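/- Let $m\ge 1$, let $\pi\colon E\to M$ be a fibration (a surjective smooth submersion) with $\dim M=m$, $\dim E=m+n$, and let $\eta$ be a volume form on $M$. Adapted coordinates are denoted $(x^i,u^\alpha)$. *Notation.* $J^1\pi$ is the first jet manifold of $\pi$, with coordinates $(x^i,u^\alpha,u^\alpha_i)$ and projections $\pi_{1,0}\colon J^1\pi\to E$, $\pi_1\colon J^1\pi\to M$; $J^1\pi_1$ is the first jet manifold of $\pi_1$, with coordinates $(x^i,u^\alpha,u^\alpha_i,\bar u^\alpha_j,u^\alpha_{ij})$. For a fibration $P\to M$, $\Lambda^k_2P$ is the bundle of $k$-forms on $P$ which vanish when two of their arguments are vertical over $M$. Let $\nu\colon\Lambda^m_2E\to E$, with coordinates $(x^i,u^\alpha,p,p^i_\alpha)$ for the form $p\,d^mx+p^i_\alpha\,du^\alpha\wedge d^{m-1}x_i$, where $d^{m-1}x_i=\iota_{\partial/\partial x^i}d^mx$. The jet manifold $J^1(\pi\circ\nu)$ has coordinates $(x^i,u^\alpha,p,p^i_\alpha,u^\alpha_j,p_j,p^i_{\alpha j})$ and is a vector bundle over $J^1\pi$ with projection $j^1\nu$,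 where $a\,j^1_x\theta_1+b\,j^1_x\theta_2=j^1_x(a\theta_1+b\theta_2)$ for sections with $\nu\circ\theta_1=\nu\circ\theta_2$. *Construction.* Let $\nabla$ be a symmetric (torsion-free) linear connection on $M$, or on an open subset of $M$ (the construction is then made over that subset), with Christoffel symbols $\nabla_{\partial_j}\partial_i=\Gamma^k_{ji}\partial_k$. The exchange map $ex_\nabla\colon J^1\pi_1\to J^1\pi_1$ is given in adapted coordinates by $$ex_\nabla(x^i,u^\alpha,u^\alpha_i,\bar u^\alpha_j,u^\alpha_{ij})=(x^i,u^\alpha,\bar u^\alpha_i,u^\alpha_j,u^\alpha_{ji}+(\bar u^\alpha_k-u^\alpha_k)\Gamma^k_{ji}).$$ For a function $f$ on $M$ the 1-form $d^{\nabla,\eta}f$ is defined by $d^{\nabla,\eta}f\otimes\eta=\nabla(f\eta)$. The pairing of $\omega\in\Lambda^m_2E$ with $j^1_x\phi\in J^1\pi$ over the same point of $E$ is defined by $\phi^*_x\omega=\langle\omega,j^1_x\phi\rangle\,\eta(x)$, and for jets with $j^1\nu(j^1_x\theta)=j^1(\pi_{1,0})(j^1_x\sigma)$ one sets $d^{\nabla,\eta}\langle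 j^1_x\theta,j^1_x\sigma\rangle=(d^{\nabla,\eta}\langle\theta,\sigma\rangle)(x)$, where $\theta,\sigma$ represent the jets and $\nu\circ\theta=\pi_{1,0}\circ\sigma$. For $w\in J^1(\pi\circ\nu)$ with $z=j^1\nu(w)\in J^1\pi$ and $x=\pi_1(z)$, consider $$J^1_z\pi_1\to T^*_xM,\qquad y\mapsto d^{\nabla,\eta}\langle w,ex_\nabla(y)\rangle ,$$ where $J^1_z\pi_1$ is the fibre of $J^1\pi_1\to J^1\pi$, $j^1_x\sigma\mapsto\sigma(x)$. Identify affine functions $f$ on $J^1_z\pi_1$ with forms $\omega\in\Lambda^m_2(T_zJ^1\pi)$ by $y^*\omega=f(y)\,\eta(x)$, so that affine maps $J^1_z\pi_1\to T_x^*M$ become elements of $\Lambda^m_2(T_zJ^1\pi)\otimes T^*_xM$, and apply the morphism $\Lambda^m_2J^1\pi\otimes_{J^1\pi}\pi_1^*T^*M\to\Lambda^{m+1}_2J^1\pi$, $\omega\otimes\lambda\mapsto-\lambda\wedge\omega=(-1)^{m+1}\omega\wedge\lambda$, given by the wedge product. The resulting element of $\Lambda^{m+1}_2(T_zJ^1\pi)$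 is $A^\eta_\pi(w)$. **Theorem.** The exchange map $ex_\nabla$ is well defined: its expression above holds in every system of adapted coordinates. For every $w$ and every $\nabla$ defined near $\pi_1(j^1\nu(w))$ there is exactly one element of $\Lambda^m_2(T_zJ^1\pi)\otimes T^*_xM$ corresponding to the map $y\mapsto d^{\nabla,\eta}\langle w,ex_\nabla(y)\rangle$ (with $d^{\nabla,\eta}\langle w,ex_\nabla(y)\rangle$ independent of the representing sections). The construction thus defines a unique map, the Tulczyjew morphism $$A^\eta_\pi\colon J^1(\pi\circ\nu)\to\Lambda^{m+1}_2J^1\pi ,$$ which is the same for all symmetric linear connections $\nabla$, and so depends only on $\pi$ and $\eta$. It is a smooth vector bundle epimorphism over the identity of $J^1\pi$, and in every system of adapted coordinates it is given by $$A^\eta_\pi(x^i,u^\alpha,p,p^i_\alpha,u^\alpha_j,p_j,p^i_{\alpha j})=(p^i_{\alpha i}\,du^\alpha+p^i_\alpha\,du^\alpha_i)\wedge d^mx$$ at the point $(x^i,u^\alpha,u^\alpha_i)$ of $J^1\pi$. -/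

import Mathlib

open Set Filter Topology Manifold
open scoped ContDiff

noncomputable section

/-- The differential of a map between manifolds modelled on normed spaces, where the tangent spaces
are regarded as copies of the model spaces. -/
def tmap {A B X Y : Type*} [NormedAddCommGroup A] [NormedSpace ℝ A] [NormedAddCommGroup B]
    [NormedSpace ℝ B] [TopologicalSpace X] [ChartedSpace A X] [TopologicalSpace Y]
    [ChartedSpace B Y] (f : X → Y) (x : X) : A →L[ℝ] B :=
  mfderiv 𝓘(ℝ, A) 𝓘(ℝ, B) f x

section Fibration

variable {V M : Type*} [NormedAddCommGroup V] [NormedSpace ℝ V] [TopologicalSpace M]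
  [ChartedSpace V M]
variable {F P : Type*} [NormedAddCommGroup F] [NormedSpace ℝ F] [TopologicalSpace P]
  [ChartedSpace (V × F) P]

variable (V F) in
/-- A fibration: a surjective smooth submersion `π : P → M`, where `M` is modelled on `V` and `P`
on `V × F`. -/
class IsFibration (π : P → M) : Prop where
  surjective : Function.Surjective π
  submersion : IsSubmersionOfComplement F 𝓘(ℝ, V × F) 𝓘(ℝ, V) ∞ π

variable (V F) in
/-- A system of fibred (adapted) coordinates `(x, u)` for `π : P → M`. -/
structure FiberedChart (π : P → M) where
  κ : OpenPartialHomeomorph P (V × F)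
  ψ : OpenPartialHomeomorph M V
  mem_κ : κ ∈ IsManifold.maximalAtlas 𝓘(ℝ, V × F) ∞ P
  mem_ψ : ψ ∈ IsManifold.maximalAtlas 𝓘(ℝ, V) ∞ M
  mapsTo : ∀ p ∈ κ.source, π p ∈ ψ.source
  fst_κ : ∀ p ∈ κ.source, (κ p).1 = ψ (π p)

variable {π : P → M}

variable (V F) in
theorem exists_fiberedChart [IsManifold 𝓘(ℝ, V × F) ∞ P] [h : IsFibration V F π] (p : P) :
    ∃ c : FiberedChart V F π, p ∈ c.κ.source := by
  have hp : IsSubmersionAtOfComplement F 𝓘(ℝ, V × F) 𝓘(ℝ, V) ∞ π p := h.submersion p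
  let e := hp.equiv.toHomeomorph.toOpenPartialHomeomorph
  refine ⟨⟨hp.domChart.trans e, hp.codChart, ?_, hp.codChart_mem_maximalAtlas, ?_, ?_⟩, ?_⟩
  · have hs : ContMDiff 𝓘(ℝ, V × F) 𝓘(ℝ, V × F) ∞ hp.equiv :=
      hp.equiv.contDiff.contMDiff
    have hs' : ContMDiff 𝓘(ℝ, V × F) 𝓘(ℝ, V × F) ∞ hp.equiv.symm :=
      hp.equiv.symm.contDiff.contMDiff
    have hmk : ∀ φ : OpenPartialHomeomorph P (V × F),
        ContMDiffOn 𝓘(ℝ, V × F) 𝓘(ℝ, V × F) ∞ φ φ.source →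
        ContMDiffOn 𝓘(ℝ, V × F) 𝓘(ℝ, V × F) ∞ φ.symm φ.target →
        φ ∈ IsManifold.maximalAtlas 𝓘(ℝ, V × F) ∞ P :=
      fun φ h1 h2 => φ.mem_maximalAtlas_of_contMDiffOn h1 h2
    refine hmk _ ?_ ?_
    · refine (hs.comp_contMDiffOn
        (contMDiffOn_of_mem_maximalAtlas hp.domChart_mem_maximalAtlas)).mono ?_
      intro x hx; simpa [e] using hx
    · refine (contMDiffOn_symm_of_mem_maximalAtlas hp.domChart_mem_maximalAtlas).comp
        hs'.contMDiffOn ?_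
      intro x hx; simpa [e] using hx
  · intro q hq
    exact hp.source_subset_preimage_source (by simpa [e] using hq)
  · intro q hq
    have hq' : q ∈ hp.domChart.source := by simpa [e] using hq
    have ht : hp.domChart q ∈ (hp.domChart.extend 𝓘(ℝ, V × F)).target := by
      simpa using hp.domChart.map_source hq'
    have := hp.writtenInCharts ht
    simpa [hq', e] using this.symm
  · simpa [e] using hp.mem_domChart_source

variable (V F) in
/-- A chosen system of fibred coordinates around a point. -/
def fiberedChartAt [IsManifold 𝓘(ℝ, V × F) ∞ P] (π : P → M) [IsFibration V F π] (p : P) :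
    FiberedChart V F π :=
  (exists_fiberedChart V F (π := π) p).choose

theorem mem_fiberedChartAt [IsManifold 𝓘(ℝ, V × F) ∞ P] [IsFibration V F π] (p : P) :
    p ∈ (fiberedChartAt V F π p).κ.source :=
  (exists_fiberedChart V F (π := π) p).choose_spec

end Fibration

section Bundle

variable {V M : Type*} [NormedAddCommGroup V] [NormedSpace ℝ V] [TopologicalSpace M]
  [ChartedSpace V M]
variable {F P : Type*} [NormedAddCommGroup F] [NormedSpace ℝ F] [TopologicalSpace P]
  [ChartedSpace (V × F) P]

variable (V F) in
/-- A family of bundle charts on a set `Q` over `P`, one for each system of fibred coordinates of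
`π : P → M`, with model fibre `G` and smooth transition maps. -/
structure BundleCharts (π : P → M) (G : Type*) [NormedAddCommGroup G] [NormedSpace ℝ G]
    {Q : Type*} (q : Q → P) where
  e : FiberedChart V F π → PartialEquiv Q (V × (F × G))
  source_eq : ∀ c, (e c).source = q ⁻¹' c.κ.source
  mem_target : ∀ c y, y ∈ (e c).target ↔ (y.1, y.2.1) ∈ c.κ.target
  fst_eq : ∀ c, ∀ z ∈ (e c).source, ((e c z).1, (e c z).2.1) = c.κ (q z)
  smooth : ∀ c c', ContDiffOn ℝ ∞ (e c' ∘ (e c).symm) ((e c).symm.trans (e c')).source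

namespace BundleCharts

variable {π : P → M} {G : Type*} [NormedAddCommGroup G] [NormedSpace ℝ G]
    {Q : Type*} {q : Q → P} (B : BundleCharts V F π G q)

theorem q_symm (B : BundleCharts V F π G q) (c : FiberedChart V F π) {y : V × (F × G)} (hy : y ∈ (B.e c).target) :
    q ((B.e c).symm y) = c.κ.symm (y.1, y.2.1) := by
  have h1 := (B.e c).map_target hy
  have h2 := B.fst_eq c _ h1
  rw [(B.e c).right_inv hy] at h2
  rw [B.source_eq] at h1
  rw [h2, c.κ.left_inv h1]

variable [IsManifold 𝓘(ℝ, V × F) ∞ P] [IsFibration V F π]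

/-- The charted space data of a set with bundle charts. -/
def core : ChartedSpaceCore (V × (F × G)) Q where
  atlas := range B.e
  chartAt z := B.e (fiberedChartAt V F π (q z))
  mem_chart_source z := by
    rw [B.source_eq]; exact mem_fiberedChartAt _
  chart_mem_atlas z := mem_range_self _
  open_source := by
    rintro _ _ ⟨c, rfl⟩ ⟨c', rfl⟩
    have : ((B.e c).symm.trans (B.e c')).source =
        (fun y : V × (F × G) => (y.1, y.2.1)) ⁻¹' (c.κ.symm.trans c'.κ).source := by
      ext y
      simp only [PartialEquiv.trans_source, PartialEquiv.symm_source, mem_inter_iff, mem_preimage,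
        OpenPartialHomeomorph.trans_source, OpenPartialHomeomorph.symm_source, ← B.mem_target]
      refine and_congr_right fun hy => ?_
      rw [B.source_eq, mem_preimage, B.q_symm c hy]
    rw [this]
    exact (c.κ.symm.trans c'.κ).open_source.preimage (by fun_prop)
  continuousOn_toFun := by
    rintro _ _ ⟨c, rfl⟩ ⟨c', rfl⟩
    exact (B.smooth c c').continuousOn

/-- The topology of the total space. -/
@[reducible]
def topology : TopologicalSpace Q := B.core.toTopologicalSpace

/-- The charted space structure of the total space. -/
@[reducible]
def charted : @ChartedSpace (V × (F × G)) _ Q B.topology := B.core.toChartedSpace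

/-- The chart of the total space over a fibred chart. -/
def chart (c : FiberedChart V F π) :
    letI := B.topology
    OpenPartialHomeomorph Q (V × (F × G)) :=
  B.core.openPartialHomeomorph (B.e c) (mem_range_self c)

theorem mem_atlas (c : FiberedChart V F π) :
    letI := B.topology
    letI := B.charted
    B.chart c ∈ atlas (V × (F × G)) Q := by
  refine mem_iUnion.2 ⟨B.e c, mem_iUnion.2 ⟨mem_range_self c, rfl⟩⟩

theorem isManifold :
    letI := B.topology
    letI := B.charted
    IsManifold 𝓘(ℝ, V × (F × G)) ∞ Q := by
  let := B.topology
  let := B.charted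
  refine isManifold_of_contDiffOn _ _ _ ?_
  intro e e' he he'
  obtain ⟨_, he⟩ := mem_iUnion.1 he
  obtain ⟨⟨c, rfl⟩, rfl⟩ := mem_iUnion.1 he
  obtain ⟨_, he'⟩ := mem_iUnion.1 he'
  obtain ⟨⟨c', rfl⟩, rfl⟩ := mem_iUnion.1 he'
  simpa using! B.smooth c c'

theorem chart_mem_maximalAtlas (c : FiberedChart V F π) :
    letI := B.topology
    letI := B.charted
    B.chart c ∈ IsManifold.maximalAtlas 𝓘(ℝ, V × (F × G)) ∞ Q := by
  let := B.topology
  let := B.charted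
  have := B.isManifold
  exact IsManifold.subset_maximalAtlas (B.mem_atlas c)

/-- The fibred chart of `π ∘ q` given by a bundle chart. -/
def fiberedChart (c : FiberedChart V F π) :
    letI := B.topology
    letI := B.charted
    FiberedChart V (F × G) (π ∘ q) :=
  letI := B.topology
  letI := B.charted
  { κ := B.chart c
    ψ := c.ψ
    mem_κ := B.chart_mem_maximalAtlas c
    mem_ψ := c.mem_ψ
    mapsTo := fun z hz => c.mapsTo _ (by
      have : z ∈ (B.e c).source := hz
      rwa [B.source_eq] at this)
    fst_κ := fun z hz => by
      have hz' : z ∈ (B.e c).source := hz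
      have h1 := B.fst_eq c z hz'
      rw [B.source_eq] at hz'
      exact (congrArg Prod.fst h1).trans (c.fst_κ _ hz') }

theorem surjective (B : BundleCharts V F π G q) : Function.Surjective q := by
  intro p
  let c := fiberedChartAt V F π p
  have hp : p ∈ c.κ.source := mem_fiberedChartAt p
  let y : V × (F × G) := ((c.κ p).1, (c.κ p).2, 0)
  have hy : y ∈ (B.e c).target := (B.mem_target c y).2 (c.κ.map_source hp)
  exact ⟨(B.e c).symm y, by rw [B.q_symm c hy]; exact c.κ.left_inv hp⟩

theorem isFibration :
    letI := B.topology
    letI := B.charted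
    IsFibration V (F × G) (π ∘ q) := by
  let := B.topology
  let := B.charted
  refine ⟨(IsFibration.surjective V F (π := π)).comp B.surjective, fun z => ?_⟩
  let c := B.fiberedChart (fiberedChartAt V F π (q z))
  have hz : z ∈ c.κ.source := by
    change z ∈ (B.e _).source
    rw [B.source_eq]; exact mem_fiberedChartAt _
  refine IsSubmersionAtOfComplement.mk_of_charts (.refl ℝ _) c.κ c.ψ hz (c.mapsTo _ hz) c.mem_κ
    c.mem_ψ c.mapsTo ?_
  intro y hy
  have hy' : y ∈ c.κ.target := by simpa using hy
  have := c.fst_κ _ (c.κ.map_target hy')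
  rw [c.κ.right_inv hy'] at this
  simpa using this.symm

theorem contMDiff_proj :
    letI := B.topology
    letI := B.charted
    ContMDiff 𝓘(ℝ, V × (F × G)) 𝓘(ℝ, V × F) ∞ q := by
  let := B.topology
  let := B.charted
  intro z
  let c := fiberedChartAt V F π (q z)
  have hz : z ∈ (B.chart c).source := by
    change z ∈ (B.e _).source
    rw [B.source_eq]; exact mem_fiberedChartAt _
  have h1 : ContMDiffAt 𝓘(ℝ, V × (F × G)) 𝓘(ℝ, V × (F × G)) ∞ (B.chart c) z :=
    contMDiffAt_of_mem_maximalAtlas (B.chart_mem_maximalAtlas c) hz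
  have h2 : ContMDiff 𝓘(ℝ, V × (F × G)) 𝓘(ℝ, V × F) ∞
      (fun y : V × (F × G) => (y.1, y.2.1)) := by
    rw [contMDiff_iff_contDiff]; fun_prop
  have hm : (((B.chart c) z).1, ((B.chart c) z).2.1) = c.κ (q z) := B.fst_eq c z hz
  have h3 : ContMDiffAt 𝓘(ℝ, V × F) 𝓘(ℝ, V × F) ∞ c.κ.symm (((B.chart c) z).1, ((B.chart c) z).2.1) := by
    rw [hm]
    exact contMDiffAt_symm_of_mem_maximalAtlas c.mem_κ (c.κ.map_source (mem_fiberedChartAt _))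
  have h4 := h3.comp z ((h2.contMDiffAt).comp z h1)
  refine h4.congr_of_eventuallyEq ?_
  filter_upwards [(B.chart c).open_source.mem_nhds hz] with z' hz'
  have h5 := B.fst_eq c z' hz'
  have hz'' : z' ∈ (B.e c).source := hz'
  rw [B.source_eq] at hz''
  change q z' = c.κ.symm ((B.e c z').1, (B.e c z').2.1)
  rw [h5, c.κ.left_inv hz'']

end BundleCharts

end Bundle

section TangentMap

variable {A B C X Y Z : Type*} [NormedAddCommGroup A] [NormedSpace ℝ A] [NormedAddCommGroup B]
    [NormedSpace ℝ B] [NormedAddCommGroup C] [NormedSpace ℝ C] [TopologicalSpace X]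
    [ChartedSpace A X] [TopologicalSpace Y] [ChartedSpace B Y] [TopologicalSpace Z]
    [ChartedSpace C Z]

theorem tmap_comp {f : X → Y} {g : Y → Z} {x : X}
    (hg : MDifferentiableAt 𝓘(ℝ, B) 𝓘(ℝ, C) g (f x))
    (hf : MDifferentiableAt 𝓘(ℝ, A) 𝓘(ℝ, B) f x) :
    tmap (A := A) (B := C) (g ∘ f) x =
      (tmap (A := B) (B := C) g (f x)).comp (tmap (A := A) (B := B) f x) :=
  mfderiv_comp x hg hf

theorem tmap_congr {f g : X → Y} {x : X} (h : f =ᶠ[𝓝 x] g) :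
    tmap (A := A) (B := B) f x = tmap (A := A) (B := B) g x :=
  h.mfderiv_eq

theorem tmap_eq_fderiv {f : A → B} {x : A} : tmap (A := A) (B := B) f x = fderiv ℝ f x :=
  mfderiv_eq_fderiv

theorem tmap_id {x : X} : tmap (A := A) (B := A) (id : X → X) x = ContinuousLinearMap.id ℝ A :=
  mfderiv_id

variable {e : OpenPartialHomeomorph X A} {e' : OpenPartialHomeomorph X A}

theorem mdiff_chart (he : e ∈ IsManifold.maximalAtlas 𝓘(ℝ, A) ∞ X) {x : X} (hx : x ∈ e.source) :
    MDifferentiableAt 𝓘(ℝ, A) 𝓘(ℝ, A) e x :=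
  (contMDiffAt_of_mem_maximalAtlas he hx).mdifferentiableAt (by simp)

theorem mdiff_chart_symm (he : e ∈ IsManifold.maximalAtlas 𝓘(ℝ, A) ∞ X) {y : A}
    (hy : y ∈ e.target) : MDifferentiableAt 𝓘(ℝ, A) 𝓘(ℝ, A) e.symm y :=
  (contMDiffAt_symm_of_mem_maximalAtlas he hy).mdifferentiableAt (by simp)

theorem tmap_symm_comp (he : e ∈ IsManifold.maximalAtlas 𝓘(ℝ, A) ∞ X) {x : X}
    (hx : x ∈ e.source) :
    (tmap (A := A) (B := A) e.symm (e x)).comp (tmap (A := A) (B := A) e x) =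
      ContinuousLinearMap.id ℝ A := by
  rw [← tmap_comp (mdiff_chart_symm he (e.map_source hx)) (mdiff_chart he hx), ← tmap_id (x := x)]
  apply tmap_congr
  filter_upwards [e.open_source.mem_nhds hx] with y hy using e.left_inv hy

theorem tmap_comp_symm (he : e ∈ IsManifold.maximalAtlas 𝓘(ℝ, A) ∞ X) {x : X}
    (hx : x ∈ e.source) :
    (tmap (A := A) (B := A) e x).comp (tmap (A := A) (B := A) e.symm (e x)) =
      ContinuousLinearMap.id ℝ A := by
  have hx' := e.map_source hx
  have h1 : MDifferentiableAt 𝓘(ℝ, A) 𝓘(ℝ, A) e (e.symm (e x)) := by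
    rw [e.left_inv hx]; exact mdiff_chart he hx
  have h2 := tmap_comp h1 (mdiff_chart_symm he hx')
  rw [e.left_inv hx] at h2
  rw [← h2, ← tmap_id (X := A) (x := e x)]
  apply tmap_congr
  filter_upwards [e.open_target.mem_nhds hx'] with y hy using e.right_inv hy

/-- The derivative of a change of charts. -/
theorem tmap_comp_tmap_symm (he : e ∈ IsManifold.maximalAtlas 𝓘(ℝ, A) ∞ X)
    (he' : e' ∈ IsManifold.maximalAtlas 𝓘(ℝ, A) ∞ X) {x : X}
    (hx : x ∈ e.source) (hx' : x ∈ e'.source) :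
    (tmap (A := A) (B := A) e' x).comp (tmap (A := A) (B := A) e.symm (e x)) =
      fderiv ℝ (e' ∘ e.symm) (e x) := by
  have h1 : MDifferentiableAt 𝓘(ℝ, A) 𝓘(ℝ, A) e' (e.symm (e x)) := by
    rw [e.left_inv hx]; exact mdiff_chart he' hx'
  have h2 := tmap_comp h1 (mdiff_chart_symm he (e.map_source hx))
  rw [e.left_inv hx] at h2
  rw [← h2, tmap_eq_fderiv]

theorem contDiffOn_change (he : e ∈ IsManifold.maximalAtlas 𝓘(ℝ, A) ∞ X)
    (he' : e' ∈ IsManifold.maximalAtlas 𝓘(ℝ, A) ∞ X) :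
    ContDiffOn ℝ ∞ (e' ∘ e.symm) (e.symm.trans e').source := by
  have h := (contMDiffOn_of_mem_maximalAtlas he').comp
    ((contMDiffOn_symm_of_mem_maximalAtlas he).mono (t := (e.symm.trans e').source)
      (fun y hy => hy.1)) (fun y hy => hy.2)
  exact h.contDiffOn

theorem contDiffOn_fderiv_change (he : e ∈ IsManifold.maximalAtlas 𝓘(ℝ, A) ∞ X)
    (he' : e' ∈ IsManifold.maximalAtlas 𝓘(ℝ, A) ∞ X) :
    ContDiffOn ℝ ∞ (fderiv ℝ (e' ∘ e.symm)) (e.symm.trans e').source :=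
  (contDiffOn_change he he').fderiv_of_isOpen (e.symm.trans e').open_source (by simp)

end TangentMap

namespace FiberedChart

variable {V M : Type*} [NormedAddCommGroup V] [NormedSpace ℝ V] [TopologicalSpace M]
  [ChartedSpace V M]
variable {F P : Type*} [NormedAddCommGroup F] [NormedSpace ℝ F] [TopologicalSpace P]
  [ChartedSpace (V × F) P] {π : P → M} (c : FiberedChart V F π)

theorem mdiff_proj {p : P} (hp : p ∈ c.κ.source) :
    MDifferentiableAt 𝓘(ℝ, V × F) 𝓘(ℝ, V) π p := by
  have h1 : MDifferentiableAt 𝓘(ℝ, V × F) 𝓘(ℝ, V) (Prod.fst : V × F → V) (c.κ p) :=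
    differentiableAt_fst.mdifferentiableAt
  have h2 : MDifferentiableAt 𝓘(ℝ, V) 𝓘(ℝ, V) c.ψ.symm (c.κ p).1 := by
    rw [c.fst_κ p hp]; exact mdiff_chart_symm c.mem_ψ (c.ψ.map_source (c.mapsTo p hp))
  have h3 := h2.comp p (h1.comp p (mdiff_chart c.mem_κ hp))
  refine h3.congr_of_eventuallyEq ?_
  filter_upwards [c.κ.open_source.mem_nhds hp] with q hq
  simp only [Function.comp]
  rw [c.fst_κ q hq, c.ψ.left_inv (c.mapsTo q hq)]

theorem tmap_ψ_comp {p : P} (hp : p ∈ c.κ.source) :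
    (tmap (A := V) (B := V) c.ψ (π p)).comp (tmap (A := V × F) (B := V) π p) =
      (ContinuousLinearMap.fst ℝ V F).comp (tmap (A := V × F) (B := V × F) c.κ p) := by
  have h1 : MDifferentiableAt 𝓘(ℝ, V × F) 𝓘(ℝ, V) (Prod.fst : V × F → V) (c.κ p) :=
    differentiableAt_fst.mdifferentiableAt
  rw [← tmap_comp (mdiff_chart c.mem_ψ (c.mapsTo p hp)) (c.mdiff_proj hp)]
  have h2 : ContinuousLinearMap.fst ℝ V F = tmap (A := V × F) (B := V) Prod.fst (c.κ p) := by
    rw [tmap_eq_fderiv, fderiv_fst]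
  rw [h2, ← tmap_comp h1 (mdiff_chart c.mem_κ hp)]
  apply tmap_congr
  filter_upwards [c.κ.open_source.mem_nhds hp] with q hq using (c.fst_κ q hq).symm

theorem tmap_proj {p : P} (hp : p ∈ c.κ.source) :
    tmap (A := V × F) (B := V) π p = (tmap (A := V) (B := V) c.ψ.symm (c.ψ (π p))).comp
      ((ContinuousLinearMap.fst ℝ V F).comp (tmap (A := V × F) (B := V × F) c.κ p)) := by
  rw [← c.tmap_ψ_comp hp, ← ContinuousLinearMap.comp_assoc,
    tmap_symm_comp c.mem_ψ (c.mapsTo p hp), ContinuousLinearMap.id_comp]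

end FiberedChart

section Jets

variable {V M : Type*} [NormedAddCommGroup V] [NormedSpace ℝ V] [TopologicalSpace M]
  [ChartedSpace V M]
variable {F P : Type*} [NormedAddCommGroup F] [NormedSpace ℝ F] [TopologicalSpace P]
  [ChartedSpace (V × F) P]

variable (V F) in
/-- The first jet manifold `J¹π`: its elements over `p : P` are the linear maps
`z : T_{π p} M → T_p P` with `T_p π ∘ z = id`. -/
structure Jet1 (π : P → M) where
  pt : P
  map : TangentSpace 𝓘(ℝ, V) (π pt) →L[ℝ] TangentSpace 𝓘(ℝ, V × F) pt
  proj_comp : (mfderiv 𝓘(ℝ, V × F) 𝓘(ℝ, V) π pt).comp map = ContinuousLinearMap.id ℝ _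

namespace Jet1

variable {π : P → M}

/-- The linear map of a jet, read in the model spaces. -/
def lin (z : Jet1 V F π) : V →L[ℝ] V × F := z.map

theorem ext' {z z' : Jet1 V F π} (h : z.pt = z'.pt) (h' : z.lin = z'.lin) : z = z' := by
  cases z; cases z'; simp only at h; subst h; simp only [lin] at h'; subst h'; rfl

theorem tmap_comp_lin (z : Jet1 V F π) :
    (tmap (A := V × F) (B := V) π z.pt).comp z.lin = ContinuousLinearMap.id ℝ V :=
  z.proj_comp

/-- The jet at `p` whose matrix of derivatives in a fibred chart is `a`. -/
def ofCoord (c : FiberedChart V F π) (p : P) (hp : p ∈ c.κ.source) (a : V →L[ℝ] F) :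
    Jet1 V F π where
  pt := p
  map := (tmap (A := V × F) (B := V × F) c.κ.symm (c.κ p)).comp
    (((ContinuousLinearMap.id ℝ V).prod a).comp (tmap (A := V) (B := V) c.ψ (π p)))
  proj_comp := by
    change (tmap (A := V × F) (B := V) π p).comp ((tmap (A := V × F) (B := V × F) c.κ.symm
      (c.κ p)).comp (((ContinuousLinearMap.id ℝ V).prod a).comp
        (tmap (A := V) (B := V) c.ψ (π p)))) = ContinuousLinearMap.id ℝ V
    have h1 := tmap_comp_symm c.mem_κ hp
    have h2 := tmap_symm_comp c.mem_ψ (c.mapsTo p hp)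
    rw [c.tmap_proj hp]
    ext v : 1
    have h1' := fun w => DFunLike.congr_fun h1 w
    have h2' := fun w => DFunLike.congr_fun h2 w
    simp only [ContinuousLinearMap.comp_apply, ContinuousLinearMap.id_apply] at h1' h2' ⊢
    rw [h1']
    simpa using h2' v

/-- The matrix of derivatives `(∂u^α/∂x^i)` of a jet in a fibred chart. -/
def coord (c : FiberedChart V F π) (z : Jet1 V F π) : V →L[ℝ] F :=
  (ContinuousLinearMap.snd ℝ V F).comp ((tmap (A := V × F) (B := V × F) c.κ z.pt).comp
    (z.lin.comp (tmap (A := V) (B := V) c.ψ.symm (c.ψ (π z.pt)))))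

theorem prod_coord (c : FiberedChart V F π) (z : Jet1 V F π) (hz : z.pt ∈ c.κ.source) :
    (ContinuousLinearMap.id ℝ V).prod (z.coord c) =
      (tmap (A := V × F) (B := V × F) c.κ z.pt).comp
        (z.lin.comp (tmap (A := V) (B := V) c.ψ.symm (c.ψ (π z.pt)))) := by
  have h1 := c.tmap_ψ_comp hz
  have h2 := z.tmap_comp_lin
  have h3 := tmap_comp_symm c.mem_ψ (c.mapsTo _ hz)
  ext v : 1
  have h1' := fun w => DFunLike.congr_fun h1 w
  have h2' := fun w => DFunLike.congr_fun h2 w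
  have h3' := fun w => DFunLike.congr_fun h3 w
  simp only [ContinuousLinearMap.comp_apply, ContinuousLinearMap.id_apply] at h1' h2' h3' ⊢
  refine Prod.ext ?_ rfl
  have := h1' (z.lin (tmap (A := V) (B := V) c.ψ.symm (c.ψ (π z.pt)) v))
  rw [h2', h3'] at this
  simpa using this

theorem ofCoord_coord (c : FiberedChart V F π) (z : Jet1 V F π) (hz : z.pt ∈ c.κ.source) :
    ofCoord c z.pt hz (z.coord c) = z := by
  refine ext' rfl ?_
  change (tmap (A := V × F) (B := V × F) c.κ.symm (c.κ z.pt)).comp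
    (((ContinuousLinearMap.id ℝ V).prod (z.coord c)).comp
      (tmap (A := V) (B := V) c.ψ (π z.pt))) = z.lin
  rw [prod_coord c z hz]
  have h1 := tmap_symm_comp c.mem_κ hz
  have h3 := tmap_symm_comp c.mem_ψ (c.mapsTo _ hz)
  ext v : 1
  have h1' := fun w => DFunLike.congr_fun h1 w
  have h3' := fun w => DFunLike.congr_fun h3 w
  simp only [ContinuousLinearMap.comp_apply, ContinuousLinearMap.id_apply] at h1' h3' ⊢
  rw [h1', h3']

theorem coord_ofCoord' (c c' : FiberedChart V F π) (p : P) (hp : p ∈ c.κ.source)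
    (hp' : p ∈ c'.κ.source) (a : V →L[ℝ] F) :
    (ofCoord c p hp a).coord c' = (ContinuousLinearMap.snd ℝ V F).comp
      ((fderiv ℝ (c'.κ ∘ c.κ.symm) (c.κ p)).comp
        (((ContinuousLinearMap.id ℝ V).prod a).comp
          (fderiv ℝ (c.ψ ∘ c'.ψ.symm) (c'.κ p).1))) := by
  rw [← tmap_comp_tmap_symm c.mem_κ c'.mem_κ hp hp', c'.fst_κ p hp',
    ← tmap_comp_tmap_symm c'.mem_ψ c.mem_ψ (c'.mapsTo p hp') (c.mapsTo p hp)]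
  rfl

theorem coord_ofCoord (c : FiberedChart V F π) (p : P) (hp : p ∈ c.κ.source) (a : V →L[ℝ] F) :
    (ofCoord c p hp a).coord c = a := by
  have h1 := tmap_comp_symm c.mem_κ hp
  have h2 := tmap_comp_symm c.mem_ψ (c.mapsTo p hp)
  ext v : 1
  have h1' := fun w => DFunLike.congr_fun h1 w
  have h2' := fun w => DFunLike.congr_fun h2 w
  simp only [ContinuousLinearMap.comp_apply, ContinuousLinearMap.id_apply] at h1' h2'
  change (tmap (A := V × F) (B := V × F) c.κ p (tmap (A := V × F) (B := V × F) c.κ.symm (c.κ p)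
    (((ContinuousLinearMap.id ℝ V).prod a) (tmap (A := V) (B := V) c.ψ (π p)
      (tmap (A := V) (B := V) c.ψ.symm (c.ψ (π p)) v))))).2 = a v
  rw [h1', h2']
  rfl

open Classical in
/-- The coordinates `(x, u, ∂u/∂x)` induced on `J¹π` by a fibred chart. -/
def jetEquiv [IsManifold 𝓘(ℝ, V × F) ∞ P] [IsFibration V F π] (c : FiberedChart V F π) :
    PartialEquiv (Jet1 V F π) (V × (F × (V →L[ℝ] F))) where
  toFun z := ((c.κ z.pt).1, (c.κ z.pt).2, z.coord c)
  invFun y :=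
    if h : (y.1, y.2.1) ∈ c.κ.target then
      ofCoord c (c.κ.symm (y.1, y.2.1)) (c.κ.map_target h) y.2.2
    else
      ofCoord (fiberedChartAt V F π (c.κ.symm (y.1, y.2.1))) _ (mem_fiberedChartAt _) 0
  source := pt ⁻¹' c.κ.source
  target := {y | (y.1, y.2.1) ∈ c.κ.target}
  map_source' z hz := c.κ.map_source hz
  map_target' y hy := by
    have hy' : (y.1, y.2.1) ∈ c.κ.target := hy
    simp only [hy', dif_pos, mem_preimage]
    exact c.κ.map_target hy'
  left_inv' z hz := by
    have hz' : z.pt ∈ c.κ.source := hz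
    have h : ((c.κ z.pt).1, (c.κ z.pt).2) ∈ c.κ.target := c.κ.map_source hz'
    simp only [h, dif_pos]
    have h2 : c.κ.symm ((c.κ z.pt).1, (c.κ z.pt).2) = z.pt := c.κ.left_inv hz'
    have h3 : ∀ (p : P) (hp : p ∈ c.κ.source), p = z.pt → ofCoord c p hp (z.coord c) = z := by
      rintro p hp rfl; exact ofCoord_coord c z hp
    exact h3 _ _ h2
  right_inv' y hy := by
    have hy' : (y.1, y.2.1) ∈ c.κ.target := hy
    simp only [hy', dif_pos, coord_ofCoord]
    change ((c.κ (c.κ.symm (y.1, y.2.1))).1, (c.κ (c.κ.symm (y.1, y.2.1))).2, y.2.2) = y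
    rw [c.κ.right_inv hy']

theorem jetEquiv_symm [IsManifold 𝓘(ℝ, V × F) ∞ P] [IsFibration V F π] (c : FiberedChart V F π)
    (y : V × (F × (V →L[ℝ] F))) (h : (y.1, y.2.1) ∈ c.κ.target) :
    (jetEquiv c).symm y = ofCoord c (c.κ.symm (y.1, y.2.1)) (c.κ.map_target h) y.2.2 := by
  simp only [jetEquiv, PartialEquiv.symm, PartialEquiv.coe_mk, h, dif_pos]

variable [IsManifold 𝓘(ℝ, V × F) ∞ P] [IsFibration V F π]

/-- The bundle charts of `J¹π → P`. -/
def bundleCharts (π : P → M) [IsFibration V F π] :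
    BundleCharts V F π (V →L[ℝ] F) (pt : Jet1 V F π → P) where
  e := jetEquiv
  source_eq _ := rfl
  mem_target _ _ := Iff.rfl
  fst_eq _ _ _ := rfl
  smooth c c' := by
    have hs : ∀ y ∈ ((jetEquiv c).symm.trans (jetEquiv c')).source,
        (y.1, y.2.1) ∈ (c.κ.symm.trans c'.κ).source := by
      intro y hy
      have hy1 : (y.1, y.2.1) ∈ c.κ.target := hy.1
      have hy2 : ((jetEquiv c).symm y).pt ∈ c'.κ.source := hy.2
      rw [jetEquiv_symm c y hy1] at hy2
      exact ⟨hy1, hy2⟩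
    have hm : MapsTo (fun y : V × (F × (V →L[ℝ] F)) => (y.1, y.2.1))
        ((jetEquiv c).symm.trans (jetEquiv c')).source (c.κ.symm.trans c'.κ).source := hs
    have hΦ : ContDiffOn ℝ ∞ (fun y : V × (F × (V →L[ℝ] F)) =>
        (c'.κ ∘ c.κ.symm) (y.1, y.2.1)) ((jetEquiv c).symm.trans (jetEquiv c')).source :=
      (contDiffOn_change c.mem_κ c'.mem_κ).comp (by fun_prop) hm
    have hdΦ : ContDiffOn ℝ ∞ (fun y : V × (F × (V →L[ℝ] F)) =>
        fderiv ℝ (c'.κ ∘ c.κ.symm) (y.1, y.2.1)) ((jetEquiv c).symm.trans (jetEquiv c')).source :=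
      (contDiffOn_fderiv_change c.mem_κ c'.mem_κ).comp
        (f := fun y : V × (F × (V →L[ℝ] F)) => (y.1, y.2.1)) (by fun_prop) hm
    have hψ : ContDiffOn ℝ ∞ (fun y : V × (F × (V →L[ℝ] F)) =>
        fderiv ℝ (c.ψ ∘ c'.ψ.symm) ((c'.κ ∘ c.κ.symm) (y.1, y.2.1)).1)
        ((jetEquiv c).symm.trans (jetEquiv c')).source := by
      refine (contDiffOn_fderiv_change c'.mem_ψ c.mem_ψ).comp hΦ.fst ?_
      intro y hy
      have h := hs y hy
      simp only [OpenPartialHomeomorph.trans_source, OpenPartialHomeomorph.symm_source,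
        mem_inter_iff, mem_preimage] at h ⊢
      simp only [Function.comp]
      have h4 := c'.fst_κ _ h.2
      rw [h4]
      have h5 := c'.mapsTo _ h.2
      refine ⟨c'.ψ.map_source h5, ?_⟩
      rw [c'.ψ.left_inv h5]
      exact c.mapsTo _ (c.κ.map_target h.1)
    have hA : ContDiffOn ℝ ∞ (fun y : V × (F × (V →L[ℝ] F)) =>
        (ContinuousLinearMap.id ℝ V).prod y.2.2)
        ((jetEquiv c).symm.trans (jetEquiv c')).source := by
      have : (fun y : V × (F × (V →L[ℝ] F)) => (ContinuousLinearMap.id ℝ V).prod y.2.2) =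
          fun y => (ContinuousLinearMap.inl ℝ V F) +
            (ContinuousLinearMap.inr ℝ V F).comp y.2.2 := by
        funext y; ext v <;> simp
      rw [this]
      exact (contDiff_const.add (contDiff_const.clm_comp (by fun_prop))).contDiffOn
    have hfin : ContDiffOn ℝ ∞ (fun y : V × (F × (V →L[ℝ] F)) =>
        (((c'.κ ∘ c.κ.symm) (y.1, y.2.1)).1, ((c'.κ ∘ c.κ.symm) (y.1, y.2.1)).2,
          (ContinuousLinearMap.snd ℝ V F).comp ((fderiv ℝ (c'.κ ∘ c.κ.symm) (y.1, y.2.1)).comp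
            (((ContinuousLinearMap.id ℝ V).prod y.2.2).comp
              (fderiv ℝ (c.ψ ∘ c'.ψ.symm) ((c'.κ ∘ c.κ.symm) (y.1, y.2.1)).1)))))
        ((jetEquiv c).symm.trans (jetEquiv c')).source :=
      hΦ.fst.prodMk (hΦ.snd.prodMk
        (contDiffOn_const.clm_comp (hdΦ.clm_comp (hA.clm_comp hψ))))
    refine hfin.congr ?_
    intro y hy
    have h := hs y hy
    simp only [OpenPartialHomeomorph.trans_source, OpenPartialHomeomorph.symm_source,
        mem_inter_iff, mem_preimage] at h
    simp only [Function.comp]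
    rw [jetEquiv_symm c y h.1]
    have h7 := coord_ofCoord' c c' (c.κ.symm (y.1, y.2.1)) (c.κ.map_target h.1) h.2 y.2.2
    rw [c.κ.right_inv h.1] at h7
    refine Prod.ext rfl (Prod.ext rfl h7)

instance : TopologicalSpace (Jet1 V F π) := (bundleCharts π).topology

instance : ChartedSpace (V × (F × (V →L[ℝ] F))) (Jet1 V F π) := (bundleCharts π).charted

instance : IsManifold 𝓘(ℝ, V × (F × (V →L[ℝ] F))) ∞ (Jet1 V F π) := (bundleCharts π).isManifold

/-- The projection `π₁ : J¹π → M`. -/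
def proj (π : P → M) : Jet1 V F π → M := π ∘ pt

instance : IsFibration V (F × (V →L[ℝ] F)) (proj π : Jet1 V F π → M) :=
  (bundleCharts π).isFibration

end Jet1

/-- The natural chart of `J¹π`, with coordinates `(x, u, ∂u/∂x)`. -/
def FiberedChart.jet {π : P → M} [IsManifold 𝓘(ℝ, V × F) ∞ P] [IsFibration V F π]
    (c : FiberedChart V F π) : FiberedChart V (F × (V →L[ℝ] F)) (Jet1.proj π : Jet1 V F π → M) :=
  (Jet1.bundleCharts π).fiberedChart c

end Jets
section HorizontalForms

variable {V W : Type*} [AddCommGroup V] [Module ℝ V] [TopologicalSpace V] [AddCommGroup W]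
  [Module ℝ W] [TopologicalSpace W]

/-- The `k`-forms on `W` which are `r`-horizontal with respect to `L : W → V`: those which vanish
as soon as `r` of their arguments are in the kernel of `L`. -/
def horizontalForms (L : W →L[ℝ] V) (k r : ℕ) : Submodule ℝ (W [⋀^Fin k]→L[ℝ] ℝ) where
  carrier := {α | ∀ (v : Fin k → W) (s : Finset (Fin k)), s.card = r → (∀ i ∈ s, L (v i) = 0) →
    α v = 0}
  add_mem' {α α'} h h' v s hs hv := by simp [h v s hs hv, h' v s hs hv]
  zero_mem' v s hs hv := rfl
  smul_mem' a α h v s hs hv := by simp [h v s hs hv]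

end HorizontalForms

section Pullback

variable {V F : Type*} [NormedAddCommGroup V] [NormedSpace ℝ V] [NormedAddCommGroup F]
  [NormedSpace ℝ F]

variable (V F) in
/-- The `r`-horizontal `k`-forms on `V × F` with respect to the projection to `V`. -/
abbrev ModelForms (k r : ℕ) : Submodule ℝ ((V × F) [⋀^Fin k]→L[ℝ] ℝ) :=
  horizontalForms (ContinuousLinearMap.fst ℝ V F) k r

instance (k r : ℕ) : NormedAddCommGroup (ModelForms V F k r) := inferInstance

instance (k r : ℕ) : NormedSpace ℝ (ModelForms V F k r) := inferInstance

theorem horizontalForms_comp {W W' V V' : Type*} [AddCommGroup V] [Module ℝ V] [TopologicalSpace V]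
    [AddCommGroup V'] [Module ℝ V'] [TopologicalSpace V'] [AddCommGroup W] [Module ℝ W]
    [TopologicalSpace W] [AddCommGroup W'] [Module ℝ W'] [TopologicalSpace W']
    {L : W →L[ℝ] V} {L' : W' →L[ℝ] V'} {k r : ℕ} {α : W [⋀^Fin k]→L[ℝ] ℝ}
    (hα : α ∈ horizontalForms L k r) (T : W' →L[ℝ] W) (hT : ∀ w, L' w = 0 → L (T w) = 0) :
    α.compContinuousLinearMap T ∈ horizontalForms L' k r := by
  intro v s hs hv
  exact hα _ s hs fun i hi => hT _ (hv i hi)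

instance [FiniteDimensional ℝ V] [FiniteDimensional ℝ F] (k : ℕ) :
    FiniteDimensional ℝ (ContinuousMultilinearMap ℝ (fun _ : Fin k => V × F) ℝ) :=
  Module.Finite.of_injective
    (ContinuousMultilinearMap.toMultilinearMapLinear (R' := ℝ) (A := ℝ)
      (M₁ := fun _ : Fin k => V × F) (M₂ := ℝ)) ContinuousMultilinearMap.toMultilinearMap_injective

instance [FiniteDimensional ℝ V] [FiniteDimensional ℝ F] (k r : ℕ) :
    FiniteDimensional ℝ (ModelForms V F k r) := by
  have : FiniteDimensional ℝ ((V × F) [⋀^Fin k]→L[ℝ] ℝ) :=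
    Module.Finite.of_injective
      ((ContinuousAlternatingMap.toContinuousMultilinearMapCLM ℝ :
        ((V × F) [⋀^Fin k]→L[ℝ] ℝ) →L[ℝ] ContinuousMultilinearMap ℝ (fun _ : Fin k => V × F) ℝ) :
        ((V × F) [⋀^Fin k]→L[ℝ] ℝ) →ₗ[ℝ] ContinuousMultilinearMap ℝ (fun _ : Fin k => V × F) ℝ)
      ContinuousAlternatingMap.toContinuousMultilinearMap_injective
  infer_instance

theorem contDiffOn_modelForms_pullback [FiniteDimensional ℝ V] [FiniteDimensional ℝ F] {k r : ℕ}
    {X : Type*} [NormedAddCommGroup X] [NormedSpace ℝ X] {s : Set X}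
    {f g : X → ModelForms V F k r} {T : X → (V × F) →L[ℝ] (V × F)}
    (hf : ContDiffOn ℝ ∞ f s) (hT : ContDiffOn ℝ ∞ T s)
    (hg : ∀ x ∈ s, (g x : (V × F) [⋀^Fin k]→L[ℝ] ℝ) =
      (f x : (V × F) [⋀^Fin k]→L[ℝ] ℝ).compContinuousLinearMap (T x)) :
    ContDiffOn ℝ ∞ g s := by
  let j : ModelForms V F k r →L[ℝ] ContinuousMultilinearMap ℝ (fun _ : Fin k => V × F) ℝ :=
    (ContinuousAlternatingMap.toContinuousMultilinearMapCLM ℝ).comp (ModelForms V F k r).subtypeL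
  have hj : Function.Injective j := fun a b h =>
    Subtype.ext (ContinuousAlternatingMap.toContinuousMultilinearMap_injective h)
  obtain ⟨p, hp⟩ : ∃ p : ContinuousMultilinearMap ℝ (fun _ : Fin k => V × F) ℝ →ₗ[ℝ]
      ModelForms V F k r, p ∘ₗ j.toLinearMap = LinearMap.id :=
    LinearMap.exists_leftInverse_of_injective (K := ℝ) (V := ModelForms V F k r)
      (V' := ContinuousMultilinearMap ℝ (fun _ : Fin k => V × F) ℝ) j.toLinearMap
      (LinearMap.ker_eq_bot_of_injective (f := j.toLinearMap) hj)
  let p' := p.toContinuousLinearMap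
  have hpj : ∀ a, p' (j a) = a := fun a => LinearMap.congr_fun hp a
  have h1 : ContDiffOn ℝ ∞ (fun x =>
      p' ((ContinuousMultilinearMap.compContinuousLinearMapContinuousMultilinear ℝ
        (fun _ : Fin k => V × F) (fun _ : Fin k => V × F) ℝ (fun _ => T x)) (j (f x)))) s := by
    refine p'.contDiff.comp_contDiffOn (ContDiffOn.clm_apply ?_ (j.contDiff.comp_contDiffOn hf))
    exact (ContinuousMultilinearMap.contDiff _).comp_contDiffOn (contDiffOn_pi.2 fun _ => hT)
  refine h1.congr fun x hx => ?_
  rw [← hpj (g x)]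
  congr 1
  ext v
  change (g x : (V × F) [⋀^Fin k]→L[ℝ] ℝ) v = _
  rw [hg x hx]
  rfl

end Pullback

section Forms

variable {V M : Type*} [NormedAddCommGroup V] [NormedSpace ℝ V] [TopologicalSpace M]
  [ChartedSpace V M]
variable {F P : Type*} [NormedAddCommGroup F] [NormedSpace ℝ F] [TopologicalSpace P]
  [ChartedSpace (V × F) P]

variable (V F) in
/-- The bundle `Λᵏᵣ P` of `k`-forms on `P` which are `r`-horizontal with respect to `π`. -/
structure HForm (π : P → M) (k r : ℕ) where
  pt : P
  form : (TangentSpace 𝓘(ℝ, V × F) pt) [⋀^Fin k]→L[ℝ] ℝ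
  horizontal : form ∈ horizontalForms (mfderiv 𝓘(ℝ, V × F) 𝓘(ℝ, V) π pt) k r

namespace HForm

variable {π : P → M} {k r : ℕ}

/-- The alternating map of a form, read in the model space. -/
def alt (α : HForm V F π k r) : (V × F) [⋀^Fin k]→L[ℝ] ℝ := α.form

theorem ext' {α α' : HForm V F π k r} (h : α.pt = α'.pt) (h' : α.alt = α'.alt) : α = α' := by
  cases α; cases α'; simp only at h; subst h; simp only [alt] at h'; subst h'; rfl

/-- The form at `p` whose expression in a fibred chart is `a`. -/
def ofCoord (c : FiberedChart V F π) (p : P) (hp : p ∈ c.κ.source) (a : ModelForms V F k r) :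
    HForm V F π k r where
  pt := p
  form := (a : (V × F) [⋀^Fin k]→L[ℝ] ℝ).compContinuousLinearMap
    (tmap (A := V × F) (B := V × F) c.κ p)
  horizontal := by
    refine horizontalForms_comp (W := V × F) (W' := V × F) (V' := V)
      (L' := tmap (A := V × F) (B := V) π p) a.2 _ ?_
    intro w hw
    have h := DFunLike.congr_fun (c.tmap_ψ_comp hp) w
    simp only [ContinuousLinearMap.comp_apply, hw, map_zero] at h
    exact h.symm

theorem tmap_symm_vertical (c : FiberedChart V F π) {p : P} (hp : p ∈ c.κ.source) (w : V × F)
    (hw : w.1 = 0) :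
    tmap (A := V × F) (B := V) π p (tmap (A := V × F) (B := V × F) c.κ.symm (c.κ p) w) = 0 := by
  have h1 := DFunLike.congr_fun (tmap_comp_symm c.mem_κ hp) w
  rw [c.tmap_proj hp]
  simp only [ContinuousLinearMap.comp_apply, ContinuousLinearMap.id_apply] at h1 ⊢
  rw [h1]
  simp [hw]

open Classical in
/-- The expression of a form in a fibred chart (zero outside of the domain of the chart). -/
def coord (c : FiberedChart V F π) (α : HForm V F π k r) : ModelForms V F k r :=
  if h : α.pt ∈ c.κ.source then
    ⟨α.alt.compContinuousLinearMap (tmap (A := V × F) (B := V × F) c.κ.symm (c.κ α.pt)),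
      horizontalForms_comp (W := V × F) (W' := V × F) (V := V)
        (L := tmap (A := V × F) (B := V) π α.pt) α.horizontal _
        (fun w hw => tmap_symm_vertical c h w hw)⟩
  else 0

theorem coord_of_mem (c : FiberedChart V F π) (α : HForm V F π k r) (h : α.pt ∈ c.κ.source) :
    (α.coord c : (V × F) [⋀^Fin k]→L[ℝ] ℝ) =
      α.alt.compContinuousLinearMap (tmap (A := V × F) (B := V × F) c.κ.symm (c.κ α.pt)) := by
  simp [coord, h]

theorem ofCoord_coord (c : FiberedChart V F π) (α : HForm V F π k r) (h : α.pt ∈ c.κ.source) :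
    ofCoord c α.pt h (α.coord c) = α := by
  refine ext' rfl ?_
  have h1 := tmap_symm_comp c.mem_κ h
  change (α.coord c : (V × F) [⋀^Fin k]→L[ℝ] ℝ).compContinuousLinearMap
    (tmap (A := V × F) (B := V × F) c.κ α.pt) = α.alt
  rw [coord_of_mem c α h]
  ext v
  have h1' := fun w => DFunLike.congr_fun h1 w
  simp only [ContinuousLinearMap.comp_apply, ContinuousLinearMap.id_apply] at h1'
  simp only [ContinuousAlternatingMap.compContinuousLinearMap_apply]
  congr 1
  funext i
  exact h1' (v i)

theorem coord_ofCoord' (c c' : FiberedChart V F π) (p : P) (hp : p ∈ c.κ.source)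
    (hp' : p ∈ c'.κ.source) (a : ModelForms V F k r) :
    ((ofCoord c p hp a).coord c' : (V × F) [⋀^Fin k]→L[ℝ] ℝ) =
      (a : (V × F) [⋀^Fin k]→L[ℝ] ℝ).compContinuousLinearMap
        (fderiv ℝ (c.κ ∘ c'.κ.symm) (c'.κ p)) := by
  rw [coord_of_mem c' _ hp', ← tmap_comp_tmap_symm c'.mem_κ c.mem_κ hp' hp]
  rfl

theorem coord_ofCoord (c : FiberedChart V F π) (p : P) (hp : p ∈ c.κ.source)
    (a : ModelForms V F k r) : (ofCoord c p hp a).coord c = a := by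
  apply Subtype.ext
  rw [coord_of_mem c _ hp]
  have h1 := tmap_comp_symm c.mem_κ hp
  have h1' := fun w => DFunLike.congr_fun h1 w
  simp only [ContinuousLinearMap.comp_apply, ContinuousLinearMap.id_apply] at h1'
  ext v
  change (a : (V × F) [⋀^Fin k]→L[ℝ] ℝ) _ = (a : (V × F) [⋀^Fin k]→L[ℝ] ℝ) v
  congr 1
  funext i
  exact h1' (v i)

open Classical in
/-- The coordinates induced on `Λᵏᵣ P` by a fibred chart. -/
def formEquiv [IsManifold 𝓘(ℝ, V × F) ∞ P] [IsFibration V F π] (c : FiberedChart V F π) :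
    PartialEquiv (HForm V F π k r) (V × (F × ModelForms V F k r)) where
  toFun α := ((c.κ α.pt).1, (c.κ α.pt).2, α.coord c)
  invFun y :=
    if h : (y.1, y.2.1) ∈ c.κ.target then
      ofCoord c (c.κ.symm (y.1, y.2.1)) (c.κ.map_target h) y.2.2
    else
      ⟨c.κ.symm (y.1, y.2.1), 0, Submodule.zero_mem _⟩
  source := pt ⁻¹' c.κ.source
  target := {y | (y.1, y.2.1) ∈ c.κ.target}
  map_source' z hz := c.κ.map_source hz
  map_target' y hy := by
    have hy' : (y.1, y.2.1) ∈ c.κ.target := hy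
    simp only [hy', dif_pos, mem_preimage]
    exact c.κ.map_target hy'
  left_inv' z hz := by
    have hz' : z.pt ∈ c.κ.source := hz
    have h : ((c.κ z.pt).1, (c.κ z.pt).2) ∈ c.κ.target := c.κ.map_source hz'
    simp only [h, dif_pos]
    have h2 : c.κ.symm ((c.κ z.pt).1, (c.κ z.pt).2) = z.pt := c.κ.left_inv hz'
    have h3 : ∀ (p : P) (hp : p ∈ c.κ.source), p = z.pt → ofCoord c p hp (z.coord c) = z := by
      rintro p hp rfl; exact ofCoord_coord c z hp
    exact h3 _ _ h2
  right_inv' y hy := by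
    have hy' : (y.1, y.2.1) ∈ c.κ.target := hy
    simp only [hy', dif_pos, coord_ofCoord]
    change ((c.κ (c.κ.symm (y.1, y.2.1))).1, (c.κ (c.κ.symm (y.1, y.2.1))).2, y.2.2) = y
    rw [c.κ.right_inv hy']

theorem formEquiv_symm [IsManifold 𝓘(ℝ, V × F) ∞ P] [IsFibration V F π] (c : FiberedChart V F π)
    (y : V × (F × ModelForms V F k r)) (h : (y.1, y.2.1) ∈ c.κ.target) :
    (formEquiv c).symm y = ofCoord c (c.κ.symm (y.1, y.2.1)) (c.κ.map_target h) y.2.2 := by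
  simp only [formEquiv, PartialEquiv.symm, PartialEquiv.coe_mk, h, dif_pos]

variable [FiniteDimensional ℝ V] [FiniteDimensional ℝ F]
variable [IsManifold 𝓘(ℝ, V × F) ∞ P] [IsFibration V F π]

/-- The bundle charts of `Λᵏᵣ P → P`. -/
def bundleCharts (π : P → M) [IsFibration V F π] (k r : ℕ) :
    BundleCharts V F π (ModelForms V F k r) (pt : HForm V F π k r → P) where
  e := formEquiv
  source_eq _ := rfl
  mem_target _ _ := Iff.rfl
  fst_eq _ _ _ := rfl
  smooth c c' := by
    have hs : ∀ y ∈ ((formEquiv (k := k) (r := r) c).symm.trans (formEquiv c')).source,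
        (y.1, y.2.1) ∈ (c.κ.symm.trans c'.κ).source := by
      intro y hy
      have hy1 : (y.1, y.2.1) ∈ c.κ.target := hy.1
      have hy2 : ((formEquiv c).symm y).pt ∈ c'.κ.source := hy.2
      rw [formEquiv_symm c y hy1] at hy2
      exact ⟨hy1, hy2⟩
    have hm : MapsTo (fun y : V × (F × ModelForms V F k r) => (y.1, y.2.1))
        ((formEquiv c).symm.trans (formEquiv c')).source (c.κ.symm.trans c'.κ).source := hs
    have hΦ : ContDiffOn ℝ ∞ (fun y : V × (F × ModelForms V F k r) =>
        (c'.κ ∘ c.κ.symm) (y.1, y.2.1)) ((formEquiv c).symm.trans (formEquiv c')).source :=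
      (contDiffOn_change c.mem_κ c'.mem_κ).comp (by fun_prop) hm
    have hψ : ContDiffOn ℝ ∞ (fun y : V × (F × ModelForms V F k r) =>
        fderiv ℝ (c.κ ∘ c'.κ.symm) ((c'.κ ∘ c.κ.symm) (y.1, y.2.1)))
        ((formEquiv c).symm.trans (formEquiv c')).source := by
      refine (contDiffOn_fderiv_change c'.mem_κ c.mem_κ).comp hΦ ?_
      intro y hy
      have h := hs y hy
      simp only [OpenPartialHomeomorph.trans_source, OpenPartialHomeomorph.symm_source,
        mem_inter_iff, mem_preimage] at h ⊢
      simp only [Function.comp]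
      refine ⟨c'.κ.map_source h.2, ?_⟩
      rw [c'.κ.left_inv h.2]
      exact c.κ.map_target h.1
    have hfst : ContDiffOn ℝ ∞ (fun y : V × (F × ModelForms V F k r) => y.2.2)
        ((formEquiv c).symm.trans (formEquiv c')).source := by fun_prop
    have hcoord : ContDiffOn ℝ ∞ (fun y : V × (F × ModelForms V F k r) =>
        ((formEquiv c).symm y).coord c') ((formEquiv c).symm.trans (formEquiv c')).source := by
      refine contDiffOn_modelForms_pullback hfst hψ ?_
      intro y hy
      have h := hs y hy
      simp only [OpenPartialHomeomorph.trans_source, OpenPartialHomeomorph.symm_source,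
        mem_inter_iff, mem_preimage] at h
      rw [formEquiv_symm c y h.1]
      exact coord_ofCoord' c c' _ _ h.2 _
    refine (hΦ.fst.prodMk (hΦ.snd.prodMk hcoord)).congr ?_
    intro y hy
    have h := hs y hy
    simp only [OpenPartialHomeomorph.trans_source, OpenPartialHomeomorph.symm_source,
        mem_inter_iff, mem_preimage] at h
    simp only [Function.comp]
    rw [formEquiv_symm c y h.1]
    rfl

instance : TopologicalSpace (HForm V F π k r) := (bundleCharts π k r).topology

instance : ChartedSpace (V × (F × ModelForms V F k r)) (HForm V F π k r) :=
  (bundleCharts π k r).charted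

instance : IsManifold 𝓘(ℝ, V × (F × ModelForms V F k r)) ∞ (HForm V F π k r) :=
  (bundleCharts π k r).isManifold

/-- The projection `π ∘ ν : Λᵏᵣ P → M`. -/
def proj (π : P → M) (k r : ℕ) : HForm V F π k r → M := π ∘ pt

instance : IsFibration V (F × ModelForms V F k r) (proj π k r : HForm V F π k r → M) :=
  (bundleCharts π k r).isFibration

end HForm

/-- The natural chart of `Λᵏᵣ P` given by a fibred chart of `P`. -/
def FiberedChart.forms {π : P → M} [FiniteDimensional ℝ V] [FiniteDimensional ℝ F]
    [IsManifold 𝓘(ℝ, V × F) ∞ P] [IsFibration V F π]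
    (c : FiberedChart V F π) (k r : ℕ) :
    FiberedChart V (F × ModelForms V F k r) (HForm.proj π k r : HForm V F π k r → M) :=
  (HForm.bundleCharts π k r).fiberedChart c

end Forms

section Base

/-- The model space `ℝᵐ`. -/
abbrev Euc (m : ℕ) : Type := EuclideanSpace ℝ (Fin m)

/-- The `i`-th vector of the standard basis of `ℝᵐ`. -/
abbrev stdVec {m : ℕ} (i : Fin m) : Euc m := EuclideanSpace.single i 1

variable {m : ℕ} {M : Type*} [TopologicalSpace M] [ChartedSpace (Euc m) M]

variable (m M) in
/-- A volume form on the `m`-dimensional manifold `M`: a smooth nowhere vanishing `m`-form. -/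
structure VolumeForm where
  toFun : ∀ x : M, (TangentSpace 𝓘(ℝ, Euc m) x) [⋀^Fin m]→L[ℝ] ℝ
  ne_zero : ∀ x, toFun x ≠ 0
  smooth : ∀ ψ ∈ IsManifold.maximalAtlas 𝓘(ℝ, Euc m) ∞ M,
    ContDiffOn ℝ ∞ (fun v => toFun (ψ.symm v)
      (fun i => mfderiv 𝓘(ℝ, Euc m) 𝓘(ℝ, Euc m) ψ.symm v (stdVec i : Euc m))) ψ.target

/-- The vector field on the domain of the chart `ψ` whose components in `ψ` are constant, equal to
`v`; for `v = stdVec i` this is the coordinate field `∂/∂xⁱ`. -/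
def coordField (ψ : OpenPartialHomeomorph M (Euc m)) (v : Euc m) (x : M) :
    TangentSpace 𝓘(ℝ, Euc m) x :=
  tmap (A := Euc m) (B := Euc m) ψ.symm (ψ x) v

/-- The map `∇` is a smooth symmetric (torsion-free) linear connection on the subset `U` of `M`;
`∇ Y x (X x)` is `(∇_X Y)(x)`. -/
structure IsSymmetricConnectionOn [IsManifold 𝓘(ℝ, Euc m) ∞ M]
    (cov : (∀ x : M, TangentSpace 𝓘(ℝ, Euc m) x) →
      ∀ x : M, TangentSpace 𝓘(ℝ, Euc m) x →L[ℝ] TangentSpace 𝓘(ℝ, Euc m) x)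
    (U : Set M) : Prop where
  isCovariantDerivativeOn : IsCovariantDerivativeOn (Euc m) cov U
  contMDiff : ContMDiffCovariantDerivativeOn (Euc m) ∞ cov U
  torsion_eq_zero : ∀ x ∈ U, ∀ X Y : (∀ x : M, TangentSpace 𝓘(ℝ, Euc m) x),
    MDifferentiableAt 𝓘(ℝ, Euc m) 𝓘(ℝ, Euc m).tangent
      (fun y => (⟨y, X y⟩ : TangentBundle 𝓘(ℝ, Euc m) M)) x →
    MDifferentiableAt 𝓘(ℝ, Euc m) 𝓘(ℝ, Euc m).tangent
      (fun y => (⟨y, Y y⟩ : TangentBundle 𝓘(ℝ, Euc m) M)) x →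
    cov Y x (X x) - cov X x (Y x) = VectorField.mlieBracket 𝓘(ℝ, Euc m) X Y x

/-- The Christoffel symbols at `x` in the chart `ψ`, as the bilinear map
`(v, w) ↦ ∑ vʲ wⁱ Γᵏⱼᵢ ∂ₖ`, where `∇_{∂ⱼ} ∂ᵢ = Γᵏⱼᵢ ∂ₖ`. -/
def christoffel
    (cov : (∀ x : M, TangentSpace 𝓘(ℝ, Euc m) x) →
      ∀ x : M, TangentSpace 𝓘(ℝ, Euc m) x →L[ℝ] TangentSpace 𝓘(ℝ, Euc m) x)
    (ψ : OpenPartialHomeomorph M (Euc m)) (x : M) : Euc m →L[ℝ] Euc m →L[ℝ] Euc m :=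
  ∑ i : Fin m, (ContinuousLinearMap.smulRightL ℝ (Euc m) (Euc m) (EuclideanSpace.proj i)).comp
    ((tmap (A := Euc m) (B := Euc m) ψ x).comp
      ((cov (coordField ψ (stdVec i)) x : Euc m →L[ℝ] Euc m).comp
        (tmap (A := Euc m) (B := Euc m) ψ.symm (ψ x))))

/-- The linear form `X ↦ (∇_X (f η))(∂₁, …, ∂ₘ)` on `T_x M`, where
`(∇_X μ)(∂₁, …, ∂ₘ) = X (μ(∂₁, …, ∂ₘ)) - ∑ᵢ μ(∂₁, …, ∇_X ∂ᵢ, …, ∂ₘ)` and the `∂ᵢ` are the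
coordinate fields of a chart at `x`. -/
def nablaSmul
    (cov : (∀ x : M, TangentSpace 𝓘(ℝ, Euc m) x) →
      ∀ x : M, TangentSpace 𝓘(ℝ, Euc m) x →L[ℝ] TangentSpace 𝓘(ℝ, Euc m) x)
    (η : VolumeForm m M) (f : M → ℝ) (x : M) : TangentSpace 𝓘(ℝ, Euc m) x →L[ℝ] ℝ :=
  letI D : Fin m → ∀ y : M, TangentSpace 𝓘(ℝ, Euc m) y :=
    fun i => coordField (chartAt (Euc m) x) (stdVec i)
  letI df : TangentSpace 𝓘(ℝ, Euc m) x →L[ℝ] ℝ :=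
    mfderiv 𝓘(ℝ, Euc m) 𝓘(ℝ, ℝ) (fun y => f y * η.toFun y (fun i => D i y)) x
  df - ∑ i : Fin m, f x • ((η.toFun x).toContinuousMultilinearMap.toContinuousLinearMap
      (fun j => D j x) i).comp (cov (D i) x)

/-- The 1-form `d^{∇,η} f`, characterized by `d^{∇,η} f ⊗ η = ∇(f η)`. -/
def dNabla
    (cov : (∀ x : M, TangentSpace 𝓘(ℝ, Euc m) x) →
      ∀ x : M, TangentSpace 𝓘(ℝ, Euc m) x →L[ℝ] TangentSpace 𝓘(ℝ, Euc m) x)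
    (η : VolumeForm m M) (f : M → ℝ) (x : M) : TangentSpace 𝓘(ℝ, Euc m) x →L[ℝ] ℝ :=
  (η.toFun x (fun i => coordField (chartAt (Euc m) x) (stdVec i) x))⁻¹ • nablaSmul cov η f x

end Base

section Sections

variable {V M : Type*} [NormedAddCommGroup V] [NormedSpace ℝ V] [TopologicalSpace M]
  [ChartedSpace V M]
variable {F P : Type*} [NormedAddCommGroup F] [NormedSpace ℝ F] [TopologicalSpace P]
  [ChartedSpace (V × F) P] {ρ : P → M}

/-- `z = j¹ₓ σ`: the map `σ` is a smooth local section of `ρ` near `x` whose first jet at `x`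
is `z`. -/
structure IsJetOf (z : Jet1 V F ρ) (σ : M → P) (x : M) : Prop where
  isSection : ∀ᶠ y in 𝓝 x, ρ (σ y) = y
  smooth : ∀ᶠ y in 𝓝 x, ContMDiffAt 𝓘(ℝ, V) 𝓘(ℝ, V × F) ∞ σ y
  value : σ x = z.pt
  deriv : tmap (A := V) (B := V × F) σ x = z.lin

variable [FiniteDimensional ℝ V] [FiniteDimensional ℝ F] [IsManifold 𝓘(ℝ, V × F) ∞ P]
  [IsFibration V F ρ] {k r : ℕ}

/-- The prolongation `j¹ν : J¹(π ∘ ν) → J¹π` of the projection `ν : Λᵏᵣ P → P`. -/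
def Jet1.base (w : Jet1 V (F × ModelForms V F k r)
    (HForm.proj ρ k r : HForm V F ρ k r → M)) : Jet1 V F ρ where
  pt := w.pt.pt
  map := (mfderiv 𝓘(ℝ, V × (F × ModelForms V F k r)) 𝓘(ℝ, V × F) HForm.pt w.pt).comp w.map
  proj_comp := by
    have h1 : MDifferentiableAt 𝓘(ℝ, V × (F × ModelForms V F k r)) 𝓘(ℝ, V × F)
        (HForm.pt : HForm V F ρ k r → P) w.pt :=
      ((HForm.bundleCharts ρ k r).contMDiff_proj w.pt).mdifferentiableAt (by simp)
    have h2 : MDifferentiableAt 𝓘(ℝ, V × F) 𝓘(ℝ, V) ρ w.pt.pt :=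
      (fiberedChartAt V F ρ w.pt.pt).mdiff_proj (mem_fiberedChartAt _)
    have h3 := tmap_comp h2 h1
    have h4 := w.tmap_comp_lin
    change (tmap (A := V × F) (B := V) ρ w.pt.pt).comp
      ((tmap (A := V × (F × ModelForms V F k r)) (B := V × F) HForm.pt w.pt).comp w.lin) =
        ContinuousLinearMap.id ℝ V
    rw [← ContinuousLinearMap.comp_assoc, ← h3]
    exact h4

/-- `w = a w₁ + b w₂` in a fibre of the vector bundle `j¹ν : J¹(π ∘ ν) → J¹π`, whose operations are
`a j¹ₓθ₁ + b j¹ₓθ₂ = j¹ₓ(a θ₁ + b θ₂)` for local sections with `ν ∘ θ₁ = ν ∘ θ₂`. -/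
def IsLinComb (a b : ℝ) (w₁ w₂ w : Jet1 V (F × ModelForms V F k r)
    (HForm.proj ρ k r : HForm V F ρ k r → M)) : Prop :=
  ∃ (x : M) (θ₁ θ₂ θ : M → HForm V F ρ k r),
    IsJetOf w₁ θ₁ x ∧ IsJetOf w₂ θ₂ x ∧ IsJetOf w θ x ∧
    ∀ᶠ y in 𝓝 x, (θ₁ y).pt = (θ y).pt ∧ (θ₂ y).pt = (θ y).pt ∧
      (θ y).alt = a • (θ₁ y).alt + b • (θ₂ y).alt

end Sections

section Exchange

variable {V F : Type*} [NormedAddCommGroup V] [NormedSpace ℝ V] [NormedAddCommGroup F]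
  [NormedSpace ℝ F]

/-- The coordinate expression of the exchange map,
`(xⁱ, u, uᵢ, ūⱼ, uᵢⱼ) ↦ (xⁱ, u, ūᵢ, uⱼ, uⱼᵢ + (ūₖ - uₖ) Γᵏⱼᵢ)`. The coordinates of a point of
`J¹π₁` are `(x, ((u, a), b))`, where `a eᵢ = uᵢ` and `b eⱼ = (ūⱼ, s eⱼ)`, `s eⱼ eᵢ = uᵢⱼ`. -/
def exchangeCoord (Γ : V →L[ℝ] V →L[ℝ] V)
    (y : V × ((F × (V →L[ℝ] F)) × (V →L[ℝ] F × (V →L[ℝ] F)))) :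
    V × ((F × (V →L[ℝ] F)) × (V →L[ℝ] F × (V →L[ℝ] F))) :=
  letI a : V →L[ℝ] F := y.2.1.2
  letI a' : V →L[ℝ] F := (ContinuousLinearMap.fst ℝ F (V →L[ℝ] F)).comp y.2.2
  letI s : V →L[ℝ] V →L[ℝ] F := (ContinuousLinearMap.snd ℝ F (V →L[ℝ] F)).comp y.2.2
  (y.1, (y.2.1.1, a'),
    a.prod (s.flip + (ContinuousLinearMap.compL ℝ V V F (a' - a)).comp Γ))

end Exchange

section Tulczyjew

variable {m : ℕ} {M : Type*} [TopologicalSpace M] [ChartedSpace (Euc m) M]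
variable {F E : Type*} [NormedAddCommGroup F] [NormedSpace ℝ F] [TopologicalSpace E]
  [ChartedSpace (Euc m × F) E] [IsManifold 𝓘(ℝ, Euc m × F) ∞ E] {π : E → M}
  [IsFibration (Euc m) F π]

variable (m F) in
/-- The first jet manifold `J¹π`. -/
abbrev JetSpace (π : E → M) : Type _ := Jet1 (Euc m) F π

variable (m F) in
/-- The iterated jet manifold `J¹π₁`, where `π₁ : J¹π → M`. -/
abbrev IteratedJetSpace (π : E → M) [IsFibration (Euc m) F π] : Type _ :=
  Jet1 (Euc m) (F × (Euc m →L[ℝ] F)) (Jet1.proj π : JetSpace m F π → M)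

/-- The exchange map `ex_∇ : J¹π₁ → J¹π₁`, through its coordinate expression in a system of fibred
coordinates. -/
def exchange
    (cov : (∀ x : M, TangentSpace 𝓘(ℝ, Euc m) x) →
      ∀ x : M, TangentSpace 𝓘(ℝ, Euc m) x →L[ℝ] TangentSpace 𝓘(ℝ, Euc m) x)
    (y : IteratedJetSpace m F π) : IteratedJetSpace m F π :=
  letI c := fiberedChartAt (Euc m) F π y.pt.pt
  c.jet.jet.κ.symm (exchangeCoord (christoffel cov c.ψ (π y.pt.pt)) (c.jet.jet.κ y))

/-- The pairing `⟨α, z⟩` of `α ∈ Λᵐ₂E` and `z ∈ J¹π` over the same point of `E`, defined by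
`z^* α = ⟨α, z⟩ η`. -/
def pairing (η : VolumeForm m M) (α : HForm (Euc m) F π m 2) (z : JetSpace m F π) : ℝ :=
  α.alt (fun i => z.lin (stdVec i)) / η.toFun (π z.pt) (fun i => (stdVec i : Euc m))

variable [FiniteDimensional ℝ F]

variable (m F) in
/-- The manifold `J¹(π ∘ ν)`, where `ν : Λᵐ₂E → E`. -/
abbrev MomentumJetSpace (π : E → M) [IsFibration (Euc m) F π] : Type _ :=
  Jet1 (Euc m) (F × ModelForms (Euc m) F m 2)
    (HForm.proj π m 2 : HForm (Euc m) F π m 2 → M)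

variable (m F) in
/-- The bundle `Λᵐ⁺¹₂ J¹π`. -/
abbrev JetForms (π : E → M) [IsFibration (Euc m) F π] : Type _ :=
  HForm (Euc m) (F × (Euc m →L[ℝ] F)) (Jet1.proj π : JetSpace m F π → M) (m + 1) 2

/-- The linear map `T : T_x M → Λᵐ₂(T_z J¹π)`, that is, the element of `Λᵐ₂(T_z J¹π) ⊗ T^*_x M`,
where `z = j¹ν(w)` and `x = π₁(z)`, corresponds to the affine map
`J¹_z π₁ → T^*_x M`, `y ↦ d^{∇,η}⟨w, ex_∇ y⟩`. Here `d^{∇,η}⟨j¹ₓθ, j¹ₓσ⟩ = (d^{∇,η}⟨θ, σ⟩)(x)` for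
local sections with `ν ∘ θ = π₁,₀ ∘ σ`, and a form `α ∈ Λᵐ₂(T_z J¹π)` corresponds to the affine
function `f` on `J¹_z π₁` with `y^* α = f(y) η`. -/
structure IsTulczyjewTensor
    (cov : (∀ x : M, TangentSpace 𝓘(ℝ, Euc m) x) →
      ∀ x : M, TangentSpace 𝓘(ℝ, Euc m) x →L[ℝ] TangentSpace 𝓘(ℝ, Euc m) x)
    (η : VolumeForm m M) (w : MomentumJetSpace m F π)
    (T : TangentSpace 𝓘(ℝ, Euc m) (Jet1.proj π w.base) →L[ℝ]
      (TangentSpace 𝓘(ℝ, Euc m × (F × (Euc m →L[ℝ] F))) w.base) [⋀^Fin m]→L[ℝ] ℝ) : Prop where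
  horizontal : ∀ X, T X ∈ horizontalForms (mfderiv 𝓘(ℝ, Euc m × (F × (Euc m →L[ℝ] F)))
    𝓘(ℝ, Euc m) (Jet1.proj π : JetSpace m F π → M) w.base) m 2
  pullback : ∀ (B : TangentSpace 𝓘(ℝ, Euc m) (Jet1.proj π w.base) →L[ℝ]
      TangentSpace 𝓘(ℝ, Euc m × (F × (Euc m →L[ℝ] F))) w.base)
    (hB : (mfderiv 𝓘(ℝ, Euc m × (F × (Euc m →L[ℝ] F))) 𝓘(ℝ, Euc m)
      (Jet1.proj π : JetSpace m F π → M) w.base).comp B = ContinuousLinearMap.id ℝ _)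
    (θ : M → HForm (Euc m) F π m 2) (σ : M → JetSpace m F π),
    IsJetOf w θ (Jet1.proj π w.base) →
    IsJetOf (exchange cov (⟨w.base, B, hB⟩ : IteratedJetSpace m F π)) σ (Jet1.proj π w.base) →
    (∀ᶠ y in 𝓝 (Jet1.proj π w.base), (θ y).pt = (σ y).pt) →
    ∀ X, (T X).compContinuousLinearMap B =
      dNabla cov η (fun y => pairing η (θ y) (σ y)) (Jet1.proj π w.base) X •
        η.toFun (Jet1.proj π w.base)

/-- The image of `T` under the morphism `Λᵐ₂J¹π ⊗ T^*M → Λᵐ⁺¹₂J¹π` given by the wedge product,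
`α ⊗ λ ↦ (-1)ᵐ⁺¹ α ∧ λ = -λ ∧ α`; the sign is such that `du^α ∧ dᵐ⁻¹xᵢ ⊗ dxᵏ` is mapped to
`δᵏᵢ du^α ∧ dᵐx`. -/
def wedgeTensor (z : JetSpace m F π)
    (T : TangentSpace 𝓘(ℝ, Euc m) (Jet1.proj π z) →L[ℝ]
      (TangentSpace 𝓘(ℝ, Euc m × (F × (Euc m →L[ℝ] F))) z) [⋀^Fin m]→L[ℝ] ℝ) :
    (Euc m × (F × (Euc m →L[ℝ] F))) [⋀^Fin (m + 1)]→L[ℝ] ℝ :=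
  letI T' : Euc m →L[ℝ] (Euc m × (F × (Euc m →L[ℝ] F))) [⋀^Fin m]→L[ℝ] ℝ := T;
  -ContinuousAlternatingMap.alternatizeUncurryFin
    (T'.comp (tmap (A := Euc m × (F × (Euc m →L[ℝ] F))) (B := Euc m)
      (Jet1.proj π : JetSpace m F π → M) z))

/-- `A : J¹(π ∘ ν) → Λᵐ⁺¹₂J¹π` is a (smooth) vector bundle epimorphism over the identity of
`J¹π`. -/
structure IsVectorBundleEpimorphism (A : MomentumJetSpace m F π → JetForms m F π) : Prop where
  smooth : ContMDiff
    𝓘(ℝ, Euc m × ((F × ModelForms (Euc m) F m 2) ×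
      (Euc m →L[ℝ] F × ModelForms (Euc m) F m 2)))
    𝓘(ℝ, Euc m × ((F × (Euc m →L[ℝ] F)) ×
      ModelForms (Euc m) (F × (Euc m →L[ℝ] F)) (m + 1) 2)) ∞ A
  over_id : ∀ w, (A w).pt = w.base
  linear : ∀ (a b : ℝ) (w₁ w₂ : MomentumJetSpace m F π), w₁.base = w₂.base →
    (∃! w, IsLinComb a b w₁ w₂ w) ∧
      ∀ w, IsLinComb a b w₁ w₂ w → (A w).alt = a • (A w₁).alt + b • (A w₂).alt
  surjective : ∀ β : JetForms m F π, ∃ w, w.base = β.pt ∧ A w = β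

/-- The components `(p^i_α)_α`, for fixed `i`, of a 2-horizontal `m`-form
`p dᵐx + p^i_α du^α ∧ dᵐ⁻¹xᵢ`: these are its values on
`(∂/∂x¹, …, ∂/∂u^α, …, ∂/∂xᵐ)`, with `∂/∂u^α` in the `i`-th place. -/
def momentum (α : ModelForms (Euc m) F m 2) (i : Fin m) : F →L[ℝ] ℝ :=
  ((α : (Euc m × F) [⋀^Fin m]→L[ℝ] ℝ).toContinuousMultilinearMap.toContinuousLinearMap
    (fun j => (stdVec j, 0)) i).comp (ContinuousLinearMap.inr ℝ (Euc m) F)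

/-- In all natural coordinates, the map `A` is given by
`(xⁱ, u^α, p, p^i_α, u^α_j, p_j, p^i_{αj}) ↦ (p^i_{αi} du^α + p^i_α du^α_i) ∧ dᵐx`, at the point
`(xⁱ, u^α, u^α_j)` of `J¹π`. -/
def HasTulczyjewExpression (A : MomentumJetSpace m F π → JetForms m F π) : Prop :=
  ∀ (c : FiberedChart (Euc m) F π) (w : MomentumJetSpace m F π), w.pt.pt ∈ c.κ.source →
    ∀ (x : Euc m) (u : F) (α : ModelForms (Euc m) F m 2)
      (b : Euc m →L[ℝ] F × ModelForms (Euc m) F m 2),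
    (c.forms m 2).jet.κ w = (x, (u, α), b) →
    ∃ β : ModelForms (Euc m) (F × (Euc m →L[ℝ] F)) (m + 1) 2,
      (c.jet.forms (m + 1) 2).κ (A w) =
        (x, (u, (ContinuousLinearMap.fst ℝ F (ModelForms (Euc m) F m 2)).comp b), β) ∧
      ∀ v : Fin (m + 1) → Euc m × (F × (Euc m →L[ℝ] F)),
        (β : (Euc m × (F × (Euc m →L[ℝ] F))) [⋀^Fin (m + 1)]→L[ℝ] ℝ) v =
          ∑ k : Fin (m + 1), (-1) ^ (k : ℕ) *
            (∑ i : Fin m, (momentum (b (stdVec i)).2 i (v k).2.1 +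
              momentum α i ((v k).2.2 (stdVec i)))) *
            Matrix.det (Matrix.of fun i j : Fin m => (v (k.succAbove i)).1 j)

end Tulczyjew

end

/-! The tensor T attached to w is computed in one adapted chart. Its independence of the chart and
of ∇ then follows from intrinsic uniqueness statements rather than from a transformation formula for
the morphism.

The value of a 2-horizontal m-form on the graph of (uᵢ) is p + pⁱuᵢ (`modelForms_apply_graph`). So
in a chart ⟨θ, σ⟩ η(∂₁, …, ∂ₘ) is the function G = p + pⁱuᵢ, and d^{∇,η}⟨θ, σ⟩ · η(∂₁, …, ∂ₘ) = dG −
G tr Γ (`dNabla_apply`, `dNabla_pairing`). Inserting ex_∇(y) for the jet of σ gives a function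
affine in y, and the explicit form `tulczyjewForm` represents it (`tulczyjewForm_graph`). Under the
wedge product only the sum over k of the k-th momentum of T(∂ₖ) survives (`neg_alternatize_eq`). It
equals pᵏₖ du + pᵏ duₖ plus (Γᵏₖᵢ − Γᵏᵢₖ) pⁱ du, and the last term vanishes for a symmetric
connection (`neg_alternatize_tulczyjewTensorModel`). Thus neither ∇ nor η is left in the result.

T is unique because an m-form on ℝᵐ × W is determined by its values on graphs of linear maps ℝᵐ → W
(`map_eq_zero_of_graph`), and these graphs are exactly the elements of J¹_z π₁ read in a chart. The
pullback condition is not vacuous: ex_∇ interchanges the two first-order parts of y, so j¹π₁,₀ of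
ex_∇(y) is z = j¹ν(w), and sections affine in a chart represent both jets over the same section of π
(`exists_sections`).

The exchange map is well defined because, under a change of charts, the second derivative of the
base change enters before and after the exchange multiplied by uᵢ and ūᵢ respectively; the
discrepancy is the inhomogeneous term in the law of the Christoffel symbols (`exchangeIn_eq`).

To compare the coordinate expressions in two charts, take the flat connection of one of them. Its
Christoffel symbols vanish in that chart, hence are symmetric in the other, and the unique T can be
evaluated in both (`tulczyjewAt_eq`). No global connection is needed.

Finally, a 2-horizontal (m+1)-form is P ∧ dᵐx with P a linear form on vertical vectors
(`form_succ_eq_zero`). The morphism is linear in the momentum coordinates, and every P is attained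
as soon as there is one index i to carry the du part through pⁱᵢ, which is the role of m ≥ 1
(`exists_tulczyjewModel_eq`). -/

noncomputable section

/-! ### Exterior algebra of ℝᵐ × W: top forms, graphs, horizontal forms -/

section LinearAlgebra

variable {m : ℕ} {W : Type*} [NormedAddCommGroup W] [NormedSpace ℝ W]

variable (m) in
/-- The standard volume form `dᵐx` of `ℝᵐ`. -/
def detForm : Euc m [⋀^Fin m]→L[ℝ] ℝ :=
  { (Matrix.detRowAlternating (n := Fin m) (R := ℝ)).compLinearMap
      (EuclideanSpace.equiv (Fin m) ℝ).toLinearMap with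
    cont := by
      change Continuous fun v : Fin m → Euc m => Matrix.det (Matrix.of fun i j => v i j)
      refine Continuous.matrix_det ?_
      refine continuous_matrix fun i j => ?_
      simp only [Matrix.of_apply]
      fun_prop }

theorem detForm_apply (v : Fin m → Euc m) :
    detForm m v = Matrix.det (Matrix.of fun i j => v i j) := rfl

theorem detForm_stdVec : detForm m (fun i => stdVec i) = 1 := by
  rw [detForm_apply]
  convert Matrix.det_one (n := Fin m) (R := ℝ)
  ext i j
  simp [Matrix.one_apply, PiLp.single_apply, eq_comm]

/-- Forms of top degree make up a line, spanned by dᵐx. -/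
theorem map_eq_detForm (μ : Euc m [⋀^Fin m]→L[ℝ] ℝ) (v : Fin m → Euc m) :
    μ v = detForm m v * μ (fun i => stdVec i) := by
  let e := (EuclideanSpace.basisFun (Fin m) ℝ).toBasis
  have he : ⇑e = fun i => stdVec i := by
    funext i; simp [e, stdVec]
  have h1 := DFunLike.congr_fun (μ.toAlternatingMap.eq_smul_basis_det e) v
  have h2 := DFunLike.congr_fun ((detForm m).toAlternatingMap.eq_smul_basis_det e) v
  rw [he] at h1 h2
  simp only [ContinuousAlternatingMap.coe_toAlternatingMap, AlternatingMap.smul_apply, smul_eq_mul,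
    detForm_stdVec, one_mul] at h1 h2
  rw [h1, h2, mul_comm]

/-- The determinant of an endomorphism of `ℝᵐ`. -/
theorem map_comp_eq_detForm (μ : Euc m [⋀^Fin m]→L[ℝ] ℝ) (L : Euc m →L[ℝ] Euc m)
    (v : Fin m → Euc m) :
    μ (fun i => L (v i)) = detForm m (fun i => L (stdVec i)) * μ v := by
  have h1 := map_eq_detForm (μ.compContinuousLinearMap L) v
  have h2 := map_eq_detForm μ (fun i => L (stdVec i))
  have h3 := map_eq_detForm μ v
  simp only [ContinuousAlternatingMap.compContinuousLinearMap_apply, Function.comp_def] at h1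
  rw [h1, h2, h3]; ring

/-- Differentiate μ((1 + sL)v₁, …, (1 + sL)vₘ) = det(1 + sL) μ(v) at s = 0. The factor `t` depends
on `L` only; `sum_map_update_eq_trace` identifies it with the trace. -/
theorem exists_sum_map_update_eq (L : Euc m →L[ℝ] Euc m) :
    ∃ t : ℝ, ∀ (μ : Euc m [⋀^Fin m]→L[ℝ] ℝ) (v : Fin m → Euc m),
      ∑ i, μ (Function.update v i (L (v i))) = t * μ v := by
  have key : ∀ (μ : Euc m [⋀^Fin m]→L[ℝ] ℝ) (v : Fin m → Euc m),
      HasDerivAt (fun s : ℝ => μ (fun i => v i + s • L (v i)))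
        (∑ i, μ (Function.update v i (L (v i)))) 0 := by
    intro μ v
    have h1 := (μ.toContinuousMultilinearMap.hasFDerivAt (fun i => v i + (0 : ℝ) • L (v i)))
    have h2 : HasDerivAt (fun s : ℝ => (fun i => v i + s • L (v i) : Fin m → Euc m))
        (fun i => L (v i)) 0 := by
      rw [hasDerivAt_pi]
      intro i
      simpa using ((hasDerivAt_id (0 : ℝ)).smul_const (L (v i))).const_add (v i)
    have h3 := h1.comp_hasDerivAt (0 : ℝ) h2
    simpa [ContinuousMultilinearMap.linearDeriv_apply, Function.comp_def] using! h3
  refine ⟨deriv (fun s : ℝ => detForm m (fun i => stdVec i + s • L (stdVec i))) 0, fun μ v => ?_⟩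
  have h1 := key μ v
  have h2 := ((key (detForm m) (fun i => stdVec i)).differentiableAt.hasDerivAt.mul_const (μ v))
  refine h1.unique (h2.congr_of_eventuallyEq (Eventually.of_forall fun s => ?_))
  have h3 := map_comp_eq_detForm μ (ContinuousLinearMap.id ℝ _ + s • L) v
  simpa using h3

/-- Vectors whose base components are independent all lie on one graph, where `α` restricts to a top
form of ℝᵐ that vanishes on the standard basis. Such families are dense, and `α` is continuous.
Horizontality plays no role. -/
theorem map_eq_zero_of_graph {α : (Euc m × W) [⋀^Fin m]→L[ℝ] ℝ}
    (h : ∀ l : Euc m →L[ℝ] W, α (fun i => (stdVec i, l (stdVec i))) = 0) : α = 0 := by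
  have hind : ∀ v : Fin m → Euc m × W, detForm m (fun i => (v i).1) ≠ 0 → α v = 0 := by
    intro v hv
    let e := (EuclideanSpace.basisFun (Fin m) ℝ).toBasis
    have he : ∀ i, e i = stdVec i := fun i => by simp [e, stdVec]
    -- The graph containing every `v i` is that of N ∘ L⁻¹, where `L` and `N` send the i-th basis
    -- vector to the base and vertical components of `v i`.
    let L : Euc m →ₗ[ℝ] Euc m := e.constr ℝ fun i => (v i).1
    let N : Euc m →ₗ[ℝ] W := e.constr ℝ fun i => (v i).2
    have hL : ∀ i, L (stdVec i) = (v i).1 := fun i => by rw [← he, Module.Basis.constr_basis]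
    have hN : ∀ i, N (stdVec i) = (v i).2 := fun i => by rw [← he, Module.Basis.constr_basis]
    have hdet : LinearMap.det L ≠ 0 := by
      have h1 := e.det_comp L e
      have h2 := DFunLike.congr_fun ((detForm m).toAlternatingMap.eq_smul_basis_det e) (L ∘ e)
      rw [AlternatingMap.smul_apply, h1, e.det_self, mul_one] at h2
      intro h0
      rw [h0, smul_zero] at h2
      apply hv
      rw [← h2]
      change _ = detForm m _
      congr 1
      funext i
      simp [he, hL]
    let Le := LinearEquiv.ofIsUnitDet (f := L) (v := e) (v' := e)
      (by rw [LinearMap.det_toMatrix]; exact isUnit_iff_ne_zero.2 hdet)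
    let l : Euc m →L[ℝ] W := (N ∘ₗ Le.symm.toLinearMap).toContinuousLinearMap
    have h3 := map_eq_detForm (α.compContinuousLinearMap ((ContinuousLinearMap.id ℝ _).prod l))
      (fun i => (v i).1)
    have h4 : ∀ i, ((v i).1, l (v i).1) = v i := by
      intro i
      have : Le.symm (v i).1 = stdVec i := by
        rw [LinearEquiv.symm_apply_eq]; exact (hL i).symm
      refine Prod.ext rfl ?_
      change N (Le.symm (v i).1) = _
      rw [this, hN]
    simp only [ContinuousAlternatingMap.compContinuousLinearMap_apply, Function.comp_def,
      ContinuousLinearMap.prod_apply, ContinuousLinearMap.id_apply, h4, h, mul_zero] at h3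
    exact h3
  ext v
  -- Along this perturbation the determinant of the base components is det(A + t), the
  -- characteristic polynomial of −A at t, so it vanishes for finitely many t only.
  let g : ℝ → Fin m → Euc m × W := fun t i => v i + t • (stdVec i, 0)
  have hg : Continuous g := by fun_prop
  let A : Matrix (Fin m) (Fin m) ℝ := Matrix.of fun i j => (v i).1 j
  have hfin : {t : ℝ | detForm m (fun i => (g t i).1) = 0}.Finite := by
    refine ((-A).charpoly.roots.toFinset.finite_toSet).subset fun t ht => ?_
    simp only [Finset.mem_coe, Multiset.mem_toFinset]
    rw [Polynomial.mem_roots (Matrix.charpoly_monic _).ne_zero, Polynomial.IsRoot,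
      Matrix.eval_charpoly]
    rw [← show _ = (0 : ℝ) from ht, detForm_apply]
    congr 1
    ext i j
    simp [g, A, Matrix.scalar_apply, Matrix.diagonal_apply, PiLp.single_apply, eq_comm, add_comm]
  have hz : (fun t => α (g t)) = fun _ => 0 :=
    Continuous.ext_on (hfin.countable.dense_compl ℝ) (α.cont.comp hg) continuous_const
      fun t ht => hind _ ht
  have h0 : g 0 = v := by funext i; simp [g]
  rw [← h0]
  exact congrFun hz 0

theorem eq_of_graph {α α' : (Euc m × W) [⋀^Fin m]→L[ℝ] ℝ}
    (h : ∀ l : Euc m →L[ℝ] W, α (fun i => (stdVec i, l (stdVec i))) =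
      α' (fun i => (stdVec i, l (stdVec i)))) : α = α' :=
  sub_eq_zero.1 (map_eq_zero_of_graph fun l => sub_eq_zero.2 (h l))

theorem momentum_apply (α : ModelForms (Euc m) W m 2) (i : Fin m) (w : W) :
    momentum α i w = (α : (Euc m × W) [⋀^Fin m]→L[ℝ] ℝ)
      (Function.update (fun j => (stdVec j, 0)) i (0, w)) := rfl

/-- `horizontalForms` asks for exactly `r` vertical arguments; having more is harmless. -/
theorem map_eq_zero_of_horizontal {V' W' : Type*} [AddCommGroup V'] [Module ℝ V']
    [TopologicalSpace V'] [AddCommGroup W'] [Module ℝ W'] [TopologicalSpace W']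
    {L : W' →L[ℝ] V'} {k r : ℕ} {α : W' [⋀^Fin k]→L[ℝ] ℝ} (hα : α ∈ horizontalForms L k r)
    (v : Fin k → W') (s : Finset (Fin k)) (hs : r ≤ s.card) (h : ∀ i ∈ s, L (v i) = 0) :
    α v = 0 := by
  obtain ⟨t, hts, ht⟩ := Finset.exists_subset_card_eq hs
  exact hα v t ht fun i hi => h i (hts hi)

/-- In the multilinear expansion, 2-horizontality kills every term with two or more vertical
arguments. What remains is p + pⁱuᵢ, affine in the slopes. -/
theorem modelForms_apply_graph (α : ModelForms (Euc m) W m 2) (w : Fin m → W) :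
    (α : (Euc m × W) [⋀^Fin m]→L[ℝ] ℝ) (fun i => (stdVec i, w i)) =
      (α : (Euc m × W) [⋀^Fin m]→L[ℝ] ℝ) (fun i => (stdVec i, 0)) + ∑ i, momentum α i (w i) := by
  classical
  let a : Fin m → Euc m × W := fun i => (stdVec i, 0)
  let b : Fin m → Euc m × W := fun i => (0, w i)
  have hab : (fun i => (stdVec i, w i)) = b + a := by
    funext i; simp [a, b]
  have h0 := (α : (Euc m × W) [⋀^Fin m]→L[ℝ] ℝ).toMultilinearMap.map_add_univ b a
  change (α : (Euc m × W) [⋀^Fin m]→L[ℝ] ℝ) (b + a) = ∑ s : Finset (Fin m),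
    (α : (Euc m × W) [⋀^Fin m]→L[ℝ] ℝ) (s.piecewise b a) at h0
  rw [hab, h0]
  have hni : (∅ : Finset (Fin m)) ∉ Finset.univ.image (fun i : Fin m => ({i} : Finset (Fin m))) := by
    simp
  rw [← Finset.sum_subset (Finset.subset_univ
    (insert ∅ (Finset.univ.image (fun i : Fin m => ({i} : Finset (Fin m))))))]
  · rw [Finset.sum_insert hni, Finset.sum_image (by simp [Function.Injective]),
      Finset.piecewise_empty]
    · congr 1
      refine Finset.sum_congr rfl fun i _ => ?_
      rw [momentum_apply, Finset.piecewise_singleton]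
  · intro s _ hs
    refine map_eq_zero_of_horizontal α.2 _ s ?_ fun i hi => ?_
    · by_contra hlt
      apply hs
      have : s.card = 0 ∨ s.card = 1 := by omega
      rcases this with h | h
      · simp [Finset.card_eq_zero.1 h]
      · obtain ⟨i, rfl⟩ := Finset.card_eq_one.1 h
        simp
    · simp [Finset.piecewise_eq_of_mem _ _ _ hi, b]

/-- The map `(v, w) ↦ v + (q w - vⁱ) eᵢ`. -/
def replaceCoord (i : Fin m) (q : W →L[ℝ] ℝ) : Euc m × W →L[ℝ] Euc m :=
  ContinuousLinearMap.fst ℝ (Euc m) W +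
    ((q.comp (ContinuousLinearMap.snd ℝ (Euc m) W)) -
      (EuclideanSpace.proj i : Euc m →L[ℝ] ℝ).comp (ContinuousLinearMap.fst ℝ (Euc m) W)).smulRight
        (stdVec i)

theorem replaceCoord_apply (i : Fin m) (q : W →L[ℝ] ℝ) (v : Euc m × W) :
    replaceCoord i q v = v.1 + (q v.2 - v.1 i) • stdVec i := by
  simp [replaceCoord]

theorem map_eq_zero_of_eq_smul (μ : Euc m [⋀^Fin m]→L[ℝ] ℝ) {v : Fin m → Euc m} {j k : Fin m}
    (hjk : j ≠ k) {a b : ℝ} {x : Euc m} (hj : v j = a • x) (hk : v k = b • x) : μ v = 0 := by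
  have h1 : v = Function.update (Function.update v j (a • x)) k (b • x) := by
    rw [← hj, Function.update_eq_self, ← hk, Function.update_eq_self]
  rw [h1, μ.map_update_smul, Function.update_comm hjk, μ.map_update_smul]
  rw [μ.map_eq_zero_of_eq _ (i := j) (j := k) _ hjk]
  · simp
  · simp [hjk.symm]

/-- The form `c dᵐx + ∑ᵢ qᵢ ∧ dᵐ⁻¹xᵢ`. -/
def mkForm (c : ℝ) (q : Fin m → W →L[ℝ] ℝ) : ModelForms (Euc m) W m 2 :=
  ⟨c • (detForm m).compContinuousLinearMap (ContinuousLinearMap.fst ℝ (Euc m) W) +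
      ∑ i, (detForm m).compContinuousLinearMap (replaceCoord i (q i)), by
    refine Submodule.add_mem _ (Submodule.smul_mem _ _ ?_) (Submodule.sum_mem _ fun i _ => ?_)
    · intro v s hs h
      obtain ⟨j, hj⟩ : s.Nonempty := Finset.card_pos.1 (by omega)
      exact (detForm m).map_coord_zero j (h j hj)
    · intro v s hs h
      obtain ⟨j, k, hjk, rfl⟩ := Finset.card_eq_two.1 hs
      have hj : (v j).1 = 0 := h j (by simp)
      have hk : (v k).1 = 0 := h k (by simp)
      -- `replaceCoord i` sends all vertical vectors into the line of `stdVec i`, so two vertical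
      -- arguments become proportional.
      refine map_eq_zero_of_eq_smul (detForm m) hjk (a := q i (v j).2) (b := q i (v k).2)
        (x := stdVec i) ?_ ?_
      · change replaceCoord i (q i) (v j) = _
        rw [replaceCoord_apply, hj]; simp
      · change replaceCoord i (q i) (v k) = _
        rw [replaceCoord_apply, hk]; simp⟩

theorem mkForm_apply (c : ℝ) (q : Fin m → W →L[ℝ] ℝ) (v : Fin m → Euc m × W) :
    (mkForm c q : (Euc m × W) [⋀^Fin m]→L[ℝ] ℝ) v =
      c * detForm m (fun i => (v i).1) + ∑ i, detForm m (fun j => replaceCoord i (q i) (v j)) := by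
  simp only [mkForm, ContinuousAlternatingMap.add_apply, ContinuousAlternatingMap.smul_apply,
    ContinuousAlternatingMap.sum_apply, smul_eq_mul]
  rfl

theorem replaceCoord_stdVec (i j : Fin m) (q : W →L[ℝ] ℝ) :
    replaceCoord i q (stdVec j, 0) = if j = i then 0 else stdVec j := by
  rw [replaceCoord_apply]
  split_ifs with h
  · subst h; simp
  · simp [Ne.symm h]

theorem mkForm_stdVec (c : ℝ) (q : Fin m → W →L[ℝ] ℝ) :
    (mkForm c q : (Euc m × W) [⋀^Fin m]→L[ℝ] ℝ) (fun i => (stdVec i, 0)) = c := by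
  rw [mkForm_apply, detForm_stdVec, mul_one, add_eq_left]
  refine Finset.sum_eq_zero fun i _ => (detForm m).map_coord_zero i ?_
  simp [replaceCoord_stdVec]

/-- Pulling dᵐx back along `replaceCoord i (q i)` replaces the factor dxⁱ by qᵢ. For j ≠ i the j-th
summand has lost dxʲ and therefore kills the argument (eⱼ, 0), so only the i-th summand is seen. -/
theorem momentum_mkForm (c : ℝ) (q : Fin m → W →L[ℝ] ℝ) (i : Fin m) :
    momentum (mkForm c q) i = q i := by
  ext w
  rw [momentum_apply, mkForm_apply, (detForm m).map_coord_zero i (by simp), mul_zero, zero_add,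
    Finset.sum_eq_single i]
  · have : (fun j => replaceCoord i (q i)
        (Function.update (fun j => ((stdVec j, 0) : Euc m × W)) i (0, w) j)) =
        Function.update (fun j => stdVec j) i (q i w • stdVec i) := by
      funext j
      rcases eq_or_ne j i with rfl | h
      · simp [replaceCoord_apply]
      · simp only [Function.update_of_ne h, replaceCoord_stdVec, if_neg h]
    rw [this, (detForm m).map_update_smul, Function.update_eq_self, detForm_stdVec]
    simp
  · intro j _ hj
    refine (detForm m).map_coord_zero j ?_
    simp [Function.update_of_ne hj, replaceCoord_stdVec]
  · simp

theorem mkForm_graph (c : ℝ) (q : Fin m → W →L[ℝ] ℝ) (w : Fin m → W) :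
    (mkForm c q : (Euc m × W) [⋀^Fin m]→L[ℝ] ℝ) (fun i => (stdVec i, w i)) =
      c + ∑ i, q i (w i) := by
  rw [modelForms_apply_graph, mkForm_stdVec]
  simp only [momentum_mkForm]

/-- The values in the hypothesis are the only free components of a 2-horizontal (m+1)-form: they
force `β` to vanish as soon as one argument is vertical, and m + 1 vectors always have a nontrivial
combination that is vertical. -/
theorem form_succ_eq_zero {β : (Euc m × W) [⋀^Fin (m + 1)]→L[ℝ] ℝ}
    (hβ : β ∈ horizontalForms (ContinuousLinearMap.fst ℝ (Euc m) W) (m + 1) 2)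
    (h : ∀ w : W, β (Fin.cons (0, w) fun i => (stdVec i, 0)) = 0) : β = 0 := by
  -- Contraction with a vertical vector leaves a 1-horizontal form. Its momenta vanish, so its value
  -- on every graph is its value on the horizontal frame, which is zero by hypothesis.
  have hcurry : ∀ w : W, β.curryLeft (0, w) = 0 := by
    intro w
    refine map_eq_zero_of_graph fun l => ?_
    have h1 : β.curryLeft (0, w) ∈ horizontalForms (ContinuousLinearMap.fst ℝ (Euc m) W) m 1 := by
      intro v s hs hv
      rw [ContinuousAlternatingMap.curryLeft_apply_apply]
      refine hβ _ (insert 0 (s.map (Fin.succEmb m))) ?_ ?_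
      · rw [Finset.card_insert_of_notMem (by simp [Fin.succ_ne_zero]), Finset.card_map, hs]
      · intro i hi
        rcases Finset.mem_insert.1 hi with rfl | hi
        · simp
        · obtain ⟨j, hj, rfl⟩ := Finset.mem_map.1 hi
          simpa using hv j hj
    have h2 : β.curryLeft (0, w) ∈ horizontalForms (ContinuousLinearMap.fst ℝ (Euc m) W) m 2 :=
      fun v s hs hv => map_eq_zero_of_horizontal h1 v s (by omega) hv
    have h3 := modelForms_apply_graph ⟨_, h2⟩ fun i => l (stdVec i)
    change β.curryLeft (0, w) _ = β.curryLeft (0, w) _ + _ at h3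
    rw [h3, ContinuousAlternatingMap.curryLeft_apply_apply]
    have h4 : ∀ i, momentum ⟨_, h2⟩ i (l (stdVec i)) = 0 := by
      intro i
      rw [momentum_apply]
      exact h1 _ {i} (by simp) (by simp)
    simp only [h4, Finset.sum_const_zero, add_zero]
    exact h w
  have hvert : ∀ (v : Fin (m + 1) → Euc m × W) (k : Fin (m + 1)), (v k).1 = 0 → β v = 0 := by
    intro v k hk
    have h1 := β.map_insertNth k (v k) (k.removeNth v)
    rw [Fin.insertNth_self_removeNth] at h1
    have h2 := DFunLike.congr_fun (hcurry (v k).2) (k.removeNth v)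
    rw [ContinuousAlternatingMap.curryLeft_apply_apply, ← hk] at h2
    rw [h1]
    change _ • β (Matrix.vecCons (v k) _) = 0
    rw [show β (Matrix.vecCons (v k) (k.removeNth v)) = 0 from h2, smul_zero]
  ext v
  have hdep : ¬ LinearIndependent ℝ (fun k => (v k).1) := by
    intro hli
    have := hli.fintype_card_le_finrank
    simp at this
  obtain ⟨g, hg, k, hk⟩ := Fintype.not_linearIndependent_iff.1 hdep
  -- Putting the vertical combination in the k-th place gives zero on one side and g k · β v on the
  -- other, with g k ≠ 0.
  have h1 : β (Function.update v k (∑ j, g j • v j)) = 0 := by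
    refine hvert _ k ?_
    rw [Function.update_self, Prod.fst_sum]
    exact hg
  have h2 := β.toAlternatingMap.map_update_sum Finset.univ k (fun j => g j • v j) v
  simp only [ContinuousAlternatingMap.coe_toAlternatingMap, AlternatingMap.map_update_smul] at h2
  rw [h1, Finset.sum_eq_single k] at h2
  · rw [Function.update_eq_self] at h2
    simpa [hk] using h2.symm
  · intro j _ hj
    have := β.toAlternatingMap.map_update_self v hj.symm
    simp only [ContinuousAlternatingMap.coe_toAlternatingMap] at this
    rw [this, smul_zero]
  · simp

/-- The form `P ∧ dᵐx`. -/
def wedgeVolume (P : W →L[ℝ] ℝ) : ModelForms (Euc m) W (m + 1) 2 :=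
  ⟨ContinuousAlternatingMap.alternatizeUncurryFin
      ((P.comp (ContinuousLinearMap.snd ℝ (Euc m) W)).smulRight
        ((detForm m).compContinuousLinearMap (ContinuousLinearMap.fst ℝ (Euc m) W))), by
    intro v s hs h
    rw [ContinuousAlternatingMap.alternatizeUncurryFin_apply]
    refine Finset.sum_eq_zero fun k _ => ?_
    -- At most one of the two vertical arguments is absorbed by `P`; the other one reaches dᵐx.
    obtain ⟨j, hj, hjk⟩ : ∃ j ∈ s, j ≠ k := by
      by_contra! hcon
      have := Finset.card_le_card (show s ⊆ {k} from fun j hj => by simp [hcon j hj])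
      simp [hs] at this
    obtain ⟨i, rfl⟩ := Fin.exists_succAbove_eq hjk
    have h0 : detForm m (fun a => (v (k.succAbove a)).1) = 0 :=
      (detForm m).map_coord_zero i (h _ hj)
    change _ • (P (v k).2 * detForm m (fun a => (v (k.succAbove a)).1)) = 0
    rw [h0, mul_zero, smul_zero]⟩

theorem wedgeVolume_apply (P : W →L[ℝ] ℝ) (v : Fin (m + 1) → Euc m × W) :
    (wedgeVolume (m := m) P : (Euc m × W) [⋀^Fin (m + 1)]→L[ℝ] ℝ) v =
      ∑ k : Fin (m + 1), (-1) ^ (k : ℕ) * P (v k).2 *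
        Matrix.det (Matrix.of fun i j : Fin m => (v (k.succAbove i)).1 j) := by
  rw [wedgeVolume, ContinuousAlternatingMap.alternatizeUncurryFin_apply]
  refine Finset.sum_congr rfl fun k _ => ?_
  change _ • (P (v k).2 * detForm m (fun a => (v (k.succAbove a)).1)) = _
  rw [detForm_apply, zsmul_eq_mul, mul_assoc]
  push_cast
  rfl

theorem wedgeVolume_cons (P : W →L[ℝ] ℝ) (w : W) :
    (wedgeVolume (m := m) P : (Euc m × W) [⋀^Fin (m + 1)]→L[ℝ] ℝ)
      (Fin.cons (0, w) fun i => (stdVec i, 0)) = P w := by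
  rw [wedgeVolume_apply, Fin.sum_univ_succ, Finset.sum_eq_zero, add_zero]
  · simp only [Fin.cons_zero, Fin.zero_succAbove, Fin.cons_succ]
    rw [← detForm_apply, detForm_stdVec]
    simp
  · intro i _
    simp

theorem eq_wedgeVolume {β : (Euc m × W) [⋀^Fin (m + 1)]→L[ℝ] ℝ}
    (hβ : β ∈ horizontalForms (ContinuousLinearMap.fst ℝ (Euc m) W) (m + 1) 2) {P : W →L[ℝ] ℝ}
    (h : ∀ w : W, β (Fin.cons (0, w) fun i => (stdVec i, 0)) = P w) :
    β = (wedgeVolume (m := m) P : (Euc m × W) [⋀^Fin (m + 1)]→L[ℝ] ℝ) := by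
  refine sub_eq_zero.1 (form_succ_eq_zero (Submodule.sub_mem _ hβ (wedgeVolume (m := m) P).2) fun w => ?_)
  rw [ContinuousAlternatingMap.sub_apply, wedgeVolume_cons, h, sub_self]

/-- The coefficient `P` of a form `P ∧ dᵐx`. -/
def wedgeCoeff (β : (Euc m × W) [⋀^Fin (m + 1)]→L[ℝ] ℝ) : W →L[ℝ] ℝ :=
  (ContinuousAlternatingMap.apply ℝ (Euc m × W) ℝ (fun i => (stdVec i, (0 : W)))).comp
    (β.curryLeft.comp (ContinuousLinearMap.inr ℝ (Euc m) W))

theorem eq_wedgeVolume_wedgeCoeff (β : ModelForms (Euc m) W (m + 1) 2) :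
    β = wedgeVolume (wedgeCoeff (β : (Euc m × W) [⋀^Fin (m + 1)]→L[ℝ] ℝ)) :=
  Subtype.ext (eq_wedgeVolume β.2 fun _ => rfl)

/-- Removing eₖ leaves the vertical vector in front; moving it into the vacant k-th place costs k
transpositions. -/
theorem map_cons_stdVec (α : (Euc m × W) [⋀^Fin m]→L[ℝ] ℝ) (k : Fin m) (w : W) :
    α (k.succ.removeNth (Fin.cons (0, w) fun i => (stdVec i, 0) : Fin (m + 1) → Euc m × W)) =
      (-1) ^ (k : ℕ) • α (Function.update (fun j => (stdVec j, 0)) k (0, w)) := by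
  obtain _ | m := m
  · exact k.elim0
  have h1 := α.neg_one_pow_smul_map_insertNth k (0, w)
    (k.removeNth fun i => ((stdVec i, 0) : Euc (m + 1) × W))
  rw [Fin.insertNth_removeNth] at h1
  rw [h1]
  congr 1
  funext i
  refine Fin.cases ?_ (fun j => ?_) i
  · simp [Fin.removeNth]
  · simp [Fin.removeNth]

/-- The wedge product `∑ₖ -dxᵏ ∧ T eₖ`, in terms of momenta. -/
theorem neg_alternatize_eq (T : Euc m →L[ℝ] (Euc m × W) [⋀^Fin m]→L[ℝ] ℝ)
    (hT : ∀ x, T x ∈ horizontalForms (ContinuousLinearMap.fst ℝ (Euc m) W) m 2) (P : W →L[ℝ] ℝ)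
    (hP : ∀ w, ∑ k, momentum ⟨T (stdVec k), hT _⟩ k w = P w) :
    -ContinuousAlternatingMap.alternatizeUncurryFin
      (T.comp (ContinuousLinearMap.fst ℝ (Euc m) W)) =
      (wedgeVolume (m := m) P : (Euc m × W) [⋀^Fin (m + 1)]→L[ℝ] ℝ) := by
  refine eq_wedgeVolume (Submodule.neg_mem _ ?_) fun w => ?_
  · intro v s hs h
    rw [ContinuousAlternatingMap.alternatizeUncurryFin_apply]
    refine Finset.sum_eq_zero fun k _ => ?_
    by_cases hk : k ∈ s
    · have : T.comp (ContinuousLinearMap.fst ℝ (Euc m) W) (v k) = 0 := by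
        rw [ContinuousLinearMap.comp_apply, h k hk, map_zero]
      rw [this]; simp
    · have : T.comp (ContinuousLinearMap.fst ℝ (Euc m) W) (v k) (k.removeNth v) = 0 := by
        refine hT _ _ (Finset.univ.filter fun i => k.succAbove i ∈ s) ?_ ?_
        · rw [← hs, ← Finset.card_map (k.succAboveEmb)]
          congr 1
          ext j
          simp only [Finset.mem_map, Finset.mem_filter, Finset.mem_univ, true_and]
          constructor
          · rintro ⟨i, hi, rfl⟩; exact hi
          · intro hj
            obtain ⟨i, rfl⟩ := Fin.exists_succAbove_eq (show j ≠ k by rintro rfl; exact hk hj)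
            exact ⟨i, hj, rfl⟩
        · intro i hi
          exact h _ (Finset.mem_filter.1 hi).2
      rw [this, smul_zero]
  · rw [ContinuousAlternatingMap.neg_apply, ContinuousAlternatingMap.alternatizeUncurryFin_apply,
      Fin.sum_univ_succ, ← hP]
    -- The summand in which the base covector receives the vertical vector drops out.
    have h0 : T.comp (ContinuousLinearMap.fst ℝ (Euc m) W)
        ((Fin.cons (0, w) fun i => (stdVec i, 0) : Fin (m + 1) → Euc m × W) 0) = 0 := by simp
    rw [h0]
    simp only [show ∀ x, (0 : (Euc m × W) [⋀^Fin m]→L[ℝ] ℝ) x = 0 from fun _ => rfl, smul_zero,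
      zero_add, ← Finset.sum_neg_distrib]
    refine Finset.sum_congr rfl fun k _ => ?_
    rw [map_cons_stdVec, momentum_apply]
    simp only [Fin.cons_succ, ContinuousLinearMap.comp_apply, ContinuousLinearMap.coe_fst',
      Fin.val_succ, pow_succ, smul_smul]
    -- Three signs multiply to +1: (−1)ᵏ⁺¹ from the alternatization, (−1)ᵏ from the reordering, and
    -- the minus sign in the definition of the morphism.
    rw [mul_neg_one, neg_mul, neg_smul, neg_neg, ← mul_pow]
    simp

end LinearAlgebra

/-! ### Jets in coordinates and their representing sections -/

section JetCoordinates

variable {V M : Type*} [NormedAddCommGroup V] [NormedSpace ℝ V] [TopologicalSpace M]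
  [ChartedSpace V M]
variable {F P : Type*} [NormedAddCommGroup F] [NormedSpace ℝ F] [TopologicalSpace P]
  [ChartedSpace (V × F) P] {ρ : P → M}

theorem Jet1.coord_change (c c' : FiberedChart V F ρ) (z : Jet1 V F ρ) (hz : z.pt ∈ c.κ.source)
    (hz' : z.pt ∈ c'.κ.source) :
    z.coord c' = (ContinuousLinearMap.snd ℝ V F).comp
      ((fderiv ℝ (c'.κ ∘ c.κ.symm) (c.κ z.pt)).comp
        (((ContinuousLinearMap.id ℝ V).prod (z.coord c)).comp
          (fderiv ℝ (c.ψ ∘ c'.ψ.symm) (c'.κ z.pt).1))) := by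
  rw [← Jet1.coord_ofCoord' c c' z.pt hz hz', Jet1.ofCoord_coord]

theorem Jet1.lin_eq (c : FiberedChart V F ρ) (z : Jet1 V F ρ) (hz : z.pt ∈ c.κ.source) :
    z.lin = (tmap (A := V × F) (B := V × F) c.κ.symm (c.κ z.pt)).comp
      (((ContinuousLinearMap.id ℝ V).prod (z.coord c)).comp
        (tmap (A := V) (B := V) c.ψ (ρ z.pt))) := by
  conv_lhs => rw [← Jet1.ofCoord_coord c z hz]
  rfl

theorem Jet1.eq_of_coord_eq (c : FiberedChart V F ρ) {z z' : Jet1 V F ρ}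
    (hz : z.pt ∈ c.κ.source) (h : z.pt = z'.pt) (h' : z.coord c = z'.coord c) : z = z' := by
  refine Jet1.ext' h ?_
  rw [Jet1.lin_eq c z hz, Jet1.lin_eq c z' (h ▸ hz), h', h]

theorem IsJetOf.base_eq {z : Jet1 V F ρ} {σ : M → P} {x : M} (h : IsJetOf z σ x) :
    ρ z.pt = x := by
  rw [← h.value]; exact h.isSection.self_of_nhds

theorem IsJetOf.mdifferentiableAt {z : Jet1 V F ρ} {σ : M → P} {x : M} (h : IsJetOf z σ x) :
    MDifferentiableAt 𝓘(ℝ, V) 𝓘(ℝ, V × F) σ x :=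
  h.smooth.self_of_nhds.mdifferentiableAt (by simp)

/-- This turns statements about jets into statements about ordinary derivatives of the coordinate
expression of a section. -/
theorem IsJetOf.hasFDerivAt {z : Jet1 V F ρ} {σ : M → P} {x : M} (h : IsJetOf z σ x)
    (c : FiberedChart V F ρ) (hz : z.pt ∈ c.κ.source) :
    HasFDerivAt (fun v => c.κ (σ (c.ψ.symm v)))
      ((ContinuousLinearMap.id ℝ V).prod (z.coord c)) (c.ψ x) := by
  have hx := h.base_eq
  have hxs : x ∈ c.ψ.source := hx ▸ c.mapsTo _ hz
  have h1 := mdiff_chart_symm c.mem_ψ (c.ψ.map_source hxs)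
  have h2 : MDifferentiableAt 𝓘(ℝ, V) 𝓘(ℝ, V × F) σ (c.ψ.symm (c.ψ x)) := by
    rw [c.ψ.left_inv hxs]; exact h.mdifferentiableAt
  have h3 : MDifferentiableAt 𝓘(ℝ, V × F) 𝓘(ℝ, V × F) c.κ (σ (c.ψ.symm (c.ψ x))) := by
    rw [c.ψ.left_inv hxs, h.value]; exact mdiff_chart c.mem_κ hz
  have h23 : MDifferentiableAt 𝓘(ℝ, V) 𝓘(ℝ, V × F) (c.κ ∘ σ) (c.ψ.symm (c.ψ x)) := h3.comp _ h2
  have h4 : MDifferentiableAt 𝓘(ℝ, V) 𝓘(ℝ, V × F) ((c.κ ∘ σ) ∘ c.ψ.symm) (c.ψ x) := h23.comp _ h1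
  have h5 := h4.differentiableAt.hasFDerivAt
  rw [← tmap_eq_fderiv, tmap_comp h23 h1, tmap_comp h3 h2, c.ψ.left_inv hxs, h.deriv, h.value,
    ContinuousLinearMap.comp_assoc, ← hx, ← Jet1.prod_coord c z hz, hx] at h5
  exact h5

/-- The local section whose expression in a fibred chart is affine, with a given jet. -/
def affineSection (c : FiberedChart V F ρ) (z : Jet1 V F ρ) (y : M) : P :=
  c.κ.symm (c.ψ y, (c.κ z.pt).2 + z.coord c (c.ψ y - c.ψ (ρ z.pt)))

theorem tendsto_chart_affine (c : FiberedChart V F ρ) (z : Jet1 V F ρ) (hz : z.pt ∈ c.κ.source) :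
    Tendsto (fun y => (c.ψ y, (c.κ z.pt).2 + z.coord c (c.ψ y - c.ψ (ρ z.pt))))
      (𝓝 (ρ z.pt)) (𝓝 (c.κ z.pt)) := by
  have h1 : ContinuousAt c.ψ (ρ z.pt) := c.ψ.continuousAt (c.mapsTo _ hz)
  have h2 : ContinuousAt (fun y => (c.ψ y, (c.κ z.pt).2 + z.coord c (c.ψ y - c.ψ (ρ z.pt))))
      (ρ z.pt) := by fun_prop
  convert! h2.tendsto using 2
  refine Prod.ext (c.fst_κ _ hz) ?_
  simp

theorem chart_affineSection (c : FiberedChart V F ρ) (z : Jet1 V F ρ) (hz : z.pt ∈ c.κ.source) :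
    ∀ᶠ y in 𝓝 (ρ z.pt), affineSection c z y ∈ c.κ.source ∧ y ∈ c.ψ.source ∧
      c.κ (affineSection c z y) = (c.ψ y, (c.κ z.pt).2 + z.coord c (c.ψ y - c.ψ (ρ z.pt))) := by
  filter_upwards [tendsto_chart_affine c z hz
    (c.κ.open_target.mem_nhds (c.κ.map_source hz)),
    c.ψ.open_source.mem_nhds (c.mapsTo _ hz)] with y hy hy'
  exact ⟨c.κ.map_target hy, hy', c.κ.right_inv hy⟩

/-- Every jet is represented by a local section. The affine choice has the further merit that
sections of two bundles over P whose jets have the same projection to J¹ lie over the same section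
of P near the point, not merely to first order. -/
theorem isJetOf_affineSection (c : FiberedChart V F ρ) (z : Jet1 V F ρ) (hz : z.pt ∈ c.κ.source) :
    IsJetOf z (affineSection c z) (ρ z.pt) := by
  have hs := c.mapsTo _ hz
  have hval : (c.ψ (ρ z.pt), (c.κ z.pt).2 + z.coord c (c.ψ (ρ z.pt) - c.ψ (ρ z.pt))) =
      c.κ z.pt := by
    refine Prod.ext (c.fst_κ _ hz).symm ?_
    simp
  let g : V → V × F := fun v => (v, (c.κ z.pt).2 + z.coord c (v - c.ψ (ρ z.pt)))
  have hg : ContDiff ℝ ∞ g := by fun_prop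
  refine ⟨?_, ?_, ?_, ?_⟩
  · filter_upwards [chart_affineSection c z hz] with y hy
    have h1 := c.fst_κ _ hy.1
    rw [hy.2.2] at h1
    exact (c.ψ.injOn hy.2.1 (c.mapsTo _ hy.1) h1).symm
  · filter_upwards [tendsto_chart_affine c z hz
      (c.κ.open_target.mem_nhds (c.κ.map_source hz)), c.ψ.open_source.mem_nhds hs] with y hy hy'
    have h1 := contMDiffAt_of_mem_maximalAtlas c.mem_ψ hy'
    have h2 : ContMDiffAt 𝓘(ℝ, V) 𝓘(ℝ, V × F) ∞ (g ∘ c.ψ) y := hg.contMDiff.contMDiffAt.comp y h1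
    have h3 : ContMDiffAt 𝓘(ℝ, V × F) 𝓘(ℝ, V × F) ∞ c.κ.symm ((g ∘ c.ψ) y) :=
      contMDiffAt_symm_of_mem_maximalAtlas c.mem_κ hy
    exact h3.comp y h2
  · rw [affineSection, hval, c.κ.left_inv hz]
  · have h1 := mdiff_chart c.mem_ψ hs
    have h2 : MDifferentiableAt 𝓘(ℝ, V) 𝓘(ℝ, V × F) g (c.ψ (ρ z.pt)) :=
      (hg.differentiable (by simp) _).mdifferentiableAt
    have h12 : MDifferentiableAt 𝓘(ℝ, V) 𝓘(ℝ, V × F) (g ∘ c.ψ) (ρ z.pt) := h2.comp _ h1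
    have h3 : MDifferentiableAt 𝓘(ℝ, V × F) 𝓘(ℝ, V × F) c.κ.symm ((g ∘ c.ψ) (ρ z.pt)) := by
      change MDifferentiableAt _ _ _ (c.ψ (ρ z.pt), _)
      rw [hval]; exact mdiff_chart_symm c.mem_κ (c.κ.map_source hz)
    have h4 : affineSection c z = c.κ.symm ∘ (g ∘ c.ψ) := rfl
    have h5 : fderiv ℝ g (c.ψ (ρ z.pt)) = (ContinuousLinearMap.id ℝ V).prod (z.coord c) := by
      have h6 : HasFDerivAt g ((ContinuousLinearMap.id ℝ V).prod (z.coord c)) (c.ψ (ρ z.pt)) := by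
        refine (hasFDerivAt_id _).prodMk (HasFDerivAt.const_add _ ?_)
        exact (z.coord c).hasFDerivAt.comp _ ((hasFDerivAt_id _).sub_const _)
      exact h6.fderiv
    rw [h4, tmap_comp h3 h12, tmap_comp h2 h1, tmap_eq_fderiv, h5,
      show (g ∘ c.ψ) (ρ z.pt) = c.κ z.pt from hval, Jet1.lin_eq c z hz]

variable [IsManifold 𝓘(ℝ, V × F) ∞ P] [IsFibration V F ρ]

theorem FiberedChart.jet_apply (c : FiberedChart V F ρ) (z : Jet1 V F ρ) :
    c.jet.κ z = ((c.κ z.pt).1, (c.κ z.pt).2, z.coord c) := rfl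

theorem FiberedChart.jet_ψ (c : FiberedChart V F ρ) : c.jet.ψ = c.ψ := rfl

variable [FiniteDimensional ℝ V] [FiniteDimensional ℝ F] {k r : ℕ}

theorem FiberedChart.mem_forms_source (c : FiberedChart V F ρ) (α : HForm V F ρ k r) :
    α ∈ (c.forms k r).κ.source ↔ α.pt ∈ c.κ.source := Iff.rfl

/-- Read in charts, ν is the linear projection `p` that forgets the components of the form, so j¹ν
forgets their derivatives. -/
theorem Jet1.base_coord (c : FiberedChart V F ρ)
    (w : Jet1 V (F × ModelForms V F k r) (HForm.proj ρ k r : HForm V F ρ k r → M))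
    (hw : w.pt.pt ∈ c.κ.source) :
    w.base.coord c = (ContinuousLinearMap.fst ℝ F (ModelForms V F k r)).comp
      (w.coord (c.forms k r)) := by
  let p : V × (F × ModelForms V F k r) →L[ℝ] V × F :=
    (ContinuousLinearMap.fst ℝ _ _).prod
      ((ContinuousLinearMap.fst ℝ _ _).comp (ContinuousLinearMap.snd ℝ _ _))
  have h1 : MDifferentiableAt 𝓘(ℝ, V × (F × ModelForms V F k r)) 𝓘(ℝ, V × F)
      (HForm.pt : HForm V F ρ k r → P) w.pt :=
    ((HForm.bundleCharts ρ k r).contMDiff_proj w.pt).mdifferentiableAt (by simp)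
  have h2 := mdiff_chart c.mem_κ hw
  have h3 := mdiff_chart (c.forms k r).mem_κ ((c.mem_forms_source w.pt).2 hw)
  have h4 : MDifferentiableAt 𝓘(ℝ, V × (F × ModelForms V F k r)) 𝓘(ℝ, V × F) p
      ((c.forms k r).κ w.pt) := p.differentiableAt.mdifferentiableAt
  have h5 : (tmap (A := V × F) (B := V × F) c.κ w.pt.pt).comp
      (tmap (A := V × (F × ModelForms V F k r)) (B := V × F) HForm.pt w.pt) =
      p.comp (tmap (A := V × (F × ModelForms V F k r)) (B := V × (F × ModelForms V F k r))
        (c.forms k r).κ w.pt) := by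
    rw [← tmap_comp h2 h1]
    have : p = tmap (A := V × (F × ModelForms V F k r)) (B := V × F) p ((c.forms k r).κ w.pt) := by
      rw [tmap_eq_fderiv, p.fderiv]
    rw [this, ← tmap_comp h4 h3]
    rfl
  ext v
  exact congrArg Prod.snd (DFunLike.congr_fun h5
    (w.lin (tmap (A := V) (B := V) c.ψ.symm (c.ψ (ρ w.pt.pt)) v)))

end JetCoordinates

theorem fderiv_change_differentiableAt {A X : Type*} [NormedAddCommGroup A] [NormedSpace ℝ A]
    [TopologicalSpace X] [ChartedSpace A X] {e e' : OpenPartialHomeomorph X A}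
    (he : e ∈ IsManifold.maximalAtlas 𝓘(ℝ, A) ∞ X)
    (he' : e' ∈ IsManifold.maximalAtlas 𝓘(ℝ, A) ∞ X) {x : X} (hx : x ∈ e.source)
    (hx' : x ∈ e'.source) : DifferentiableAt ℝ (fderiv ℝ (e' ∘ e.symm)) (e x) := by
  refine ((contDiffOn_fderiv_change he he').differentiableOn (by simp)).differentiableAt
    ((e.symm.trans e').open_source.mem_nhds ⟨e.map_source hx, ?_⟩)
  simpa [e.left_inv hx] using hx'

theorem change_contDiffAt {A X : Type*} [NormedAddCommGroup A] [NormedSpace ℝ A]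
    [TopologicalSpace X] [ChartedSpace A X] {e e' : OpenPartialHomeomorph X A}
    (he : e ∈ IsManifold.maximalAtlas 𝓘(ℝ, A) ∞ X)
    (he' : e' ∈ IsManifold.maximalAtlas 𝓘(ℝ, A) ∞ X) {x : X} (hx : x ∈ e.source)
    (hx' : x ∈ e'.source) : ContDiffAt ℝ ∞ (e' ∘ e.symm) (e x) := by
  refine (contDiffOn_change he he').contDiffAt
    ((e.symm.trans e').open_source.mem_nhds ⟨e.map_source hx, ?_⟩)
  simpa [e.left_inv hx] using hx'

theorem change_isSymmSndFDerivAt {A X : Type*} [NormedAddCommGroup A] [NormedSpace ℝ A]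
    [TopologicalSpace X] [ChartedSpace A X] {e e' : OpenPartialHomeomorph X A}
    (he : e ∈ IsManifold.maximalAtlas 𝓘(ℝ, A) ∞ X)
    (he' : e' ∈ IsManifold.maximalAtlas 𝓘(ℝ, A) ∞ X) {x : X} (hx : x ∈ e.source)
    (hx' : x ∈ e'.source) : IsSymmSndFDerivAt ℝ (e' ∘ e.symm) (e x) :=
  (change_contDiffAt he he' hx hx').isSymmSndFDerivAt (by
    rw [minSmoothness_of_isRCLikeNormedField]
    exact WithTop.coe_le_coe.2 (le_top : (2 : ℕ∞) ≤ ⊤))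

/-! ### Differentiability of vector fields, read in an arbitrary chart -/

section TangentSections

variable {A X : Type*} [NormedAddCommGroup A] [NormedSpace ℝ A] [TopologicalSpace X]
    [ChartedSpace A X]

theorem mdifferentiableAt_clm_chart_change {e e' : OpenPartialHomeomorph X A}
    (he : e ∈ IsManifold.maximalAtlas 𝓘(ℝ, A) ∞ X)
    (he' : e' ∈ IsManifold.maximalAtlas 𝓘(ℝ, A) ∞ X) {x : X}
    (hx : x ∈ e.source) (hx' : x ∈ e'.source) :
    MDifferentiableAt 𝓘(ℝ, A) 𝓘(ℝ, A →L[ℝ] A) (fun y => fderiv ℝ (e' ∘ e.symm) (e y)) x := by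
  have h1 : DifferentiableAt ℝ (fderiv ℝ (e' ∘ e.symm)) (e x) := by
    refine ((contDiffOn_fderiv_change he he').differentiableOn (by simp)).differentiableAt
      ((e.symm.trans e').open_source.mem_nhds ⟨e.map_source hx, ?_⟩)
    simpa [e.left_inv hx] using hx'
  exact h1.mdifferentiableAt.comp x (mdiff_chart he hx)

theorem mdifferentiableAt_section_change {e e' : OpenPartialHomeomorph X A}
    (he : e ∈ IsManifold.maximalAtlas 𝓘(ℝ, A) ∞ X)
    (he' : e' ∈ IsManifold.maximalAtlas 𝓘(ℝ, A) ∞ X) {x : X}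
    (hx : x ∈ e.source) (hx' : x ∈ e'.source) {Y : X → A}
    (h : MDifferentiableAt 𝓘(ℝ, A) 𝓘(ℝ, A) (fun y => tmap (A := A) (B := A) e y (Y y)) x) :
    MDifferentiableAt 𝓘(ℝ, A) 𝓘(ℝ, A) (fun y => tmap (A := A) (B := A) e' y (Y y)) x := by
  have h1 := (mdifferentiableAt_clm_chart_change he he' hx hx').clm_apply h
  refine h1.congr_of_eventuallyEq ?_
  filter_upwards [e.open_source.mem_nhds hx, e'.open_source.mem_nhds hx'] with y hy hy'
  rw [← tmap_comp_tmap_symm he he' hy hy']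
  have := DFunLike.congr_fun (tmap_symm_comp he hy) (Y y)
  simp only [ContinuousLinearMap.comp_apply, ContinuousLinearMap.id_apply] at this ⊢
  rw [this]

/-- The trivialization at `x` amounts to the preferred chart there, and a change of charts acts on
components through a differentiable family of linear maps. -/
theorem mdifferentiableAt_section_iff_chart [IsManifold 𝓘(ℝ, A) ∞ X] {e : OpenPartialHomeomorph X A}
    (he : e ∈ IsManifold.maximalAtlas 𝓘(ℝ, A) ∞ X) {x : X} (hx : x ∈ e.source)
    (Y : ∀ y : X, TangentSpace 𝓘(ℝ, A) y) :
    MDifferentiableAt 𝓘(ℝ, A) 𝓘(ℝ, A).tangent (fun y => (⟨y, Y y⟩ : TangentBundle 𝓘(ℝ, A) X)) x ↔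
    MDifferentiableAt 𝓘(ℝ, A) 𝓘(ℝ, A) (fun y => tmap (A := A) (B := A) e y (Y y)) x := by
  have hc : chartAt A x ∈ IsManifold.maximalAtlas 𝓘(ℝ, A) ∞ X :=
    IsManifold.chart_mem_maximalAtlas x
  have h1 : MDifferentiableAt 𝓘(ℝ, A) 𝓘(ℝ, A).tangent
      (fun y => (⟨y, Y y⟩ : TangentBundle 𝓘(ℝ, A) X)) x ↔
      MDifferentiableAt 𝓘(ℝ, A) 𝓘(ℝ, A)
        (fun y => tmap (A := A) (B := A) (chartAt A x) y (Y y)) x := by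
    refine (mdifferentiableAt_section 𝓘(ℝ, A) Y).trans ?_
    refine Filter.EventuallyEq.mdifferentiableAt_iff ?_
    filter_upwards [(chartAt A x).open_source.mem_nhds (mem_chart_source A x)] with y hy
    have := mfderiv_chartAt_eq_tangentCoordChange (I := 𝓘(ℝ, A)) hy
    change _ = (mfderiv 𝓘(ℝ, A) 𝓘(ℝ, A) (chartAt A x) y) (Y y)
    rw [this]
    rfl
  rw [h1]
  exact ⟨mdifferentiableAt_section_change hc he (mem_chart_source A x) hx,
    mdifferentiableAt_section_change he hc hx (mem_chart_source A x)⟩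

end TangentSections

/-! ### Linear connections in a chart: Christoffel symbols and torsion -/

section Connections

variable {m : ℕ} {M : Type*} [TopologicalSpace M] [ChartedSpace (Euc m) M]
  {ψ ψ' : OpenPartialHomeomorph M (Euc m)} {x : M}

theorem tmap_coordField (hψ : ψ ∈ IsManifold.maximalAtlas 𝓘(ℝ, Euc m) ∞ M) (hx : x ∈ ψ.source)
    (v : Euc m) : tmap (A := Euc m) (B := Euc m) ψ x (coordField ψ v x) = v :=
  DFunLike.congr_fun (tmap_comp_symm hψ hx) v

theorem coordField_tmap (hψ : ψ ∈ IsManifold.maximalAtlas 𝓘(ℝ, Euc m) ∞ M) (hx : x ∈ ψ.source)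
    (v : Euc m) : coordField ψ (tmap (A := Euc m) (B := Euc m) ψ x v) x = v :=
  DFunLike.congr_fun (tmap_symm_comp hψ hx) v

theorem coordField_change (hψ : ψ ∈ IsManifold.maximalAtlas 𝓘(ℝ, Euc m) ∞ M)
    (hψ' : ψ' ∈ IsManifold.maximalAtlas 𝓘(ℝ, Euc m) ∞ M) (hx : x ∈ ψ.source) (hx' : x ∈ ψ'.source)
    (v : Euc m) : coordField ψ' v x = coordField ψ (fderiv ℝ (ψ ∘ ψ'.symm) (ψ' x) v) x := by
  rw [← tmap_comp_tmap_symm hψ' hψ hx' hx]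
  exact (coordField_tmap hψ hx _).symm

theorem coordField_sum (w : Euc m) (y : M) :
    coordField ψ w y = ∑ i, w i • coordField ψ (stdVec i) y := by
  have h : w = ∑ i, w i • stdVec i := by
    ext j
    simp [Pi.single_apply]
  conv_lhs => rw [h]
  simp only [coordField, map_sum, map_smul]
  rfl

theorem christoffel_apply
    (cov : (∀ x : M, TangentSpace 𝓘(ℝ, Euc m) x) →
      ∀ x : M, TangentSpace 𝓘(ℝ, Euc m) x →L[ℝ] TangentSpace 𝓘(ℝ, Euc m) x) (v w : Euc m) :
    christoffel cov ψ x v w = ∑ i, w i • tmap (A := Euc m) (B := Euc m) ψ x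
      (cov (coordField ψ (stdVec i)) x (coordField ψ v x)) := by
  simp only [christoffel, sum_apply]
  rfl

/-- The flat connection on the domain of a chart. -/
def flatConnection (ψ : OpenPartialHomeomorph M (Euc m))
    (Y : ∀ x : M, TangentSpace 𝓘(ℝ, Euc m) x) (x : M) :
    TangentSpace 𝓘(ℝ, Euc m) x →L[ℝ] TangentSpace 𝓘(ℝ, Euc m) x :=
  (tmap (A := Euc m) (B := Euc m) ψ.symm (ψ x)).comp
    (tmap (A := Euc m) (B := Euc m) (fun y => tmap (A := Euc m) (B := Euc m) ψ y (Y y)) x)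

theorem christoffel_flatConnection (hψ : ψ ∈ IsManifold.maximalAtlas 𝓘(ℝ, Euc m) ∞ M)
    (hx : x ∈ ψ.source) : christoffel (flatConnection ψ) ψ x = 0 := by
  ext v w : 2
  rw [christoffel_apply]
  refine Finset.sum_eq_zero fun i _ => ?_
  have h1 : tmap (A := Euc m) (B := Euc m) (fun y => tmap (A := Euc m) (B := Euc m) ψ y
      (coordField ψ (stdVec i) y)) x = 0 := by
    have h2 : tmap (A := Euc m) (B := Euc m) (fun _ : M => (stdVec i : Euc m)) x = 0 :=
      mfderiv_const
    rw [← h2]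
    refine tmap_congr ?_
    filter_upwards [ψ.open_source.mem_nhds hx] with y hy using tmap_coordField hψ hy _
  have h3 : flatConnection ψ (coordField ψ (stdVec i)) x = 0 := by
    unfold flatConnection
    rw [h1]
    exact ContinuousLinearMap.comp_zero _
  rw [h3]
  have h4 : tmap (A := Euc m) (B := Euc m) ψ x (0 : Euc m) = 0 := map_zero _
  exact (congrArg _ h4).trans (smul_zero _)

variable [IsManifold 𝓘(ℝ, Euc m) ∞ M]

theorem mdifferentiableAt_coordField (hψ : ψ ∈ IsManifold.maximalAtlas 𝓘(ℝ, Euc m) ∞ M)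
    (hx : x ∈ ψ.source) {g : M → Euc m} (hg : MDifferentiableAt 𝓘(ℝ, Euc m) 𝓘(ℝ, Euc m) g x) :
    MDifferentiableAt 𝓘(ℝ, Euc m) 𝓘(ℝ, Euc m).tangent
      (fun y => (⟨y, coordField ψ (g y) y⟩ : TangentBundle 𝓘(ℝ, Euc m) M)) x := by
  rw [mdifferentiableAt_section_iff_chart hψ hx]
  refine hg.congr_of_eventuallyEq ?_
  filter_upwards [ψ.open_source.mem_nhds hx] with y hy using tmap_coordField hψ hy _

variable {cov : (∀ x : M, TangentSpace 𝓘(ℝ, Euc m) x) →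
      ∀ x : M, TangentSpace 𝓘(ℝ, Euc m) x →L[ℝ] TangentSpace 𝓘(ℝ, Euc m) x} {U : Set M}

theorem IsCovariantDerivativeOn.sum_smul {ι : Type*} (s : Finset ι)
    (h : IsCovariantDerivativeOn (Euc m) cov U) (hx : x ∈ U) {g : ι → M → ℝ}
    {Y : ι → ∀ y : M, TangentSpace 𝓘(ℝ, Euc m) y}
    (hg : ∀ i, MDifferentiableAt 𝓘(ℝ, Euc m) 𝓘(ℝ, ℝ) (g i) x)
    (hY : ∀ i, MDifferentiableAt 𝓘(ℝ, Euc m) 𝓘(ℝ, Euc m).tangent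
      (fun y => (⟨y, Y i y⟩ : TangentBundle 𝓘(ℝ, Euc m) M)) x) (v : Euc m) :
    cov (fun y => ∑ i ∈ s, g i y • Y i y) x v =
      ∑ i ∈ s, (g i x • cov (Y i) x v + (tmap (A := Euc m) (B := ℝ) (g i) x v) • Y i x) := by
  classical
  induction s using Finset.induction_on with
  | empty =>
    simp only [Finset.sum_empty]
    exact DFunLike.congr_fun (h.zero hx) v
  | insert i s hi ih =>
    have h1 := (hg i).smul_section (hY i)
    have h2 : MDifferentiableAt 𝓘(ℝ, Euc m) 𝓘(ℝ, Euc m).tangent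
      (fun y => (⟨y, ∑ i ∈ s, g i y • Y i y⟩ : TangentBundle 𝓘(ℝ, Euc m) M)) x :=
      MDifferentiableAt.sum_section fun j _ => (hg j).smul_section (hY j)
    have h3 := h.add h1 h2 hx
    have h4 : (fun y => ∑ i ∈ insert i s, g i y • Y i y) =
        (g i • Y i) + fun y => ∑ i ∈ s, g i y • Y i y := by
      funext y
      rw [Finset.sum_insert hi]; rfl
    rw [h4, h3, h.leibniz (hY i) (hg i) hx, Finset.sum_insert hi, ← ih]
    rfl

/-- Leibniz rule applied to Y = ∑ gⁱ ∂ᵢ: derivatives of the components, plus the Christoffel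
symbols. -/
theorem IsCovariantDerivativeOn.chart_apply (h : IsCovariantDerivativeOn (Euc m) cov U)
    (hU : IsOpen U) (hxU : x ∈ U) (hψ : ψ ∈ IsManifold.maximalAtlas 𝓘(ℝ, Euc m) ∞ M)
    (hx : x ∈ ψ.source) {g : M → Euc m} (hg : MDifferentiableAt 𝓘(ℝ, Euc m) 𝓘(ℝ, Euc m) g x)
    {Y : ∀ y : M, TangentSpace 𝓘(ℝ, Euc m) y} (hY : ∀ᶠ y in 𝓝 x, Y y = coordField ψ (g y) y)
    (X : Euc m) :
    tmap (A := Euc m) (B := Euc m) ψ x (cov Y x X) = tmap (A := Euc m) (B := Euc m) g x X +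
      christoffel cov ψ x (tmap (A := Euc m) (B := Euc m) ψ x X) (g x) := by
  have hgi : ∀ i, MDifferentiableAt 𝓘(ℝ, Euc m) 𝓘(ℝ, ℝ) (fun y => g y i) x := fun i =>
    ((EuclideanSpace.proj i : Euc m →L[ℝ] ℝ).differentiableAt.mdifferentiableAt).comp x hg
  have hci : ∀ i : Fin m, MDifferentiableAt 𝓘(ℝ, Euc m) 𝓘(ℝ, Euc m).tangent
      (fun y => (⟨y, coordField ψ (stdVec i) y⟩ : TangentBundle 𝓘(ℝ, Euc m) M)) x :=
    fun i => mdifferentiableAt_coordField hψ hx mdifferentiableAt_const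
  have hg' := mdifferentiableAt_coordField hψ hx hg
  have hsum : (fun y => coordField ψ (g y) y) =
      fun y => ∑ i, g y i • coordField ψ (stdVec i) y := by
    funext y; exact coordField_sum _ _
  have hYd : MDifferentiableAt 𝓘(ℝ, Euc m) 𝓘(ℝ, Euc m).tangent
      (fun y => (⟨y, Y y⟩ : TangentBundle 𝓘(ℝ, Euc m) M)) x := by
    refine hg'.congr_of_eventuallyEq ?_
    filter_upwards [hY] with y hy
    rw [hy]
  have h5 : tmap (A := Euc m) (B := Euc m) g x X =
      ∑ i, tmap (A := Euc m) (B := ℝ) (fun y => g y i) x X • stdVec i := by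
    ext j
    have h6 : tmap (A := Euc m) (B := ℝ) (fun y => g y j) x =
        (EuclideanSpace.proj j : Euc m →L[ℝ] ℝ).comp (tmap (A := Euc m) (B := Euc m) g x) := by
      have := tmap_comp (g := (EuclideanSpace.proj j : Euc m →L[ℝ] ℝ))
        (EuclideanSpace.proj j : Euc m →L[ℝ] ℝ).differentiableAt.mdifferentiableAt hg
      rw [tmap_eq_fderiv, ContinuousLinearMap.fderiv] at this
      exact this
    simp only [WithLp.ofLp_sum, Finset.sum_apply, PiLp.smul_apply, PiLp.single_apply, smul_eq_mul,
      mul_ite, mul_one, mul_zero, Finset.sum_ite_eq, Finset.mem_univ, if_true]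
    rw [h6]; rfl
  have h7 : ∀ (L : Euc m →L[ℝ] Euc m) (a b : Fin m → ℝ) (p q : Fin m → Euc m),
      L (∑ i, (a i • p i + b i • q i)) = ∑ i, b i • L (q i) + ∑ i, a i • L (p i) := by
    intro L a b p q
    simp only [map_sum, map_add, map_smul, Finset.sum_add_distrib]
    rw [add_comm]
  -- A connection on an open set is local, so `Y` may be replaced by its expansion near `x`.
  rw [h.congr_of_eventuallyEq hYd hg' (hU.mem_nhds hxU) hY, hsum,
    h.sum_smul Finset.univ hxU (g := fun i y => g y i) hgi hci X]
  refine (h7 (tmap (A := Euc m) (B := Euc m) ψ x) (fun i => g x i) _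
    (fun i => cov (coordField ψ (stdVec i)) x X) (fun i => coordField ψ (stdVec i) x)).trans ?_
  rw [christoffel_apply, h5]
  congr 1
  · exact Finset.sum_congr rfl fun i _ => by rw [tmap_coordField hψ hx]
  · exact Finset.sum_congr rfl fun i _ => by rw [coordField_tmap hψ hx]

/-- The transformation rule of the Christoffel symbols. -/
theorem IsCovariantDerivativeOn.christoffel_change (h : IsCovariantDerivativeOn (Euc m) cov U)
    (hU : IsOpen U) (hxU : x ∈ U) (hψ : ψ ∈ IsManifold.maximalAtlas 𝓘(ℝ, Euc m) ∞ M)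
    (hψ' : ψ' ∈ IsManifold.maximalAtlas 𝓘(ℝ, Euc m) ∞ M) (hx : x ∈ ψ.source)
    (hx' : x ∈ ψ'.source) (v w : Euc m) :
    fderiv ℝ (ψ ∘ ψ'.symm) (ψ' x) (christoffel cov ψ' x v w) =
      fderiv ℝ (fderiv ℝ (ψ ∘ ψ'.symm)) (ψ' x) v w +
        christoffel cov ψ x (fderiv ℝ (ψ ∘ ψ'.symm) (ψ' x) v)
          (fderiv ℝ (ψ ∘ ψ'.symm) (ψ' x) w) := by
  obtain ⟨X, hX⟩ : ∃ X : Euc m, tmap (A := Euc m) (B := Euc m) ψ' x X = v :=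
    ⟨_, tmap_coordField hψ' hx' v⟩
  obtain ⟨Z, hZ⟩ : ∃ Z : Euc m, cov (coordField ψ' w) x X = Z := ⟨_, rfl⟩
  -- The same covariant derivative is computed twice: with constant components `w` in ψ', and below
  -- with components Dχ(w) in ψ, where χ = ψ ∘ ψ'⁻¹. The derivative of Dχ produces the inhomogeneous
  -- term.
  have h1 := h.chart_apply hU hxU hψ' hx' (g := fun _ => w) mdifferentiableAt_const
    (Eventually.of_forall fun _ => rfl) X
  have hg : MDifferentiableAt 𝓘(ℝ, Euc m) 𝓘(ℝ, Euc m)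
      (fun y => fderiv ℝ (ψ ∘ ψ'.symm) (ψ' y) w) x :=
    (mdifferentiableAt_clm_chart_change hψ' hψ hx' hx).clm_apply mdifferentiableAt_const
  have h2 := h.chart_apply (Y := coordField ψ' w) hU hxU hψ hx hg (by
      filter_upwards [ψ.open_source.mem_nhds hx, ψ'.open_source.mem_nhds hx'] with y hy hy'
      exact coordField_change hψ hψ' hy hy' w) X
  have hd : DifferentiableAt ℝ (fderiv ℝ (ψ ∘ ψ'.symm)) (ψ' x) := by
    refine ((contDiffOn_fderiv_change hψ' hψ).differentiableOn (by simp)).differentiableAt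
      ((ψ'.symm.trans ψ).open_source.mem_nhds ⟨ψ'.map_source hx', ?_⟩)
    simpa [ψ'.left_inv hx'] using hx
  have h3 : tmap (A := Euc m) (B := Euc m) (fun y => fderiv ℝ (ψ ∘ ψ'.symm) (ψ' y) w) x X =
      fderiv ℝ (fderiv ℝ (ψ ∘ ψ'.symm)) (ψ' x) v w := by
    have hd' : DifferentiableAt ℝ (fun y => fderiv ℝ (ψ ∘ ψ'.symm) y w) (ψ' x) :=
      hd.clm_apply (differentiableAt_const w)
    have h4 := tmap_comp (f := ψ') (g := fun y => fderiv ℝ (ψ ∘ ψ'.symm) y w)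
      hd'.mdifferentiableAt (mdiff_chart hψ' hx')
    have h5 := DFunLike.congr_fun h4 X
    refine h5.trans ?_
    rw [ContinuousLinearMap.comp_apply, hX, tmap_eq_fderiv,
      fderiv_clm_apply hd (differentiableAt_const w)]
    simp
  have h6 : ∀ Y : Euc m, tmap (A := Euc m) (B := Euc m) ψ x Y =
      fderiv ℝ (ψ ∘ ψ'.symm) (ψ' x) (tmap (A := Euc m) (B := Euc m) ψ' x Y) := by
    intro Y
    rw [← tmap_comp_tmap_symm hψ' hψ hx' hx]
    exact congrArg _ (DFunLike.congr_fun (tmap_symm_comp hψ' hx') Y).symm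
  have h7 : tmap (A := Euc m) (B := Euc m) (fun _ : M => w) x X = 0 := by
    have : tmap (A := Euc m) (B := Euc m) (fun _ : M => w) x = 0 := mfderiv_const
    rw [this]; rfl
  rw [hZ, h3, h6, h6 X, hX] at h2
  rw [hZ, h7, zero_add, hX] at h1
  rw [← h1, h2]

/-- The inhomogeneous term of the transformation rule is a second derivative, hence symmetric, and
Dχ is injective. -/
theorem IsCovariantDerivativeOn.christoffel_symm_change
    (h : IsCovariantDerivativeOn (Euc m) cov U)
    (hU : IsOpen U) (hxU : x ∈ U) (hψ : ψ ∈ IsManifold.maximalAtlas 𝓘(ℝ, Euc m) ∞ M)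
    (hψ' : ψ' ∈ IsManifold.maximalAtlas 𝓘(ℝ, Euc m) ∞ M) (hx : x ∈ ψ.source)
    (hx' : x ∈ ψ'.source) (hs : ∀ v w, christoffel cov ψ x v w = christoffel cov ψ x w v)
    (v w : Euc m) : christoffel cov ψ' x v w = christoffel cov ψ' x w v := by
  have h1 := h.christoffel_change hU hxU hψ hψ' hx hx' v w
  rw [hs, change_isSymmSndFDerivAt hψ' hψ hx' hx v w,
    ← h.christoffel_change hU hxU hψ hψ' hx hx' w v] at h1
  have h2 : Function.Injective (fderiv ℝ (ψ ∘ ψ'.symm) (ψ' x)) := by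
    rw [← tmap_comp_tmap_symm hψ' hψ hx' hx]
    refine Function.Injective.comp (g := tmap (A := Euc m) (B := Euc m) ψ x)
      (f := tmap (A := Euc m) (B := Euc m) ψ'.symm (ψ' x)) ?_ ?_
    · exact Function.LeftInverse.injective (g := tmap (A := Euc m) (B := Euc m) ψ.symm (ψ x))
        (fun v => DFunLike.congr_fun (tmap_symm_comp hψ hx) v)
    · exact Function.LeftInverse.injective (g := tmap (A := Euc m) (B := Euc m) ψ' x)
        (fun v => DFunLike.congr_fun (tmap_comp_symm hψ' hx') v)
  exact h2 h1

/-- Fields with constant components are pulled back from constant fields of the model space, and the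
bracket commutes with pullback. -/
theorem mlieBracket_coordField (hψ : ψ ∈ IsManifold.maximalAtlas 𝓘(ℝ, Euc m) ∞ M)
    (hx : x ∈ ψ.source) (v w : Euc m) :
    VectorField.mlieBracket 𝓘(ℝ, Euc m) (coordField ψ v) (coordField ψ w) x = 0 := by
  have hpull : ∀ v : Euc m, coordField ψ v =ᶠ[𝓝 x]
      VectorField.mpullback 𝓘(ℝ, Euc m) 𝓘(ℝ, Euc m) ψ (fun _ => v) := by
    intro v
    filter_upwards [ψ.open_source.mem_nhds hx] with y hy
    have h1 := ContinuousLinearMap.inverse_eq (tmap_comp_symm hψ hy) (tmap_symm_comp hψ hy)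
    exact (DFunLike.congr_fun h1 v).symm
  have hc : ∀ v : Euc m, MDifferentiableAt 𝓘(ℝ, Euc m) 𝓘(ℝ, Euc m).tangent
      (fun y => (⟨y, v⟩ : TangentBundle 𝓘(ℝ, Euc m) (Euc m))) (ψ x) := by
    intro v
    have := (contMDiffAt_vectorSpace_iff_contDiffAt (𝕜 := ℝ) (n := 1) (x := ψ x)
      (V := fun _ : Euc m => v)).2 contDiffAt_const
    exact this.mdifferentiableAt (by simp)
  have : IsManifold 𝓘(ℝ, Euc m) (minSmoothness ℝ 2) M := by
    rw [minSmoothness_of_isRCLikeNormedField]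
    exact IsManifold.of_le (n := ∞) (by exact WithTop.coe_le_coe.2 (le_top : (2 : ℕ∞) ≤ ⊤))
  rw [(hpull v).mlieBracket_vectorField_eq (hpull w),
    ← VectorField.mpullback_mlieBracket (n := ∞) (hc v) (hc w)
      (contMDiffAt_of_mem_maximalAtlas hψ hx) (by
        rw [minSmoothness_of_isRCLikeNormedField]; exact WithTop.coe_le_coe.2 (le_top : (2 : ℕ∞) ≤ ⊤))]
  have h0 : VectorField.mlieBracket 𝓘(ℝ, Euc m)
      (fun y : Euc m => (v : TangentSpace 𝓘(ℝ, Euc m) y))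
      (fun y : Euc m => (w : TangentSpace 𝓘(ℝ, Euc m) y)) (ψ x) = 0 := by
    have h1 := congrFun
      (VectorField.mlieBracketWithin_eq_lieBracketWithin (𝕜 := ℝ) (s := univ)
      (V := fun y : Euc m => (v : TangentSpace 𝓘(ℝ, Euc m) y))
      (W := fun y : Euc m => (w : TangentSpace 𝓘(ℝ, Euc m) y))) (ψ x)
    refine (congrFun VectorField.mlieBracketWithin_univ.symm _).trans (h1.trans ?_)
    have h2 : ∀ u : Euc m, fderivWithin ℝ (fun _ : Euc m => u) univ (ψ x) = 0 := by simp
    change fderivWithin ℝ (fun _ : Euc m => w) univ (ψ x) v -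
      fderivWithin ℝ (fun _ : Euc m => v) univ (ψ x) w = 0
    rw [h2, h2]; simp
  rw [VectorField.mpullback_apply, h0, map_zero]

/-- Evaluate the torsion on coordinate fields, which commute. -/
theorem IsSymmetricConnectionOn.christoffel_symm (h : IsSymmetricConnectionOn cov U)
    (hU : IsOpen U) (hxU : x ∈ U) (hψ : ψ ∈ IsManifold.maximalAtlas 𝓘(ℝ, Euc m) ∞ M)
    (hx : x ∈ ψ.source) (v w : Euc m) :
    christoffel cov ψ x v w = christoffel cov ψ x w v := by
  have key : ∀ v w : Euc m, christoffel cov ψ x v w = tmap (A := Euc m) (B := Euc m) ψ x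
      (cov (coordField ψ w) x (coordField ψ v x)) := by
    intro v w
    obtain ⟨X, hX⟩ : ∃ X : Euc m, coordField ψ v x = X := ⟨_, rfl⟩
    have h1 := h.isCovariantDerivativeOn.chart_apply hU hxU hψ hx (g := fun _ => w)
      mdifferentiableAt_const (Eventually.of_forall fun _ => rfl) X
    have h7 : tmap (A := Euc m) (B := Euc m) (fun _ : M => w) x X = 0 := by
      have : tmap (A := Euc m) (B := Euc m) (fun _ : M => w) x = 0 := mfderiv_const
      rw [this]; rfl
    have h8 : tmap (A := Euc m) (B := Euc m) ψ x X = v := hX ▸ tmap_coordField hψ hx v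
    rw [h7, zero_add, h8] at h1
    rw [← h1, hX]
  have hc : ∀ v : Euc m, MDifferentiableAt 𝓘(ℝ, Euc m) 𝓘(ℝ, Euc m).tangent
      (fun y => (⟨y, coordField ψ v y⟩ : TangentBundle 𝓘(ℝ, Euc m) M)) x :=
    fun v => mdifferentiableAt_coordField hψ hx mdifferentiableAt_const
  have ht := h.torsion_eq_zero x hxU (coordField ψ v) (coordField ψ w) (hc v) (hc w)
  rw [mlieBracket_coordField hψ hx, sub_eq_zero] at ht
  rw [key, key, ht]

/-- The flat connection serves to compare two charts over the domain of one of them. The comparison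
needs only the algebraic rules and the symmetry of the Christoffel symbols, so smoothness of this
connection is not established. -/
theorem isCovariantDerivativeOn_flatConnection
    (hψ : ψ ∈ IsManifold.maximalAtlas 𝓘(ℝ, Euc m) ∞ M) :
    IsCovariantDerivativeOn (Euc m) (flatConnection ψ) ψ.source where
  add {Y Y' x} hY hY' hx := by
    have h1 := (mdifferentiableAt_section_iff_chart hψ hx Y).1 hY
    have h2 := (mdifferentiableAt_section_iff_chart hψ hx Y').1 hY'
    have h3 : tmap (A := Euc m) (B := Euc m)
        (fun y => tmap (A := Euc m) (B := Euc m) ψ y ((Y + Y') y)) x =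
        tmap (A := Euc m) (B := Euc m) (fun y => tmap (A := Euc m) (B := Euc m) ψ y (Y y)) x +
        tmap (A := Euc m) (B := Euc m) (fun y => tmap (A := Euc m) (B := Euc m) ψ y (Y' y)) x := by
      have h4 := mfderiv_add h1 h2
      refine Eq.trans ?_ h4
      refine tmap_congr (Eventually.of_forall fun y => ?_)
      exact (tmap (A := Euc m) (B := Euc m) ψ y).map_add (Y y) (Y' y)
    unfold flatConnection
    rw [h3]
    exact ContinuousLinearMap.comp_add _ _ _
  leibniz {Y g x} hY hg hx := by
    have h1 := (mdifferentiableAt_section_iff_chart hψ hx Y).1 hY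
    have h3 : ∀ v : Euc m, tmap (A := Euc m) (B := Euc m)
        (fun y => tmap (A := Euc m) (B := Euc m) ψ y ((g • Y) y)) x v =
        g x • tmap (A := Euc m) (B := Euc m)
          (fun y => tmap (A := Euc m) (B := Euc m) ψ y (Y y)) x v +
        tmap (A := Euc m) (B := ℝ) g x v • tmap (A := Euc m) (B := Euc m) ψ x (Y x) := by
      intro v
      have h4 := DFunLike.congr_fun (mvfderiv_smul hg h1) v
      have h5 : tmap (A := Euc m) (B := Euc m)
        (fun y => tmap (A := Euc m) (B := Euc m) ψ y ((g • Y) y)) x = tmap (A := Euc m) (B := Euc m)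
        (g • fun y => tmap (A := Euc m) (B := Euc m) ψ y (Y y)) x :=
          tmap_congr (Eventually.of_forall fun y =>
            (tmap (A := Euc m) (B := Euc m) ψ y).map_smul (g y) (Y y))
      rw [h5]
      exact h4
    have h6 : ∀ (a b : ℝ) (u y : Euc m), tmap (A := Euc m) (B := Euc m) ψ.symm (ψ x)
        (a • u + b • tmap (A := Euc m) (B := Euc m) ψ x y) =
        a • tmap (A := Euc m) (B := Euc m) ψ.symm (ψ x) u + b • y := by
      intro a b u y
      rw [map_add, map_smul, map_smul]
      congr 2
      exact coordField_tmap hψ hx y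
    refine ContinuousLinearMap.ext fun v => ?_
    exact (congrArg (tmap (A := Euc m) (B := Euc m) ψ.symm (ψ x)) (h3 v)).trans (h6 _ _ _ _)

end Connections

/-! ### Volume forms and the 1-form d^{∇,η} f in a chart -/

section VolumeForms

variable {m : ℕ}

theorem detForm_update_stdVec (i : Fin m) (v : Euc m) :
    detForm m (Function.update (fun j => stdVec j) i v) = v i := by
  rw [detForm_apply]
  have h1 : (Matrix.of fun a j => Function.update (fun j => (stdVec j : Euc m)) i v a j) =
      Matrix.updateRow (1 : Matrix (Fin m) (Fin m) ℝ) i (fun j => v j) := by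
    ext a j
    rcases eq_or_ne a i with rfl | ha
    · simp
    · simp [Matrix.updateRow_ne ha, Function.update_of_ne ha, Matrix.one_apply,
        eq_comm]
  rw [h1]
  have h2 : (fun j => v j) = ∑ j, v j • (1 : Matrix (Fin m) (Fin m) ℝ) j := by
    ext a
    simp [Matrix.one_apply, Finset.sum_apply]
  have h3 := Matrix.det_updateRow_sum (1 : Matrix (Fin m) (Fin m) ℝ) i (fun j => v j)
  rw [h2, h3]
  simp

/-- The universal factor is read off from dᵐx on the standard basis. -/
theorem sum_map_update_eq_trace (L : Euc m →L[ℝ] Euc m) (μ : Euc m [⋀^Fin m]→L[ℝ] ℝ)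
    (v : Fin m → Euc m) :
    ∑ i, μ (Function.update v i (L (v i))) = (∑ i, L (stdVec i) i) * μ v := by
  obtain ⟨t, ht⟩ := exists_sum_map_update_eq L
  have h1 := ht (detForm m) (fun i => stdVec i)
  simp only [detForm_update_stdVec, detForm_stdVec, mul_one] at h1
  rw [ht, h1]

variable {M : Type*} [TopologicalSpace M] [ChartedSpace (Euc m) M]
  {ψ ψ' : OpenPartialHomeomorph M (Euc m)} {x : M}

/-- The expression of a volume form in a chart, at a point. -/
def VolumeForm.chartForm (η : VolumeForm m M) (ψ : OpenPartialHomeomorph M (Euc m)) (x : M) :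
    Euc m [⋀^Fin m]→L[ℝ] ℝ :=
  ContinuousAlternatingMap.compContinuousLinearMap (M := Euc m) (M' := Euc m) (η.toFun x)
    (tmap (A := Euc m) (B := Euc m) ψ.symm (ψ x))

theorem VolumeForm.chartForm_apply (η : VolumeForm m M) (v : Fin m → Euc m) :
    η.chartForm ψ x v = η.toFun x (fun i => coordField ψ (v i) x) := rfl

theorem VolumeForm.apply_eq_chartForm (η : VolumeForm m M)
    (hψ : ψ ∈ IsManifold.maximalAtlas 𝓘(ℝ, Euc m) ∞ M) (hx : x ∈ ψ.source) (v : Fin m → Euc m) :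
    η.toFun x v = η.chartForm ψ x (fun i => tmap (A := Euc m) (B := Euc m) ψ x (v i)) := by
  rw [VolumeForm.chartForm_apply]
  congr 1
  funext i
  exact (coordField_tmap hψ hx (v i)).symm

theorem VolumeForm.coordField_ne_zero (η : VolumeForm m M)
    (hψ : ψ ∈ IsManifold.maximalAtlas 𝓘(ℝ, Euc m) ∞ M) (hx : x ∈ ψ.source) :
    η.toFun x (fun i => coordField ψ (stdVec i) x) ≠ 0 := by
  intro h
  refine η.ne_zero x (ContinuousAlternatingMap.ext fun v => ?_)
  refine (η.apply_eq_chartForm hψ hx v).trans ?_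
  rw [map_eq_detForm, VolumeForm.chartForm_apply, h, mul_zero]
  rfl

variable {cov : (∀ x : M, TangentSpace 𝓘(ℝ, Euc m) x) →
      ∀ x : M, TangentSpace 𝓘(ℝ, Euc m) x →L[ℝ] TangentSpace 𝓘(ℝ, Euc m) x} {U : Set M}

theorem nablaSmul_apply (η : VolumeForm m M) (f : M → ℝ) (X : Euc m) :
    nablaSmul cov η f x X =
      tmap (A := Euc m) (B := ℝ)
        (fun y => f y * η.toFun y (fun i => coordField (chartAt (Euc m) x) (stdVec i) y)) x X -
      ∑ i : Fin m, f x * η.toFun x (Function.update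
        (fun j => coordField (chartAt (Euc m) x) (stdVec j) x) i
        (cov (coordField (chartAt (Euc m) x) (stdVec i)) x X)) := by
  have h1 : ∀ (L : Fin m → Euc m →L[ℝ] ℝ) (D : Euc m →L[ℝ] ℝ),
      (D - ∑ i, L i) X = D X - ∑ i, L i X := by
    intro L D
    simp
  exact h1 _ _

variable [IsManifold 𝓘(ℝ, Euc m) ∞ M]

/-- The definition of `dNabla` refers to the preferred chart at `x`; this gives the formula dG − G
tr Γ in any chart ψ, where G is the component of f η there. -/
theorem IsCovariantDerivativeOn.dNabla_apply (h : IsCovariantDerivativeOn (Euc m) cov U)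
    (hU : IsOpen U) (hxU : x ∈ U) (hψ : ψ ∈ IsManifold.maximalAtlas 𝓘(ℝ, Euc m) ∞ M)
    (hx : x ∈ ψ.source) (η : VolumeForm m M) {f G : M → ℝ}
    (hG : MDifferentiableAt 𝓘(ℝ, Euc m) 𝓘(ℝ, ℝ) G x)
    (hfG : ∀ᶠ y in 𝓝 x, f y * η.toFun y (fun i => coordField ψ (stdVec i) y) = G y) (X : Euc m) :
    dNabla cov η f x X * η.toFun x (fun i => coordField ψ (stdVec i) x) =
      tmap (A := Euc m) (B := ℝ) G x X -
        G x * ∑ i, christoffel cov ψ x (tmap (A := Euc m) (B := Euc m) ψ x X) (stdVec i) i := by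
  set ψ' := chartAt (Euc m) x with hψ'def
  have hψ' : ψ' ∈ IsManifold.maximalAtlas 𝓘(ℝ, Euc m) ∞ M := IsManifold.chart_mem_maximalAtlas x
  have hx' : x ∈ ψ'.source := mem_chart_source _ x
  -- Components in ψ of the preferred coordinate fields; `H` below is the Jacobian determinant
  -- relating the two frames.
  let g : Fin m → M → Euc m := fun i y => fderiv ℝ (ψ ∘ ψ'.symm) (ψ' y) (stdVec i)
  have hg : ∀ i, MDifferentiableAt 𝓘(ℝ, Euc m) 𝓘(ℝ, Euc m) (g i) x := fun i =>
    (mdifferentiableAt_clm_chart_change hψ' hψ hx' hx).clm_apply mdifferentiableAt_const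
  have hDg : ∀ᶠ y in 𝓝 x, ∀ i, coordField ψ' (stdVec i) y = coordField ψ (g i y) y := by
    filter_upwards [ψ.open_source.mem_nhds hx, ψ'.open_source.mem_nhds hx'] with y hy hy' i
    exact coordField_change hψ hψ' hy hy' _
  let H : M → ℝ := fun y => detForm m (fun i => g i y)
  have hη : ∀ y, (∀ i, coordField ψ' (stdVec i) y = coordField ψ (g i y) y) →
      η.toFun y (fun i => coordField ψ' (stdVec i) y) =
        H y * η.toFun y (fun i => coordField ψ (stdVec i) y) := by
    intro y hy
    simp only [hy]
    exact map_eq_detForm (η.chartForm ψ y) (fun i => g i y)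
  have hHd : HasFDerivAt (detForm m) ((detForm m).toContinuousMultilinearMap.linearDeriv
      (fun i => g i x)) (fun i => g i x) := (detForm m).toContinuousMultilinearMap.hasFDerivAt _
  have hgp : MDifferentiableAt 𝓘(ℝ, Euc m) 𝓘(ℝ, Fin m → Euc m) (fun y i => g i y) x :=
    (ContinuousLinearMap.pi fun i => ContinuousLinearMap.apply ℝ (Euc m)
      (stdVec i : Euc m)).differentiableAt.mdifferentiableAt.comp x
        (mdifferentiableAt_clm_chart_change hψ' hψ hx' hx)
  have hgi : ∀ i, tmap (A := Euc m) (B := Euc m) (g i) x X =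
      tmap (A := Euc m) (B := Fin m → Euc m) (fun y i => g i y) x X i := by
    intro i
    have h1 := tmap_comp (g := (ContinuousLinearMap.proj i : (Fin m → Euc m) →L[ℝ] Euc m))
      (ContinuousLinearMap.proj i :
        (Fin m → Euc m) →L[ℝ] Euc m).differentiableAt.mdifferentiableAt hgp
    rw [tmap_eq_fderiv, ContinuousLinearMap.fderiv] at h1
    exact DFunLike.congr_fun h1 X
  have hH : MDifferentiableAt 𝓘(ℝ, Euc m) 𝓘(ℝ, ℝ) H x :=
    hHd.differentiableAt.mdifferentiableAt.comp x hgp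
  have hHX : tmap (A := Euc m) (B := ℝ) H x X =
      ∑ i, detForm m (Function.update (fun j => g j x) i
        (tmap (A := Euc m) (B := Euc m) (g i) x X)) := by
    have h1 := tmap_comp (f := fun y i => g i y) hHd.differentiableAt.mdifferentiableAt hgp
    rw [tmap_eq_fderiv, hHd.fderiv] at h1
    refine (DFunLike.congr_fun h1 X).trans ?_
    simp only [hgi]
    exact ContinuousMultilinearMap.linearDeriv_apply _ _ _
  have hx0 := hDg.self_of_nhds
  have hGx := hfG.self_of_nhds
  set hc := η.toFun x (fun i => coordField ψ (stdVec i) x) with hcdef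
  have hc0 : hc ≠ 0 := η.coordField_ne_zero hψ hx
  have hH0 : H x ≠ 0 := by
    have := η.coordField_ne_zero hψ' hx'
    rw [hη x hx0] at this
    exact left_ne_zero_of_mul this
  have h1 : tmap (A := Euc m) (B := ℝ)
      (fun y => f y * η.toFun y (fun i => coordField ψ' (stdVec i) y)) x X =
      G x * tmap (A := Euc m) (B := ℝ) H x X + H x * tmap (A := Euc m) (B := ℝ) G x X := by
    have h2 : tmap (A := Euc m) (B := ℝ)
      (fun y => f y * η.toFun y (fun i => coordField ψ' (stdVec i) y)) x =
      tmap (A := Euc m) (B := ℝ) (G * H) x := by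
      refine tmap_congr ?_
      filter_upwards [hDg, hfG] with y hy hy'
      rw [hη y hy, Pi.mul_apply, ← hy']
      ring
    rw [h2]
    exact DFunLike.congr_fun (mvfderiv_mul hG hH) X
  have hcov : ∀ i, η.toFun x (Function.update (fun j => coordField ψ' (stdVec j) x) i
        (cov (coordField ψ' (stdVec i)) x X)) =
      hc * detForm m (Function.update (fun j => g j x) i
        (tmap (A := Euc m) (B := Euc m) (g i) x X)) +
      hc * detForm m (Function.update (fun j => g j x) i
        (christoffel cov ψ x (tmap (A := Euc m) (B := Euc m) ψ x X) (g i x))) := by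
    intro i
    have h2 := h.chart_apply hU hxU hψ hx (hg i) (hDg.mono fun y hy => hy i) X
    rw [← mul_add, ← (detForm m).map_update_add, ← h2, mul_comm hc]
    refine Eq.trans ?_ (map_eq_detForm (η.chartForm ψ x) _)
    refine (η.apply_eq_chartForm hψ hx _).trans ?_
    congr 1
    funext j
    rcases eq_or_ne j i with rfl | hj
    · simp
    · rw [Function.update_of_ne hj, Function.update_of_ne hj, hx0]
      exact tmap_coordField hψ hx _
  have h3 : dNabla cov η f x X = (H x * hc)⁻¹ * (nablaSmul cov η f x X) := by
    rw [← hη x hx0]; rfl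
  -- The term G dH of the product rule cancels against the derivatives of the components in the
  -- covariant derivatives of the frame. Only the trace of Γ is left.
  rw [h3, nablaSmul_apply, ← hψ'def, h1, hHX]
  simp only [hcov, mul_add, Finset.sum_add_distrib, ← Finset.mul_sum]
  rw [sum_map_update_eq_trace, ← hGx]
  rw [show detForm m (fun j => g j x) = H x from rfl]
  field_simp
  ring

end VolumeForms

theorem HasDerivAt.fst_apply {A B : Type*} [NormedAddCommGroup A] [NormedSpace ℝ A]
    [NormedAddCommGroup B] [NormedSpace ℝ B] {f : ℝ → A × B} {f' : A × B} {t : ℝ}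
    (h : HasDerivAt f f' t) : HasDerivAt (fun s => (f s).1) f'.1 t :=
  (ContinuousLinearMap.fst ℝ A B).hasFDerivAt.comp_hasDerivAt t h

theorem HasDerivAt.snd_apply {A B : Type*} [NormedAddCommGroup A] [NormedSpace ℝ A]
    [NormedAddCommGroup B] [NormedSpace ℝ B] {f : ℝ → A × B} {f' : A × B} {t : ℝ}
    (h : HasDerivAt f f' t) : HasDerivAt (fun s => (f s).2) f'.2 t :=
  (ContinuousLinearMap.snd ℝ A B).hasFDerivAt.comp_hasDerivAt t h

/-! ### Coordinate changes of iterated jets and the exchange map -/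

section IteratedJets

variable {V M : Type*} [NormedAddCommGroup V] [NormedSpace ℝ V] [TopologicalSpace M]
  [ChartedSpace V M]
variable {F P : Type*} [NormedAddCommGroup F] [NormedSpace ℝ F] [TopologicalSpace P]
  [ChartedSpace (V × F) P] {ρ : P → M}

/-- Reason: a jet is a right inverse of the projection, in either chart. -/
theorem Jet1.prod_coord_change (c c' : FiberedChart V F ρ) (p : P) (hp : p ∈ c.κ.source)
    (hp' : p ∈ c'.κ.source) (a : V →L[ℝ] F) (v : V) :
    (fderiv ℝ (c'.κ ∘ c.κ.symm) (c.κ p) (fderiv ℝ (c.ψ ∘ c'.ψ.symm) (c'.κ p).1 v,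
      a (fderiv ℝ (c.ψ ∘ c'.ψ.symm) (c'.κ p).1 v))).1 = v := by
  have h1 := Jet1.prod_coord c' (Jet1.ofCoord c p hp a) hp'
  have h2 := congrArg Prod.fst (DFunLike.congr_fun h1 v)
  rw [← tmap_comp_tmap_symm c.mem_κ c'.mem_κ hp hp', c'.fst_κ p hp',
    ← tmap_comp_tmap_symm c'.mem_ψ c.mem_ψ (c'.mapsTo p hp') (c.mapsTo p hp)]
  exact h2.symm

variable [IsManifold 𝓘(ℝ, V × F) ∞ P] [IsFibration V F ρ]

/-- The change of the coordinates of iterated jets. -/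
theorem Jet1.iterated_coord_change (c c' : FiberedChart V F ρ)
    (y : Jet1 V (F × (V →L[ℝ] F)) (Jet1.proj ρ : Jet1 V F ρ → M))
    (hp : y.pt.pt ∈ c.κ.source) (hp' : y.pt.pt ∈ c'.κ.source) (v' : V) {v : V}
    (hv : fderiv ℝ (c.ψ ∘ c'.ψ.symm) (c'.ψ (ρ y.pt.pt)) v' = v) :
    (y.coord c'.jet v').1 =
      (fderiv ℝ (c'.κ ∘ c.κ.symm) (c.κ y.pt.pt) (v, (y.coord c.jet v).1)).2 ∧
    ∀ (w' w : V), fderiv ℝ (c.ψ ∘ c'.ψ.symm) (c'.ψ (ρ y.pt.pt)) w' = w →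
      (y.coord c'.jet v').2 w' =
        (fderiv ℝ (fderiv ℝ (c'.κ ∘ c.κ.symm)) (c.κ y.pt.pt) (v, (y.coord c.jet v).1)
          (w, y.pt.coord c w)).2 +
        (fderiv ℝ (c'.κ ∘ c.κ.symm) (c.κ y.pt.pt)
          (fderiv ℝ (fderiv ℝ (c.ψ ∘ c'.ψ.symm)) (c'.ψ (ρ y.pt.pt)) v' w',
            (y.coord c.jet v).2 w + y.pt.coord c
              (fderiv ℝ (fderiv ℝ (c.ψ ∘ c'.ψ.symm)) (c'.ψ (ρ y.pt.pt)) v' w'))).2 := by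
  set Φ := c'.κ ∘ c.κ.symm with hΦ
  set χ := c.ψ ∘ c'.ψ.symm with hχ
  set p := y.pt.pt with hpdef
  have hx' : c'.ψ (ρ p) = (c'.κ p).1 := (c'.fst_κ p hp').symm
  have hΦp : Φ (c.κ p) = c'.κ p := by simp only [hΦ, Function.comp, c.κ.left_inv hp]
  have h0 := Jet1.coord_change c.jet c'.jet y hp hp'
  set J := c'.jet.κ ∘ c.jet.κ.symm with hJ
  -- `ξ` is the lift of `v` by `y`. The new coordinates of `y` are the vertical part of the
  -- derivative of the jet transition map `J` along the straight line in the direction `ξ`.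
  set ξ : V × (F × (V →L[ℝ] F)) := (v, y.coord c.jet v) with hξ
  have hb : y.coord c'.jet v' = (fderiv ℝ J (c.jet.κ y.pt) ξ).2 := by
    rw [h0]
    have h1 : (c'.jet.κ y.pt).1 = c'.ψ (ρ p) := hx'.symm
    simp only [ContinuousLinearMap.comp_apply, h1, FiberedChart.jet_ψ, ContinuousLinearMap.prod_apply,
      ContinuousLinearMap.id_apply]
    rw [← hχ, hv]
    rfl
  have hline : HasDerivAt (fun t : ℝ => J (c.jet.κ y.pt + t • ξ)) (fderiv ℝ J (c.jet.κ y.pt) ξ)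
      0 := by
    have hJd : DifferentiableAt ℝ J (c.jet.κ y.pt + (0 : ℝ) • ξ) := by
      rw [zero_smul, add_zero]
      exact (change_contDiffAt c.jet.mem_κ c'.jet.mem_κ hp hp').differentiableAt (by simp)
    have h1 : HasDerivAt (fun t : ℝ => c.jet.κ y.pt + t • ξ) ξ 0 := by
      simpa using ((hasDerivAt_id (0 : ℝ)).smul_const ξ).const_add (c.jet.κ y.pt)
    have h2 := hJd.hasFDerivAt.comp_hasDerivAt (0 : ℝ) h1
    rwa [zero_smul, add_zero] at h2
  let γ : ℝ → V × F := fun t => c.κ p + t • (v, (y.coord c.jet v).1)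
  have hγ : HasDerivAt γ (v, (y.coord c.jet v).1) 0 := by
    have h1 := ((hasDerivAt_id (0 : ℝ)).smul_const (v, (y.coord c.jet v).1)).const_add (c.κ p)
    rwa [one_smul] at h1
  have hγ0 : γ 0 = c.κ p := by simp [γ]
  have hΦγ : HasDerivAt (fun t => Φ (γ t)) (fderiv ℝ Φ (c.κ p) (v, (y.coord c.jet v).1)) 0 := by
    have h1 : DifferentiableAt ℝ Φ (γ 0) := by
      rw [hγ0]; exact (change_contDiffAt c.mem_κ c'.mem_κ hp hp').differentiableAt (by simp)
    have h2 := h1.hasFDerivAt.comp_hasDerivAt (0 : ℝ) hγ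
    rwa [hγ0] at h2
  have hDΦγ : HasDerivAt (fun t => fderiv ℝ Φ (γ t))
      (fderiv ℝ (fderiv ℝ Φ) (c.κ p) (v, (y.coord c.jet v).1)) 0 := by
    have h1 : DifferentiableAt ℝ (fderiv ℝ Φ) (γ 0) := by
      rw [hγ0]; exact fderiv_change_differentiableAt c.mem_κ c'.mem_κ hp hp'
    have h2 := h1.hasFDerivAt.comp_hasDerivAt (0 : ℝ) hγ
    rwa [hγ0] at h2
  have hfst : (fderiv ℝ Φ (c.κ p) (v, (y.coord c.jet v).1)).1 = v' := by
    have h1 := Jet1.prod_coord_change c c' p hp hp'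
      ((ContinuousLinearMap.fst ℝ F (V →L[ℝ] F)).comp (y.coord c.jet)) v'
    rw [← hx', ← hχ, hv] at h1
    exact h1
  -- On that line `J` is given by the first-order rule a ↦ DΦ ∘ (id, a) ∘ Dχ over the projected line
  -- `γ`. Its product rule at t = 0 yields the two second-derivative terms.
  have hloc : ∀ᶠ t : ℝ in 𝓝 0, J (c.jet.κ y.pt + t • ξ) = ((Φ (γ t)).1, (Φ (γ t)).2,
      (ContinuousLinearMap.snd ℝ V F).comp ((fderiv ℝ Φ (γ t)).comp
        (((ContinuousLinearMap.id ℝ V).prod (y.pt.coord c + t • (y.coord c.jet v).2)).comp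
          (fderiv ℝ χ (Φ (γ t)).1)))) := by
    have h1 : ∀ᶠ t in 𝓝 (0 : ℝ), γ t ∈ (c.κ.symm.trans c'.κ).source := by
      refine hγ.continuousAt.eventually ((c.κ.symm.trans c'.κ).open_source.mem_nhds ?_)
      rw [hγ0]
      exact ⟨c.κ.map_source hp, by simpa [c.κ.left_inv hp] using hp'⟩
    filter_upwards [h1] with t ht
    have ht1 : γ t ∈ c.κ.target := ht.1
    have ht2 : c.κ.symm (γ t) ∈ c'.κ.source := ht.2
    have h2 : c.jet.κ.symm (c.jet.κ y.pt + t • ξ) = Jet1.ofCoord c (c.κ.symm (γ t))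
        (c.κ.map_target ht1) (y.pt.coord c + t • (y.coord c.jet v).2) :=
      Jet1.jetEquiv_symm c (c.jet.κ y.pt + t • ξ) ht1
    simp only [hJ, Function.comp]
    rw [h2, FiberedChart.jet_apply, Jet1.coord_ofCoord' c c' _ _ ht2, c.κ.right_inv ht1]
    rfl
  have hline' := hline.congr_of_eventuallyEq (hloc.mono fun t ht => ht.symm)
  constructor
  · rw [hb]
    exact hline'.snd_apply.fst_apply.unique hΦγ.snd_apply
  · intro w' w hw
    rw [hb]
    have hχγ : HasDerivAt (fun t => fderiv ℝ χ (Φ (γ t)).1 w')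
        (fderiv ℝ (fderiv ℝ χ) (c'.ψ (ρ p)) v' w') 0 := by
      have h1 : DifferentiableAt ℝ (fderiv ℝ χ) (Φ (γ 0)).1 := by
        rw [hγ0, hΦp, ← hx']
        exact fderiv_change_differentiableAt c'.mem_ψ c.mem_ψ (c'.mapsTo _ hp') (c.mapsTo _ hp)
      have h2 := h1.hasFDerivAt.comp_hasDerivAt (0 : ℝ) hΦγ.fst_apply
      rw [hγ0, hΦp, ← hx', hfst] at h2
      simpa using h2.clm_apply (hasDerivAt_const (0 : ℝ) w')
    have ha : HasDerivAt (fun t : ℝ => y.pt.coord c + t • (y.coord c.jet v).2)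
        (y.coord c.jet v).2 0 := by
      simpa using ((hasDerivAt_id (0 : ℝ)).smul_const (y.coord c.jet v).2).const_add (y.pt.coord c)
    have h3 := (hDΦγ.clm_apply (hχγ.prodMk (ha.clm_apply hχγ))).snd_apply
    have h4 := hline'.snd_apply.snd_apply.clm_apply (hasDerivAt_const (0 : ℝ) w')
    have h5 := h4.unique h3
    rw [map_zero, add_zero] at h5
    refine h5.trans ?_
    rw [hγ0, hΦp, ← hx', hw]
    simp

/-- The map given by the coordinate expression of the exchange map in a fibred chart. -/
def exchangeIn (c : FiberedChart V F ρ) (Γ : V →L[ℝ] V →L[ℝ] V)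
    (y : Jet1 V (F × (V →L[ℝ] F)) (Jet1.proj ρ : Jet1 V F ρ → M)) :
    Jet1 V (F × (V →L[ℝ] F)) (Jet1.proj ρ : Jet1 V F ρ → M) :=
  c.jet.jet.κ.symm (exchangeCoord Γ (c.jet.jet.κ y))

variable (c : FiberedChart V F ρ) (Γ : V →L[ℝ] V →L[ℝ] V)
  (y : Jet1 V (F × (V →L[ℝ] F)) (Jet1.proj ρ : Jet1 V F ρ → M))

theorem exchangeCoord_mem_target (hp : y.pt.pt ∈ c.κ.source) :
    exchangeCoord Γ (c.jet.jet.κ y) ∈ c.jet.jet.κ.target :=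
  c.κ.map_source hp

theorem chart_exchangeIn (hp : y.pt.pt ∈ c.κ.source) :
    c.jet.jet.κ (exchangeIn c Γ y) = exchangeCoord Γ (c.jet.jet.κ y) :=
  c.jet.jet.κ.right_inv (exchangeCoord_mem_target c Γ y hp)

theorem exchangeIn_pt_pt_mem (hp : y.pt.pt ∈ c.κ.source) :
    (exchangeIn c Γ y).pt.pt ∈ c.κ.source :=
  c.jet.jet.κ.map_target (exchangeCoord_mem_target c Γ y hp)

theorem exchangeIn_pt_pt (hp : y.pt.pt ∈ c.κ.source) : (exchangeIn c Γ y).pt.pt = y.pt.pt := by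
  refine c.κ.injOn (exchangeIn_pt_pt_mem c Γ y hp) hp ?_
  have h := chart_exchangeIn c Γ y hp
  have h1 := congrArg Prod.fst h
  have h2 := congrArg (fun q => q.2.1.1) h
  exact Prod.ext h1 h2

theorem exchangeIn_pt_coord (hp : y.pt.pt ∈ c.κ.source) (v : V) :
    (exchangeIn c Γ y).pt.coord c v = (y.coord c.jet v).1 :=
  congrArg (fun q => q.2.1.2 v) (chart_exchangeIn c Γ y hp)

theorem exchangeIn_coord_fst (hp : y.pt.pt ∈ c.κ.source) (v : V) :
    ((exchangeIn c Γ y).coord c.jet v).1 = y.pt.coord c v :=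
  congrArg (fun q => (q.2.2 v).1) (chart_exchangeIn c Γ y hp)

theorem exchangeIn_coord_snd (hp : y.pt.pt ∈ c.κ.source) (v w : V) :
    ((exchangeIn c Γ y).coord c.jet v).2 w = (y.coord c.jet w).2 v +
      ((y.coord c.jet (Γ v w)).1 - y.pt.coord c (Γ v w)) :=
  congrArg (fun q => (q.2.2 v).2 w) (chart_exchangeIn c Γ y hp)

/-- D²Φ is symmetric and so survives the exchange. The term a(D²χ) becomes ā(D²χ), with a = (uᵢ) and
ā = (ūᵢ), and the defect (ā − a)(D²χ) is supplied by the inhomogeneous part of the law relating Γ'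
to Γ. Only this law matters, not the symmetry of Γ. -/
theorem exchangeIn_eq (c c' : FiberedChart V F ρ) {Γ Γ' : V →L[ℝ] V →L[ℝ] V}
    (hp : y.pt.pt ∈ c.κ.source) (hp' : y.pt.pt ∈ c'.κ.source)
    (hΓ : ∀ v w, fderiv ℝ (c.ψ ∘ c'.ψ.symm) (c'.ψ (ρ y.pt.pt)) (Γ' v w) =
        fderiv ℝ (fderiv ℝ (c.ψ ∘ c'.ψ.symm)) (c'.ψ (ρ y.pt.pt)) v w +
          Γ (fderiv ℝ (c.ψ ∘ c'.ψ.symm) (c'.ψ (ρ y.pt.pt)) v)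
            (fderiv ℝ (c.ψ ∘ c'.ψ.symm) (c'.ψ (ρ y.pt.pt)) w)) :
    exchangeIn c Γ y = exchangeIn c' Γ' y := by
  have hpt := exchangeIn_pt_pt c Γ y hp
  have hpt' := exchangeIn_pt_pt c' Γ' y hp'
  have hs' : (exchangeIn c Γ y).pt.pt ∈ c'.κ.source := hpt ▸ hp'
  have hs : (exchangeIn c Γ y).pt.pt ∈ c.κ.source := hpt ▸ hp
  have hχs : IsSymmSndFDerivAt ℝ (c.ψ ∘ c'.ψ.symm) (c'.ψ (ρ y.pt.pt)) :=
    change_isSymmSndFDerivAt c'.mem_ψ c.mem_ψ (c'.mapsTo _ hp') (c.mapsTo _ hp)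
  have hΦs : IsSymmSndFDerivAt ℝ (c'.κ ∘ c.κ.symm) (c.κ y.pt.pt) :=
    change_isSymmSndFDerivAt c.mem_κ c'.mem_κ hp hp'
  have hcoordpt : (exchangeIn c Γ y).pt.coord c' = (exchangeIn c' Γ' y).pt.coord c' := by
    ext v'
    rw [exchangeIn_pt_coord c' Γ' y hp', (Jet1.iterated_coord_change c c' y hp hp' v' rfl).1,
      Jet1.coord_change c c' _ hs hs', hpt, c'.fst_κ _ hp']
    simp only [ContinuousLinearMap.comp_apply, ContinuousLinearMap.prod_apply,
      ContinuousLinearMap.id_apply, exchangeIn_pt_coord c Γ y hp]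
    rfl
  have hptj : (exchangeIn c Γ y).pt = (exchangeIn c' Γ' y).pt :=
    Jet1.eq_of_coord_eq c' hs' (hpt.trans hpt'.symm) hcoordpt
  refine Jet1.eq_of_coord_eq c'.jet hs' hptj ?_
  have hcoordy : ∀ u : V, y.pt.coord c' u = (fderiv ℝ (c'.κ ∘ c.κ.symm) (c.κ y.pt.pt)
      (fderiv ℝ (c.ψ ∘ c'.ψ.symm) (c'.ψ (ρ y.pt.pt)) u,
        y.pt.coord c (fderiv ℝ (c.ψ ∘ c'.ψ.symm) (c'.ψ (ρ y.pt.pt)) u))).2 := by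
    intro u
    rw [Jet1.coord_change c c' _ hp hp', c'.fst_κ _ hp']
    rfl
  have hχv : ∀ u, fderiv ℝ (c.ψ ∘ c'.ψ.symm) (c'.ψ (ρ (exchangeIn c Γ y).pt.pt)) u =
      fderiv ℝ (c.ψ ∘ c'.ψ.symm) (c'.ψ (ρ y.pt.pt)) u := fun u => by rw [hpt]
  refine ContinuousLinearMap.ext fun v' => Prod.ext ?_ (ContinuousLinearMap.ext fun w' => ?_)
  · rw [exchangeIn_coord_fst c' Γ' y hp',
      (Jet1.iterated_coord_change c c' (exchangeIn c Γ y) hs hs' v' (hχv v')).1, hcoordy, hpt,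
      exchangeIn_coord_fst c Γ y hp]
  · rw [exchangeIn_coord_snd c' Γ' y hp',
      (Jet1.iterated_coord_change c c' (exchangeIn c Γ y) hs hs' v' (hχv v')).2 w' _ (hχv w'),
      (Jet1.iterated_coord_change c c' y hp hp' w' rfl).2 v' _ rfl, hcoordy,
      (Jet1.iterated_coord_change c c' y hp hp' (Γ' v' w') rfl).1, hpt,
      exchangeIn_coord_fst c Γ y hp, exchangeIn_coord_snd c Γ y hp,
      exchangeIn_pt_coord c Γ y hp, exchangeIn_pt_coord c Γ y hp, hΓ, hχs w' v',
      hΦs (_, _) (_, y.pt.coord c _)]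
    -- Apart from the D²Φ term, all terms are values of the single linear map DΦ, so it is enough to
    -- compare their arguments.
    have key : ∀ (L : V × F →L[ℝ] V × F) (f : F) (S T R₁ R₂ : V × F), S = T + (R₁ - R₂) →
        f + (L S).2 = f + (L T).2 + ((L R₁).2 - (L R₂).2) := by
      rintro L f _ T R₁ R₂ rfl
      simp only [map_add, map_sub, Prod.snd_add, Prod.snd_sub]
      abel
    refine key _ _ _ _ _ _ (Prod.ext ?_ ?_)
    · simp
    · simp only [Prod.snd_add, Prod.snd_sub, map_add, Prod.fst_add]
      abel

end IteratedJets

section Connection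

variable {m : ℕ} {M : Type*} [TopologicalSpace M] [ChartedSpace (Euc m) M]
  [IsManifold 𝓘(ℝ, Euc m) ∞ M]
variable {F E : Type*} [NormedAddCommGroup F] [NormedSpace ℝ F] [TopologicalSpace E]
  [ChartedSpace (Euc m × F) E] [IsManifold 𝓘(ℝ, Euc m × F) ∞ E] {π : E → M}
  [IsFibration (Euc m) F π]

/-- The coordinate expression of the exchange map holds in all fibred charts. -/
theorem IsCovariantDerivativeOn.exchange_eq
    {cov : (∀ x : M, TangentSpace 𝓘(ℝ, Euc m) x) →
      ∀ x : M, TangentSpace 𝓘(ℝ, Euc m) x →L[ℝ] TangentSpace 𝓘(ℝ, Euc m) x}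
    {U : Set M} (h : IsCovariantDerivativeOn (Euc m) cov U) (hU : IsOpen U)
    (c : FiberedChart (Euc m) F π) (y : IteratedJetSpace m F π) (hp : y.pt.pt ∈ c.κ.source)
    (hyU : π y.pt.pt ∈ U) :
    exchange cov y = exchangeIn c (christoffel cov c.ψ (π y.pt.pt)) y := by
  have hp' := mem_fiberedChartAt (V := Euc m) (F := F) (π := π) y.pt.pt
  exact exchangeIn_eq y _ c hp' hp fun v w =>
    h.christoffel_change hU hyU (fiberedChartAt (Euc m) F π y.pt.pt).mem_ψ c.mem_ψ
      ((fiberedChartAt (Euc m) F π y.pt.pt).mapsTo _ hp') (c.mapsTo _ hp) v w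

end Connection

/-! ### The tensor T in coordinates -/

section Model

variable {m : ℕ} {F : Type*} [NormedAddCommGroup F] [NormedSpace ℝ F]

theorem euc_sum_smul_stdVec (x : Euc m) : ∑ j, x j • (stdVec j : Euc m) = x := by
  ext k
  simp [Finset.sum_apply, Pi.single_apply]

/-- The value at `v` of the tensor `T`, where `α` and `r` are the coordinates `(p, pⁱ)` and
`(pⱼ, pⁱⱼ)` of a jet of momenta, `a` is the matrix `uᵢ` and `Γ` are the Christoffel symbols. -/
def tulczyjewForm (α : ModelForms (Euc m) F m 2) (r : Euc m →L[ℝ] ModelForms (Euc m) F m 2)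
    (a : Euc m →L[ℝ] F) (Γ : Euc m →L[ℝ] Euc m →L[ℝ] Euc m) (v : Euc m) :
    ModelForms (Euc m) (F × (Euc m →L[ℝ] F)) m 2 :=
  mkForm ((r v : (Euc m × F) [⋀^Fin m]→L[ℝ] ℝ) (fun i => (stdVec i, 0)) -
      ∑ i, momentum α i (a (Γ v (stdVec i))) -
      (α : (Euc m × F) [⋀^Fin m]→L[ℝ] ℝ) (fun i => (stdVec i, 0)) * ∑ i, Γ v (stdVec i) i)
    fun j => (momentum (r v) j + ∑ i, Γ v (stdVec i) j • momentum α i -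
        (∑ i, Γ v (stdVec i) i) • momentum α j).comp (ContinuousLinearMap.fst ℝ F (Euc m →L[ℝ] F)) +
      (momentum α j).comp ((ContinuousLinearMap.apply ℝ F v).comp
        (ContinuousLinearMap.snd ℝ F (Euc m →L[ℝ] F)))

variable (α : ModelForms (Euc m) F m 2) (r : Euc m →L[ℝ] ModelForms (Euc m) F m 2)
    (a : Euc m →L[ℝ] F) (Γ : Euc m →L[ℝ] Euc m →L[ℝ] Euc m)

/-- The right-hand side is dG − G tr Γ in the direction `v`, evaluated on ex_∇(y) for the iterated
jet y with coordinates `b`. It dictates the coefficients in `tulczyjewForm`. -/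
theorem tulczyjewForm_graph (v : Euc m) (b : Euc m →L[ℝ] F × (Euc m →L[ℝ] F)) :
    (tulczyjewForm α r a Γ v : (Euc m × (F × (Euc m →L[ℝ] F))) [⋀^Fin m]→L[ℝ] ℝ)
        (fun i => (stdVec i, b (stdVec i))) =
      (r v : (Euc m × F) [⋀^Fin m]→L[ℝ] ℝ) (fun i => (stdVec i, (b (stdVec i)).1)) +
      ∑ i, momentum α i ((b (stdVec i)).2 v +
        ((b (Γ v (stdVec i))).1 - a (Γ v (stdVec i)))) -
      (α : (Euc m × F) [⋀^Fin m]→L[ℝ] ℝ) (fun i => (stdVec i, (b (stdVec i)).1)) *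
        ∑ i, Γ v (stdVec i) i := by
  -- Expanding Γ(v, eᵢ) in the basis moves the term pⁱ ū(Γ(v, eᵢ)) into the du part of the momenta.
  have h1 : ∑ j, ∑ i, Γ v (stdVec i) j * momentum α i (b (stdVec j)).1 =
      ∑ i, momentum α i (b (Γ v (stdVec i))).1 := by
    rw [Finset.sum_comm]
    refine Finset.sum_congr rfl fun i _ => ?_
    conv_rhs => rw [← euc_sum_smul_stdVec (Γ v (stdVec i))]
    simp [Prod.fst_sum]
  rw [tulczyjewForm, mkForm_graph, modelForms_apply_graph (r v) (fun i => (b (stdVec i)).1),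
    modelForms_apply_graph α (fun i => (b (stdVec i)).1)]
  simp only [add_apply, sub_apply,
    ContinuousLinearMap.comp_apply, sum_apply, smul_apply,
    ContinuousLinearMap.coe_fst', ContinuousLinearMap.coe_snd', ContinuousLinearMap.apply_apply,
    smul_eq_mul, Finset.sum_add_distrib, Finset.sum_sub_distrib, map_add, map_sub, h1,
    ← Finset.mul_sum]
  ring

/-- The tensor `T` in coordinates. -/
def tulczyjewTensorModel :
    Euc m →L[ℝ] (Euc m × (F × (Euc m →L[ℝ] F))) [⋀^Fin m]→L[ℝ] ℝ :=
  LinearMap.toContinuousLinearMap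
    { toFun := fun v => tulczyjewForm α r a Γ v
      -- Linearity in `v` is checked on graphs, where the value is visibly linear.
      map_add' := fun v v' => eq_of_graph fun b => by
        rw [ContinuousAlternatingMap.add_apply]
        simp only [tulczyjewForm_graph, map_add, add_apply,
          Submodule.coe_add, ContinuousAlternatingMap.add_apply, PiLp.add_apply,
          Finset.sum_add_distrib, map_sub, Prod.fst_add, Finset.sum_sub_distrib]
        ring
      map_smul' := fun t v => eq_of_graph fun b => by
        rw [ContinuousAlternatingMap.smul_apply]
        simp only [tulczyjewForm_graph, map_smul, smul_apply,
          Submodule.coe_smul, ContinuousAlternatingMap.smul_apply, PiLp.smul_apply, map_add,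
          map_sub, Finset.sum_add_distrib, Finset.sum_sub_distrib, Prod.smul_fst, smul_eq_mul,
          ← Finset.mul_sum, RingHom.id_apply]
        ring }

/-- The linear form `pⁱᵢ du + pⁱ duᵢ`. -/
def tulczyjewCoeff : F × (Euc m →L[ℝ] F) →L[ℝ] ℝ :=
  ∑ k, ((momentum (r (stdVec k)) k).comp (ContinuousLinearMap.fst ℝ F (Euc m →L[ℝ] F)) +
    (momentum α k).comp ((ContinuousLinearMap.apply ℝ F (stdVec k : Euc m)).comp
      (ContinuousLinearMap.snd ℝ F (Euc m →L[ℝ] F))))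

theorem tulczyjewCoeff_apply (w : F × (Euc m →L[ℝ] F)) :
    tulczyjewCoeff α r w = ∑ k, (momentum (r (stdVec k)) k w.1 + momentum α k (w.2 (stdVec k))) := by
  simp [tulczyjewCoeff]

/-- Here torsion-freeness enters: contraction leaves Γᵏₖᵢ pⁱ from the exchange map and −Γⁱₖᵢ pᵏ from
∇η, and these cancel when Γ is symmetric. -/
theorem neg_alternatize_tulczyjewTensorModel (hΓ : ∀ v w, Γ v w = Γ w v) :
    -ContinuousAlternatingMap.alternatizeUncurryFin ((tulczyjewTensorModel α r a Γ).comp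
      (ContinuousLinearMap.fst ℝ (Euc m) (F × (Euc m →L[ℝ] F)))) =
      (wedgeVolume (m := m) (tulczyjewCoeff α r) :
        (Euc m × (F × (Euc m →L[ℝ] F))) [⋀^Fin (m + 1)]→L[ℝ] ℝ) := by
  refine neg_alternatize_eq _ (fun x => (tulczyjewForm α r a Γ x).2) _ fun w => ?_
  have h1 : ∀ k : Fin m, momentum (⟨tulczyjewTensorModel α r a Γ (stdVec k),
      (tulczyjewForm α r a Γ (stdVec k)).2⟩ : ModelForms (Euc m) (F × (Euc m →L[ℝ] F)) m 2) k w =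
      momentum (r (stdVec k)) k w.1 + momentum α k (w.2 (stdVec k)) +
        (∑ i, Γ (stdVec k) (stdVec i) k * momentum α i w.1 -
          ∑ i, Γ (stdVec k) (stdVec i) i * momentum α k w.1) := by
    intro k
    refine (DFunLike.congr_fun (momentum_mkForm _ _ k) w).trans ?_
    simp only [add_apply, sub_apply,
      ContinuousLinearMap.comp_apply, sum_apply,
      smul_apply, ContinuousLinearMap.coe_fst', ContinuousLinearMap.coe_snd',
      ContinuousLinearMap.apply_apply, smul_eq_mul, Finset.sum_mul]
    ring
  rw [Finset.sum_congr rfl fun k _ => h1 k, Finset.sum_add_distrib, tulczyjewCoeff_apply,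
    Finset.sum_sub_distrib, add_eq_left, sub_eq_zero, Finset.sum_comm]
  refine Finset.sum_congr rfl fun i _ => Finset.sum_congr rfl fun k _ => ?_
  rw [hΓ]

end Model

/-! ### Quotients of top forms, derivatives of form values, and the pairing -/

section TopForms

variable {m : ℕ}

theorem map_stdVec_ne_zero {μ : Euc m [⋀^Fin m]→L[ℝ] ℝ} (h : μ ≠ 0) :
    μ (fun i => stdVec i) ≠ 0 := fun h0 => h <| by
  ext v
  rw [map_eq_detForm μ v, h0, mul_zero]
  rfl

/-- The quotient of two top forms does not depend on the frame, so the pairing, defined by the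
standard vectors of the model tangent space, can be computed on coordinate fields. -/
theorem div_mul_map_eq {μ ν : Euc m [⋀^Fin m]→L[ℝ] ℝ} (h : ν ≠ 0) (v : Fin m → Euc m) :
    μ (fun i => stdVec i) / ν (fun i => stdVec i) * ν v = μ v := by
  have h1 := map_stdVec_ne_zero h
  rw [map_eq_detForm μ v, map_eq_detForm ν v]
  field_simp

theorem eq_of_apply_eq {μ ν : Euc m [⋀^Fin m]→L[ℝ] ℝ} {L : Euc m →L[ℝ] Euc m}
    {L' : Euc m →L[ℝ] Euc m} (hL : L.comp L' = ContinuousLinearMap.id ℝ (Euc m))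
    (h : μ (fun i => L (stdVec i)) = ν (fun i => L (stdVec i))) : μ = ν := by
  ext v
  have h1 : ∀ κ : Euc m [⋀^Fin m]→L[ℝ] ℝ, κ v =
      detForm m (fun i => L' (v i)) * κ (fun i => L (stdVec i)) := fun κ => by
    have h2 := map_eq_detForm (κ.compContinuousLinearMap L) (fun i => L' (v i))
    refine Eq.trans ?_ h2
    exact congrArg κ (funext fun i => (DFunLike.congr_fun hL (v i)).symm)
  rw [h1 μ, h1 ν, h]

end TopForms

section ModelFormFunctionals

variable {m : ℕ} {F : Type*} [NormedAddCommGroup F] [NormedSpace ℝ F] [FiniteDimensional ℝ F]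

/-- Evaluation of model forms at `v`. -/
def modelFormEval (v : Fin m → Euc m × F) : ModelForms (Euc m) F m 2 →L[ℝ] ℝ :=
  LinearMap.toContinuousLinearMap
    { toFun := fun α => (α : (Euc m × F) [⋀^Fin m]→L[ℝ] ℝ) v
      map_add' := fun _ _ => rfl
      map_smul' := fun _ _ => rfl }

variable (m F) in
/-- The components `pⁱ` of model forms, as a linear map. -/
def momentumCLM (i : Fin m) : ModelForms (Euc m) F m 2 →L[ℝ] F →L[ℝ] ℝ :=
  LinearMap.toContinuousLinearMap
    { toFun := fun α => momentum α i
      map_add' := fun _ _ => rfl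
      map_smul' := fun _ _ => rfl }

theorem momentumCLM_apply (i : Fin m) (α : ModelForms (Euc m) F m 2) :
    momentumCLM m F i α = momentum α i := rfl

/-- Product rule for p + pⁱuᵢ; in this shape only linear evaluations and the pairing of pⁱ with uᵢ
have to be differentiated. -/
theorem hasFDerivAt_modelForms_graph {V : Type*} [NormedAddCommGroup V] [NormedSpace ℝ V]
    {α : V → ModelForms (Euc m) F m 2} {a : V → Euc m →L[ℝ] F}
    {α' : V →L[ℝ] ModelForms (Euc m) F m 2} {a' : V →L[ℝ] Euc m →L[ℝ] F} {x : V}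
    (hα : HasFDerivAt α α' x) (ha : HasFDerivAt a a' x) :
    ∃ L : V →L[ℝ] ℝ, HasFDerivAt (fun y => (α y : (Euc m × F) [⋀^Fin m]→L[ℝ] ℝ)
        (fun i => (stdVec i, a y (stdVec i)))) L x ∧
      ∀ v, L v = (α' v : (Euc m × F) [⋀^Fin m]→L[ℝ] ℝ) (fun i => (stdVec i, a x (stdVec i))) +
        ∑ i, momentum (α x) i (a' v (stdVec i)) := by
  have h1 : ∀ i : Fin m, HasFDerivAt (fun y => momentumCLM m F i (α y) (a y (stdVec i))) _ x :=
    fun i => ((momentumCLM m F i).hasFDerivAt.comp x hα).clm_apply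
      (ha.clm_apply (hasFDerivAt_const (stdVec i : Euc m) x))
  have h2 := ((modelFormEval (F := F) fun i : Fin m => (stdVec i, 0)).hasFDerivAt.comp x hα).add
    (HasFDerivAt.fun_sum fun i (_ : i ∈ Finset.univ) => h1 i)
  refine ⟨_, h2.congr_of_eventuallyEq (Eventually.of_forall fun y => ?_), fun v => ?_⟩
  · exact modelForms_apply_graph (α y) _
  · rw [modelForms_apply_graph]
    simp [Finset.sum_add_distrib, modelFormEval, momentumCLM_apply]
    ring

end ModelFormFunctionals

section Pairing

variable {m : ℕ} {M : Type*} [TopologicalSpace M] [ChartedSpace (Euc m) M]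
variable {F E : Type*} [NormedAddCommGroup F] [NormedSpace ℝ F] [TopologicalSpace E]
  [ChartedSpace (Euc m × F) E] {π : E → M}

theorem pairing_mul (η : VolumeForm m M) (c : FiberedChart (Euc m) F π)
    (α : HForm (Euc m) F π m 2) (z : JetSpace m F π) (h : α.pt = z.pt) (hz : z.pt ∈ c.κ.source) :
    pairing η α z * η.toFun (π z.pt) (fun i => coordField c.ψ (stdVec i) (π z.pt)) =
      (α.coord c : (Euc m × F) [⋀^Fin m]→L[ℝ] ℝ) (fun i => (stdVec i, z.coord c (stdVec i))) := by
  have hα : α.pt ∈ c.κ.source := h ▸ hz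
  have h1 : pairing η α z * η.toFun (π z.pt) (fun i => coordField c.ψ (stdVec i) (π z.pt)) =
      α.alt.compContinuousLinearMap z.lin
        (fun i => coordField c.ψ (stdVec i) (π z.pt)) :=
    div_mul_map_eq (μ := α.alt.compContinuousLinearMap z.lin) (η.ne_zero (π z.pt)) _
  rw [h1, HForm.coord_of_mem c α hα]
  simp only [ContinuousAlternatingMap.compContinuousLinearMap_apply]
  refine congrArg α.alt (funext fun i => ?_)
  have h2 := DFunLike.congr_fun (Jet1.prod_coord c z hz) (stdVec i)
  have h3 := DFunLike.congr_fun (tmap_symm_comp c.mem_κ hz)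
    (z.lin (tmap (A := Euc m) (B := Euc m) c.ψ.symm (c.ψ (π z.pt)) (stdVec i)))
  have h4 : tmap (A := Euc m × F) (B := Euc m × F) c.κ.symm (c.κ α.pt)
      (stdVec i, z.coord c (stdVec i)) =
      z.lin (tmap (A := Euc m) (B := Euc m) c.ψ.symm (c.ψ (π z.pt)) (stdVec i)) := by
    rw [h]
    exact (congrArg _ h2).trans h3
  exact h4.symm

end Pairing

theorem tmap_of_hasFDerivAt_chart {A B X : Type*} [NormedAddCommGroup A] [NormedSpace ℝ A]
    [NormedAddCommGroup B] [NormedSpace ℝ B] [TopologicalSpace X] [ChartedSpace A X]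
    {ψ : OpenPartialHomeomorph X A} (hψ : ψ ∈ IsManifold.maximalAtlas 𝓘(ℝ, A) ∞ X) {x : X}
    (hx : x ∈ ψ.source) {G : X → B} {L : A →L[ℝ] B}
    (h : HasFDerivAt (fun v => G (ψ.symm v)) L (ψ x)) :
    MDifferentiableAt 𝓘(ℝ, A) 𝓘(ℝ, B) G x ∧
      tmap (A := A) (B := B) G x = L.comp (tmap (A := A) (B := A) ψ x) := by
  have h1 : MDifferentiableAt 𝓘(ℝ, A) 𝓘(ℝ, B) (fun v => G (ψ.symm v)) (ψ x) :=
    h.differentiableAt.mdifferentiableAt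
  have h2 : G =ᶠ[𝓝 x] (fun v => G (ψ.symm v)) ∘ ψ := by
    filter_upwards [ψ.open_source.mem_nhds hx] with y hy
    simp only [Function.comp, ψ.left_inv hy]
  have h3 := mdiff_chart hψ hx
  refine ⟨(h1.comp x h3).congr_of_eventuallyEq h2, ?_⟩
  rw [tmap_congr h2, tmap_comp h1 h3, tmap_eq_fderiv, h.fderiv]

/-! ### Existence and uniqueness of the tensor T -/

section Tensor

variable {m : ℕ} {M : Type*} [TopologicalSpace M] [ChartedSpace (Euc m) M]
  [IsManifold 𝓘(ℝ, Euc m) ∞ M]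
variable {F E : Type*} [NormedAddCommGroup F] [NormedSpace ℝ F] [TopologicalSpace E]
  [ChartedSpace (Euc m × F) E] [IsManifold 𝓘(ℝ, Euc m × F) ∞ E] {π : E → M}
  [IsFibration (Euc m) F π] [FiniteDimensional ℝ F]

variable {cov : (∀ x : M, TangentSpace 𝓘(ℝ, Euc m) x) →
      ∀ x : M, TangentSpace 𝓘(ℝ, Euc m) x →L[ℝ] TangentSpace 𝓘(ℝ, Euc m) x} {U : Set M}

/-- The right-hand side involves only the coordinates of the two jets, which is why d^{∇,η}⟨w, z⟩
does not depend on the representing sections. -/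
theorem IsCovariantDerivativeOn.dNabla_pairing (h : IsCovariantDerivativeOn (Euc m) cov U)
    (hU : IsOpen U) {x : M} (hxU : x ∈ U) (η : VolumeForm m M) (c : FiberedChart (Euc m) F π)
    {w : MomentumJetSpace m F π} {z : IteratedJetSpace m F π} (hw : w.pt.pt ∈ c.κ.source)
    (hz : z.pt.pt ∈ c.κ.source) {θ : M → HForm (Euc m) F π m 2} {σ : M → JetSpace m F π}
    (hθ : IsJetOf w θ x) (hσ : IsJetOf z σ x) (hθσ : ∀ᶠ y in 𝓝 x, (θ y).pt = (σ y).pt)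
    (X : Euc m) {v : Euc m} (hv : tmap (A := Euc m) (B := Euc m) c.ψ x X = v) :
    dNabla cov η (fun y => pairing η (θ y) (σ y)) x X *
        η.toFun x (fun i => coordField c.ψ (stdVec i) x) =
      ((w.coord (c.forms m 2) v).2 : (Euc m × F) [⋀^Fin m]→L[ℝ] ℝ)
          (fun i => (stdVec i, z.pt.coord c (stdVec i))) +
        ∑ i, momentum (w.pt.coord c) i ((z.coord c.jet v).2 (stdVec i)) -
        (w.pt.coord c : (Euc m × F) [⋀^Fin m]→L[ℝ] ℝ)
          (fun i => (stdVec i, z.pt.coord c (stdVec i))) *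
          ∑ i, christoffel cov c.ψ x v (stdVec i) i := by
  have hx : x ∈ c.ψ.source := by
    have h1 := hθ.base_eq
    rw [← h1]
    exact c.mapsTo _ hw
  have hθ' : HasFDerivAt (fun v => (θ (c.ψ.symm v)).coord c)
      ((ContinuousLinearMap.snd ℝ F (ModelForms (Euc m) F m 2)).comp (w.coord (c.forms m 2)))
      (c.ψ x) :=
    (hθ.hasFDerivAt (c.forms m 2) hw).snd.snd
  have hσ' : HasFDerivAt (fun v => (σ (c.ψ.symm v)).coord c)
      ((ContinuousLinearMap.snd ℝ F (Euc m →L[ℝ] F)).comp (z.coord c.jet)) (c.ψ x) :=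
    (hσ.hasFDerivAt c.jet hz).snd.snd
  obtain ⟨L, hL, hLv⟩ := hasFDerivAt_modelForms_graph hθ' hσ'
  obtain ⟨hG, hGX⟩ := tmap_of_hasFDerivAt_chart
    (G := fun y => ((θ y).coord c : (Euc m × F) [⋀^Fin m]→L[ℝ] ℝ)
      (fun i => (stdVec i, (σ y).coord c (stdVec i)))) c.mem_ψ hx hL
  have hnear : ∀ᶠ y in 𝓝 x, (σ y).pt ∈ c.κ.source := by
    refine hσ.mdifferentiableAt.continuousAt.eventually (c.jet.κ.open_source.mem_nhds ?_)
    rw [hσ.value]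
    exact hz
  have hfG : ∀ᶠ y in 𝓝 x, pairing η (θ y) (σ y) *
      η.toFun y (fun i => coordField c.ψ (stdVec i) y) =
      ((θ y).coord c : (Euc m × F) [⋀^Fin m]→L[ℝ] ℝ)
        (fun i => (stdVec i, (σ y).coord c (stdVec i))) := by
    filter_upwards [hθσ, hσ.isSection, hnear] with y h1 h2 h3
    have h4 := pairing_mul η c (θ y) (σ y) h1 h3
    have h5 : π (σ y).pt = y := h2
    rw [h5] at h4
    exact h4
  have h1 := h.dNabla_apply hU hxU c.mem_ψ hx η hG hfG X
  have hθx : (θ (c.ψ.symm (c.ψ x))).coord c = w.pt.coord c := by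
    rw [c.ψ.left_inv hx, hθ.value]
  have hσx : (σ (c.ψ.symm (c.ψ x))).coord c = z.pt.coord c := by
    rw [c.ψ.left_inv hx, hσ.value]
  rw [h1, hGX, hv, ContinuousLinearMap.comp_apply, hv, hLv, hθx, hσx, hθ.value, hσ.value]
  rfl

end Tensor

section Tensor

variable {m : ℕ} {M : Type*} [TopologicalSpace M] [ChartedSpace (Euc m) M]
variable {F E : Type*} [NormedAddCommGroup F] [NormedSpace ℝ F] [TopologicalSpace E]
  [ChartedSpace (Euc m × F) E] [IsManifold 𝓘(ℝ, Euc m × F) ∞ E] {π : E → M}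
  [IsFibration (Euc m) F π] [FiniteDimensional ℝ F]

variable {cov : (∀ x : M, TangentSpace 𝓘(ℝ, Euc m) x) →
      ∀ x : M, TangentSpace 𝓘(ℝ, Euc m) x →L[ℝ] TangentSpace 𝓘(ℝ, Euc m) x} {U : Set M}

/-- The tensor `T` with the coordinate expression `tulczyjewTensorModel` in a fibred chart. -/
def tulczyjewTensor (c : FiberedChart (Euc m) F π) (w : MomentumJetSpace m F π)
    (Γ : Euc m →L[ℝ] Euc m →L[ℝ] Euc m) :
    Euc m →L[ℝ] (Euc m × (F × (Euc m →L[ℝ] F))) [⋀^Fin m]→L[ℝ] ℝ :=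
  ((ContinuousAlternatingMap.compContinuousLinearMapCLM
    (tmap (A := Euc m × (F × (Euc m →L[ℝ] F))) (B := Euc m × (F × (Euc m →L[ℝ] F)))
      c.jet.κ w.base)).comp (tulczyjewTensorModel (w.pt.coord c)
        ((ContinuousLinearMap.snd ℝ F (ModelForms (Euc m) F m 2)).comp (w.coord (c.forms m 2)))
        (w.base.coord c) Γ)).comp (tmap (A := Euc m) (B := Euc m) c.ψ (Jet1.proj π w.base))

theorem tulczyjewTensor_horizontal (c : FiberedChart (Euc m) F π) (w : MomentumJetSpace m F π)
    (hw : w.pt.pt ∈ c.κ.source) (Γ : Euc m →L[ℝ] Euc m →L[ℝ] Euc m) (X : Euc m) :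
    tulczyjewTensor c w Γ X ∈ horizontalForms (tmap (A := Euc m × (F × (Euc m →L[ℝ] F)))
      (B := Euc m) (Jet1.proj π : JetSpace m F π → M) w.base) m 2 :=
  (HForm.ofCoord c.jet w.base hw (tulczyjewForm (w.pt.coord c)
        ((ContinuousLinearMap.snd ℝ F (ModelForms (Euc m) F m 2)).comp (w.coord (c.forms m 2)))
        (w.base.coord c) Γ
        (tmap (A := Euc m) (B := Euc m) c.ψ (Jet1.proj π w.base) X))).horizontal

/-- The lift of the coordinate fields by a jet of `π₁`. -/
theorem Jet1.tmap_lin_coordField {V : Type*} [NormedAddCommGroup V] [NormedSpace ℝ V]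
    {Q : Type*} [TopologicalSpace Q] [ChartedSpace (Euc m × V) Q] {ρ : Q → M}
    (c : FiberedChart (Euc m) V ρ) (y : Jet1 (Euc m) V ρ) (hy : y.pt ∈ c.κ.source) (i : Fin m) :
    tmap (A := Euc m × V) (B := Euc m × V) c.κ y.pt (y.lin
      (coordField c.ψ (stdVec i) (ρ y.pt))) = (stdVec i, y.coord c (stdVec i)) :=
  (DFunLike.congr_fun (Jet1.prod_coord c y hy) (stdVec i)).symm

/-- Naturality of the wedge product: the differential of ψ ∘ π₁ is the first component of the
differential of the jet chart, so the model identity pulls back. -/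
theorem wedgeTensor_tulczyjewTensor (c : FiberedChart (Euc m) F π)
    (w : MomentumJetSpace m F π) (hw : w.pt.pt ∈ c.κ.source)
    {Γ : Euc m →L[ℝ] Euc m →L[ℝ] Euc m} (hΓ : ∀ v w, Γ v w = Γ w v) :
    wedgeTensor w.base (tulczyjewTensor c w Γ) =
      (wedgeVolume (m := m) (tulczyjewCoeff (w.pt.coord c)
        ((ContinuousLinearMap.snd ℝ F (ModelForms (Euc m) F m 2)).comp (w.coord (c.forms m 2)))) :
        (Euc m × (F × (Euc m →L[ℝ] F))) [⋀^Fin (m + 1)]→L[ℝ] ℝ).compContinuousLinearMap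
      (tmap (A := Euc m × (F × (Euc m →L[ℝ] F))) (B := Euc m × (F × (Euc m →L[ℝ] F)))
        c.jet.κ w.base) := by
  rw [← neg_alternatize_tulczyjewTensorModel _ _ (w.base.coord c) Γ hΓ]
  ext v
  have h1 : ∀ u, tmap (A := Euc m) (B := Euc m) c.ψ (Jet1.proj π w.base)
      (tmap (A := Euc m × (F × (Euc m →L[ℝ] F))) (B := Euc m)
        (Jet1.proj π : JetSpace m F π → M) w.base u) =
      (tmap (A := Euc m × (F × (Euc m →L[ℝ] F))) (B := Euc m × (F × (Euc m →L[ℝ] F)))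
        c.jet.κ w.base u).1 := fun u =>
    DFunLike.congr_fun (c.jet.tmap_ψ_comp (p := w.base) hw) u
  simp only [wedgeTensor, ContinuousAlternatingMap.neg_apply,
    ContinuousAlternatingMap.compContinuousLinearMap_apply,
    ContinuousAlternatingMap.alternatizeUncurryFin_apply]
  refine congrArg Neg.neg (Finset.sum_congr rfl fun i _ => congrArg _ ?_)
  have h2 := h1 (v i)
  simp only [ContinuousLinearMap.comp_apply, ContinuousLinearMap.coe_fst', Function.comp_apply]
  rw [← h2]
  rfl

variable [IsManifold 𝓘(ℝ, Euc m) ∞ M]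

/-- Both sides of the pullback condition are top forms on T_xM, so they are compared on the
coordinate frame, where `tulczyjewForm_graph` meets `dNabla_pairing` at the exchanged jet. -/
theorem IsCovariantDerivativeOn.isTulczyjewTensor (h : IsCovariantDerivativeOn (Euc m) cov U)
    (hU : IsOpen U) (η : VolumeForm m M) (c : FiberedChart (Euc m) F π)
    (w : MomentumJetSpace m F π) (hw : w.pt.pt ∈ c.κ.source) (hxU : Jet1.proj π w.base ∈ U) :
    IsTulczyjewTensor cov η w
      (tulczyjewTensor c w (christoffel cov c.ψ (Jet1.proj π w.base))) where
  horizontal X := tulczyjewTensor_horizontal c w hw _ X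
  pullback B hB θ σ hθ hσ hθσ X := by
    have hx : Jet1.proj π w.base ∈ c.ψ.source := c.mapsTo _ hw
    let y : IteratedJetSpace m F π := ⟨w.base, B, hB⟩
    have hy : y.pt.pt ∈ c.κ.source := hw
    have hex : exchange cov y = exchangeIn c (christoffel cov c.ψ (Jet1.proj π w.base)) y :=
      h.exchange_eq hU c y hy hxU
    have hey : (exchange cov y).pt.pt ∈ c.κ.source := hex ▸ exchangeIn_pt_pt_mem c _ y hy
    refine eq_of_apply_eq (tmap_symm_comp c.mem_ψ hx) ?_
    have h1 := h.dNabla_pairing hU hxU η c hw hey hθ hσ hθσ X rfl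
    refine Eq.trans ?_ h1.symm
    have h2 : ∀ i, tmap (A := Euc m × (F × (Euc m →L[ℝ] F)))
        (B := Euc m × (F × (Euc m →L[ℝ] F))) c.jet.κ w.base
          (y.lin (coordField c.ψ (stdVec i) (Jet1.proj π w.base))) =
        (stdVec i, y.coord c.jet (stdVec i)) := fun i =>
      Jet1.tmap_lin_coordField c.jet y hy i
    have h3 := tulczyjewForm_graph (w.pt.coord c)
        ((ContinuousLinearMap.snd ℝ F (ModelForms (Euc m) F m 2)).comp (w.coord (c.forms m 2)))
        (w.base.coord c) (christoffel cov c.ψ (Jet1.proj π w.base))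
        (tmap (A := Euc m) (B := Euc m) c.ψ (Jet1.proj π w.base) X) (y.coord c.jet)
    have h4 := congrArg (tulczyjewForm (w.pt.coord c)
        ((ContinuousLinearMap.snd ℝ F (ModelForms (Euc m) F m 2)).comp (w.coord (c.forms m 2)))
        (w.base.coord c) (christoffel cov c.ψ (Jet1.proj π w.base))
        (tmap (A := Euc m) (B := Euc m) c.ψ (Jet1.proj π w.base) X) :
          (Euc m × (F × (Euc m →L[ℝ] F))) [⋀^Fin m]→L[ℝ] ℝ) (funext h2)
    refine Eq.trans h4 (h3.trans ?_)
    rw [hex]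
    simp only [exchangeIn_pt_coord c _ y hy, exchangeIn_coord_snd c _ y hy]
    rfl

/-- The exchange turns the slopes of z = j¹ν(w) into the ū part of ex_∇(y), so the sections affine
in the chart that represent w and ex_∇(y) have the same u components. Without such pairs the
condition defining T would be void. -/
theorem IsCovariantDerivativeOn.exists_sections (h : IsCovariantDerivativeOn (Euc m) cov U)
    (hU : IsOpen U) (c : FiberedChart (Euc m) F π)
    (w : MomentumJetSpace m F π) (hw : w.pt.pt ∈ c.κ.source) (hxU : Jet1.proj π w.base ∈ U)
    (y : IteratedJetSpace m F π) (hy : y.pt = w.base) :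
    ∃ (θ : M → HForm (Euc m) F π m 2) (σ : M → JetSpace m F π),
      IsJetOf w θ (Jet1.proj π w.base) ∧ IsJetOf (exchange cov y) σ (Jet1.proj π w.base) ∧
      ∀ᶠ q in 𝓝 (Jet1.proj π w.base), (θ q).pt = (σ q).pt := by
  have hyw : y.pt.pt = w.pt.pt := congrArg Jet1.pt hy
  have hyc : y.pt.pt ∈ c.κ.source := hyw ▸ hw
  have hyU : π y.pt.pt ∈ U := by rw [hyw]; exact hxU
  have hex := h.exchange_eq hU c y hyc hyU
  set z := exchange cov y with hz
  have hzp : z.pt.pt = w.pt.pt := by rw [hex, exchangeIn_pt_pt c _ y hyc, hyw]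
  have hzc : z.pt.pt ∈ c.κ.source := hzp ▸ hw
  have hzx : Jet1.proj π z.pt = Jet1.proj π w.base := congrArg π hzp
  have h1 := isJetOf_affineSection (c.forms m 2) w hw
  have h2 := isJetOf_affineSection c.jet z hzc
  have h3 := chart_affineSection (c.forms m 2) w hw
  have h4 := chart_affineSection c.jet z hzc
  rw [hzx] at h2 h4
  refine ⟨_, _, h1, h2, ?_⟩
  have h3' : ∀ᶠ q in 𝓝 (Jet1.proj π w.base), _ := h3
  filter_upwards [h3', h4] with q hq hq'
  refine c.κ.injOn hq.1 hq'.1 ?_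
  have h5 := hq.2.2
  have h6 := hq'.2.2
  have h7 : ∀ v, (w.coord (c.forms m 2) v).1 = (z.coord c.jet v).1 := fun v => by
    rw [hex, exchangeIn_coord_fst c _ y hyc, hy, Jet1.base_coord c w hw]
    rfl
  refine Prod.ext ((congrArg Prod.fst h5).trans (congrArg Prod.fst h6).symm)
    ((congrArg (fun q => q.2.1) h5).trans (Eq.trans ?_ (congrArg (fun q => q.2.1) h6).symm))
  change (c.κ w.pt.pt).2 + (w.coord (c.forms m 2) (c.ψ q - c.ψ (π w.pt.pt))).1 =
    (c.κ z.pt.pt).2 + (z.coord c.jet (c.ψ q - c.ψ (π w.pt.pt))).1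
  rw [hzp, h7]

theorem IsTulczyjewTensor.unique (h : IsCovariantDerivativeOn (Euc m) cov U)
    (hU : IsOpen U) {η : VolumeForm m M} {w : MomentumJetSpace m F π}
    (hxU : Jet1.proj π w.base ∈ U)
    {T T' : Euc m →L[ℝ] (Euc m × (F × (Euc m →L[ℝ] F))) [⋀^Fin m]→L[ℝ] ℝ}
    (hT : IsTulczyjewTensor cov η w T) (hT' : IsTulczyjewTensor cov η w T') : T = T' := by
  let c := fiberedChartAt (Euc m) F π w.pt.pt
  have hw : w.pt.pt ∈ c.κ.source := mem_fiberedChartAt _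
  have hwj : w.base ∈ c.jet.κ.source := hw
  ext1 X
  let L := tmap (A := Euc m × (F × (Euc m →L[ℝ] F))) (B := Euc m × (F × (Euc m →L[ℝ] F)))
    c.jet.κ w.base
  let L' := tmap (A := Euc m × (F × (Euc m →L[ℝ] F))) (B := Euc m × (F × (Euc m →L[ℝ] F)))
    c.jet.κ.symm (c.jet.κ w.base)
  have hL : ∀ u, L' (L u) = u := fun u => DFunLike.congr_fun (tmap_symm_comp c.jet.mem_κ hwj) u
  suffices hs : (T X).compContinuousLinearMap L' = (T' X).compContinuousLinearMap L' by
    ext v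
    have h1 := DFunLike.congr_fun hs fun i => L (v i)
    simp only [ContinuousAlternatingMap.compContinuousLinearMap_apply] at h1
    simpa only [Function.comp_def, hL] using h1
  refine eq_of_graph fun b => ?_
  -- Every graph over ℝᵐ is the coordinate expression of an element of the fibre J¹_z π₁, so the two
  -- forms agree on all graphs.
  let y : IteratedJetSpace m F π := Jet1.ofCoord c.jet w.base hwj b
  obtain ⟨θ, σ, hθ, hσ, hθσ⟩ := h.exists_sections hU c w hw hxU y rfl
  have h1 := hT.pullback y.map y.proj_comp θ σ hθ hσ hθσ X
  have h2 := hT'.pullback y.map y.proj_comp θ σ hθ hσ hθσ X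
  have h3 := DFunLike.congr_fun (h1.trans h2.symm)
    fun i => coordField c.ψ (stdVec i) (Jet1.proj π w.base)
  have h4 : ∀ i, L' (stdVec i, b (stdVec i)) =
      y.lin (coordField c.ψ (stdVec i) (Jet1.proj π w.base)) := fun i => by
    have h5 := Jet1.tmap_lin_coordField c.jet y hwj i
    rw [show y.coord c.jet = b from Jet1.coord_ofCoord c.jet w.base hwj b] at h5
    rw [← h5]
    exact hL _
  have h6 := funext h4
  exact (congrArg (T X) h6).trans (h3.trans (congrArg (T' X) h6).symm)

end Tensor

/-! ### The morphism in coordinates: linearity, surjectivity, smoothness -/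

section Model

variable {m : ℕ} {F : Type*} [NormedAddCommGroup F] [NormedSpace ℝ F]

theorem wedgeVolume_linComb {W : Type*} [NormedAddCommGroup W] [NormedSpace ℝ W]
    (s t : ℝ) (P Q : W →L[ℝ] ℝ) :
    wedgeVolume (m := m) (s • P + t • Q) = s • wedgeVolume P + t • wedgeVolume Q := by
  refine (Subtype.ext (eq_wedgeVolume (s • wedgeVolume (m := m) P + t • wedgeVolume Q).2
    fun w => ?_)).symm
  have h1 := wedgeVolume_cons (m := m) P w
  have h2 := wedgeVolume_cons (m := m) Q w
  exact congrArg₂ (fun p q => s * p + t * q) h1 h2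

/-- The form `(pⁱᵢ du + pⁱ duᵢ) ∧ dᵐx`, where `α` are the coordinates `(p, pⁱ)` and `b` the
coordinates `(uⱼ, pⱼ, pⁱⱼ)` of a jet of momenta. -/
def tulczyjewModel (α : ModelForms (Euc m) F m 2)
    (b : Euc m →L[ℝ] F × ModelForms (Euc m) F m 2) :
    ModelForms (Euc m) (F × (Euc m →L[ℝ] F)) (m + 1) 2 :=
  wedgeVolume (tulczyjewCoeff α ((ContinuousLinearMap.snd ℝ F (ModelForms (Euc m) F m 2)).comp b))

theorem tulczyjewModel_linComb {s t : ℝ} {α α₁ α₂ : ModelForms (Euc m) F m 2}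
    {b b₁ b₂ : Euc m →L[ℝ] F × ModelForms (Euc m) F m 2} (hα : α = s • α₁ + t • α₂)
    (hb : ∀ v, (b v).2 = s • (b₁ v).2 + t • (b₂ v).2) :
    tulczyjewModel α b = s • tulczyjewModel α₁ b₁ + t • tulczyjewModel α₂ b₂ := by
  have hm : ∀ (β γ : ModelForms (Euc m) F m 2) (k : Fin m) (f : F),
      momentum (s • β + t • γ) k f = s * momentum β k f + t * momentum γ k f :=
    fun _ _ _ _ => rfl
  simp only [tulczyjewModel]
  rw [← wedgeVolume_linComb]
  refine congrArg _ (ContinuousLinearMap.ext fun x => ?_)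
  simp only [add_apply, smul_apply, tulczyjewCoeff_apply, ContinuousLinearMap.comp_apply,
    ContinuousLinearMap.coe_snd', hb, hα, hm, smul_eq_mul, Finset.mul_sum,
    ← Finset.sum_add_distrib]
  exact Finset.sum_congr rfl fun k _ => by ring

/-- The form to be reached is P ∧ dᵐx, and the components of P on du and on duᵢ can be prescribed
through pⁱᵢ and pⁱ. The slopes `a` do not enter the expression and stay free, which allows a lift
over any given point of J¹π. -/
theorem exists_tulczyjewModel_eq (hm : 1 ≤ m) (a : Euc m →L[ℝ] F)
    (β : ModelForms (Euc m) (F × (Euc m →L[ℝ] F)) (m + 1) 2) :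
    ∃ (α : ModelForms (Euc m) F m 2) (b : Euc m →L[ℝ] F × ModelForms (Euc m) F m 2),
      (ContinuousLinearMap.fst ℝ F (ModelForms (Euc m) F m 2)).comp b = a ∧
        tulczyjewModel α b = β := by
  let P := wedgeCoeff (m := m)
    (β : (Euc m × (F × (Euc m →L[ℝ] F))) [⋀^Fin (m + 1)]→L[ℝ] ℝ)
  -- The choice is pⁱ(f) = P(0, dxⁱ ⊗ f), while the whole du part of `P` is put into the single
  -- trace term with index `i₀`.
  let i₀ : Fin m := ⟨0, hm⟩
  let p : Fin m → F →L[ℝ] ℝ := fun i => (P.comp (ContinuousLinearMap.inr ℝ F (Euc m →L[ℝ] F))).comp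
    (ContinuousLinearMap.smulRightL ℝ (Euc m) F (EuclideanSpace.proj i))
  let q : Fin m → F →L[ℝ] ℝ := fun i =>
    if i = i₀ then P.comp (ContinuousLinearMap.inl ℝ F (Euc m →L[ℝ] F)) else 0
  let r : Euc m →L[ℝ] ModelForms (Euc m) F m 2 :=
    (EuclideanSpace.proj i₀ : Euc m →L[ℝ] ℝ).smulRight (mkForm 0 q)
  refine ⟨mkForm 0 p, a.prod r, ContinuousLinearMap.ext fun _ => rfl, ?_⟩
  suffices hs : tulczyjewCoeff (mkForm 0 p) r = P from
    (congrArg (wedgeVolume (m := m)) hs).trans (eq_wedgeVolume_wedgeCoeff β).symm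
  refine ContinuousLinearMap.ext fun w => ?_
  rw [tulczyjewCoeff_apply]
  have h1 : ∀ k, momentum (r (stdVec k)) k w.1 = if k = i₀ then P (w.1, 0) else 0 := fun k => by
    have h2 : momentum (r (stdVec k)) k w.1 =
        (stdVec k : Euc m) i₀ * momentum (mkForm 0 q) k w.1 := rfl
    rw [h2, momentum_mkForm]
    by_cases hk : k = i₀
    · simp [q, hk]
    · simp [q, hk]
  have h3 : ∑ k, momentum (mkForm 0 p) k (w.2 (stdVec k)) = P (0, w.2) := by
    have h4 : ∑ k : Fin m, ContinuousLinearMap.smulRightL ℝ (Euc m) F (EuclideanSpace.proj k)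
        (w.2 (stdVec k)) = w.2 := by
      ext v
      conv_rhs => rw [← euc_sum_smul_stdVec v]
      simp
    calc ∑ k, momentum (mkForm 0 p) k (w.2 (stdVec k))
        = ∑ k : Fin m, (P.comp (ContinuousLinearMap.inr ℝ F (Euc m →L[ℝ] F)))
          (ContinuousLinearMap.smulRightL ℝ (Euc m) F (EuclideanSpace.proj k)
            (w.2 (stdVec k))) := by simp only [momentum_mkForm]; rfl
      _ = P (0, w.2) := by rw [← map_sum, h4]; rfl
  rw [Finset.sum_add_distrib]
  refine (congrArg₂ (· + ·) ((Finset.sum_congr rfl fun k _ => h1 k).trans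
    (Finset.sum_ite_eq' _ _ _)) h3).trans ?_
  rw [if_pos (Finset.mem_univ _), ← map_add]
  simp [P]

variable [FiniteDimensional ℝ F]

theorem contDiff_tulczyjewModel :
    ContDiff ℝ ∞ fun q : ModelForms (Euc m) F m 2 × (Euc m →L[ℝ] F × ModelForms (Euc m) F m 2) =>
      tulczyjewModel q.1 q.2 := by
  let l : ModelForms (Euc m) F m 2 × (Euc m →L[ℝ] F × ModelForms (Euc m) F m 2) →ₗ[ℝ]
      ModelForms (Euc m) (F × (Euc m →L[ℝ] F)) (m + 1) 2 :=
    { toFun := fun q => tulczyjewModel q.1 q.2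
      map_add' := fun q q' => by
        have h := tulczyjewModel_linComb (s := 1) (t := 1) (α₁ := q.1) (α₂ := q'.1) (b₁ := q.2)
          (b₂ := q'.2) (b := (q + q').2) rfl (fun v => by simp)
        rw [one_smul, one_smul, one_smul, one_smul] at h
        exact h
      map_smul' := fun s q => by
        have h := tulczyjewModel_linComb (s := s) (t := 0) (α₁ := q.1) (α₂ := q.1) (b₁ := q.2)
          (b₂ := q.2) (b := (s • q).2) rfl (fun v => by simp)
        rw [zero_smul, zero_smul, add_zero, add_zero] at h
        exact h }
  exact (LinearMap.toContinuousLinearMap l).contDiff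

end Model

/-! ### The vector bundle structure of J¹(π ∘ ν) over J¹π -/

section LinComb

variable {V M : Type*} [NormedAddCommGroup V] [NormedSpace ℝ V] [TopologicalSpace M]
  [ChartedSpace V M]
variable {F P : Type*} [NormedAddCommGroup F] [NormedSpace ℝ F] [TopologicalSpace P]
  [ChartedSpace (V × F) P] {ρ : P → M} {k r : ℕ}

theorem HForm.alt_eq (c : FiberedChart V F ρ) (α : HForm V F ρ k r) (h : α.pt ∈ c.κ.source) :
    α.alt = (α.coord c : (V × F) [⋀^Fin k]→L[ℝ] ℝ).compContinuousLinearMap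
      (tmap (A := V × F) (B := V × F) c.κ α.pt) :=
  (congrArg HForm.alt (HForm.ofCoord_coord c α h)).symm

theorem HForm.eq_of_coord_eq (c : FiberedChart V F ρ) {α α' : HForm V F ρ k r}
    (h : α.pt ∈ c.κ.source) (hp : α.pt = α'.pt) (hc : α.coord c = α'.coord c) : α = α' := by
  refine HForm.ext' hp ?_
  rw [HForm.alt_eq c α h, HForm.alt_eq c α' (hp ▸ h), hc, hp]

theorem HForm.coord_linComb (c : FiberedChart V F ρ) {s t : ℝ} {α α₁ α₂ : HForm V F ρ k r}
    (h₁ : α₁.pt = α.pt) (h₂ : α₂.pt = α.pt) (h : α.alt = s • α₁.alt + t • α₂.alt) :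
    α.coord c = s • α₁.coord c + t • α₂.coord c := by
  by_cases hc : α.pt ∈ c.κ.source
  · refine Subtype.ext ?_
    rw [Submodule.coe_add, Submodule.coe_smul, Submodule.coe_smul, HForm.coord_of_mem c α hc,
      HForm.coord_of_mem c α₁ (h₁ ▸ hc), HForm.coord_of_mem c α₂ (h₂ ▸ hc), h, h₁, h₂]
    rfl
  -- Outside the chart domain all three coordinates take the default value zero.
  · have hc₁ : α₁.pt ∉ c.κ.source := h₁ ▸ hc
    have hc₂ : α₂.pt ∉ c.κ.source := h₂ ▸ hc
    simp [HForm.coord, hc, hc₁, hc₂]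

theorem HForm.alt_linComb (c : FiberedChart V F ρ) {s t : ℝ} {α α₁ α₂ : HForm V F ρ k r}
    (hc : α.pt ∈ c.κ.source) (h₁ : α₁.pt = α.pt) (h₂ : α₂.pt = α.pt)
    (h : α.coord c = s • α₁.coord c + t • α₂.coord c) :
    α.alt = s • α₁.alt + t • α₂.alt := by
  rw [HForm.alt_eq c α hc, HForm.alt_eq c α₁ (h₁ ▸ hc), HForm.alt_eq c α₂ (h₂ ▸ hc), h, h₁, h₂]
  rfl

variable [FiniteDimensional ℝ V] [FiniteDimensional ℝ F] [IsManifold 𝓘(ℝ, V × F) ∞ P]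
  [IsFibration V F ρ] {s t : ℝ} {w₁ w₂ w : Jet1 V (F × ModelForms V F k r)
    (HForm.proj ρ k r : HForm V F ρ k r → M)}

theorem IsLinComb.pt_pt (h : IsLinComb s t w₁ w₂ w) : w.pt.pt = w₁.pt.pt := by
  obtain ⟨x, θ₁, θ₂, θ, h₁, h₂, h, hθ⟩ := h
  have h3 := hθ.self_of_nhds.1
  rw [h₁.value, h.value] at h3
  exact h3.symm

theorem IsLinComb.pt_coord (h : IsLinComb s t w₁ w₂ w) (c : FiberedChart V F ρ) :
    w.pt.coord c = s • w₁.pt.coord c + t • w₂.pt.coord c := by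
  obtain ⟨x, θ₁, θ₂, θ, h₁, h₂, h, hθ⟩ := h
  have h3 := hθ.self_of_nhds
  rw [h₁.value, h₂.value, h.value] at h3
  exact HForm.coord_linComb c h3.1 h3.2.1 h3.2.2

/-- Differentiate the relation between the sections in the chart: the u part is shared, the
components of the form are combined. -/
theorem IsLinComb.coord (h : IsLinComb s t w₁ w₂ w) (c : FiberedChart V F ρ)
    (hw : w.pt.pt ∈ c.κ.source) (v : V) :
    (w.coord (c.forms k r) v).1 = (w₁.coord (c.forms k r) v).1 ∧
    (w.coord (c.forms k r) v).2 = s • (w₁.coord (c.forms k r) v).2 +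
      t • (w₂.coord (c.forms k r) v).2 := by
  obtain ⟨x, θ₁, θ₂, θ, h₁, h₂, h, hθ⟩ := h
  have h3 := hθ.self_of_nhds
  rw [h₁.value, h₂.value, h.value] at h3
  have hw₁ : w₁.pt.pt ∈ c.κ.source := h3.1 ▸ hw
  have hw₂ : w₂.pt.pt ∈ c.κ.source := h3.2.1 ▸ hw
  have hx : x ∈ c.ψ.source := h.base_eq ▸ c.mapsTo _ hw
  have hev : ∀ᶠ u in 𝓝 (c.ψ x), (θ₁ (c.ψ.symm u)).pt = (θ (c.ψ.symm u)).pt ∧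
      (θ₂ (c.ψ.symm u)).pt = (θ (c.ψ.symm u)).pt ∧
      (θ (c.ψ.symm u)).alt = s • (θ₁ (c.ψ.symm u)).alt + t • (θ₂ (c.ψ.symm u)).alt := by
    have h4 := c.ψ.symm.continuousAt (x := c.ψ x) (c.ψ.map_source hx)
    rw [ContinuousAt, c.ψ.left_inv hx] at h4
    exact h4.eventually hθ
  have d₁ := (h₁.hasFDerivAt (c.forms k r) hw₁).snd
  have d₂ := (h₂.hasFDerivAt (c.forms k r) hw₂).snd
  have d := (h.hasFDerivAt (c.forms k r) hw).snd
  constructor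
  · have h5 := d.fst.unique (d₁.fst.congr_of_eventuallyEq (hev.mono fun u hu =>
      congrArg (fun p => (c.κ p).2) hu.1.symm))
    exact DFunLike.congr_fun h5 v
  · have h5 := d.snd.unique (((d₁.snd.const_smul s).add (d₂.snd.const_smul t)).congr_of_eventuallyEq
      (hev.mono fun u hu => HForm.coord_linComb c hu.1 hu.2.1 hu.2.2))
    exact DFunLike.congr_fun h5 v

theorem IsLinComb.base_eq (h : IsLinComb s t w₁ w₂ w) : w.base = w₁.base := by
  let c := fiberedChartAt V F ρ w.pt.pt
  have hw : w.pt.pt ∈ c.κ.source := mem_fiberedChartAt _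
  refine Jet1.eq_of_coord_eq c hw h.pt_pt (ContinuousLinearMap.ext fun v => ?_)
  rw [Jet1.base_coord c w hw, Jet1.base_coord c w₁ (h.pt_pt ▸ hw)]
  exact (h.coord c hw v).1

/-- Since the bases agree, the affine sections of `w₁` and `w₂` in a common chart have the same u
part, and a combination of affine functions is affine. Uniqueness holds because the coordinates of
the result are forced. -/
theorem existsUnique_isLinComb (s t : ℝ) {w₁ w₂ : Jet1 V (F × ModelForms V F k r)
    (HForm.proj ρ k r : HForm V F ρ k r → M)} (h : w₁.base = w₂.base) :
    ∃! w, IsLinComb s t w₁ w₂ w := by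
  have hpt : w₁.pt.pt = w₂.pt.pt := congrArg Jet1.pt h
  let c := fiberedChartAt V F ρ w₁.pt.pt
  have hw₁ : w₁.pt.pt ∈ c.κ.source := mem_fiberedChartAt _
  have hw₂ : w₂.pt.pt ∈ c.κ.source := hpt ▸ hw₁
  refine existsUnique_of_exists_of_unique ?_ fun w w' hw hw' => ?_
  · let α := s • w₁.pt.coord c + t • w₂.pt.coord c
    let a : V →L[ℝ] ModelForms V F k r := (ContinuousLinearMap.snd ℝ F (ModelForms V F k r)).comp
      (s • w₁.coord (c.forms k r) + t • w₂.coord (c.forms k r))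
    let q : HForm V F ρ k r := HForm.ofCoord c w₁.pt.pt hw₁ α
    let w : Jet1 V (F × ModelForms V F k r) (HForm.proj ρ k r : HForm V F ρ k r → M) :=
      Jet1.ofCoord (c.forms k r) q hw₁ ((w₁.base.coord c).prod a)
    have hwα : w.pt.coord c = α := HForm.coord_ofCoord c _ hw₁ α
    have hwa : w.coord (c.forms k r) = (w₁.base.coord c).prod a :=
      Jet1.coord_ofCoord (c.forms k r) q hw₁ _
    have hwc : w.pt.pt ∈ c.κ.source := hw₁
    have j₁ := isJetOf_affineSection (c.forms k r) w₁ hw₁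
    have j₂ := isJetOf_affineSection (c.forms k r) w₂ hw₂
    have j := isJetOf_affineSection (c.forms k r) w hwc
    have e₁ := chart_affineSection (c.forms k r) w₁ hw₁
    have e₂ := chart_affineSection (c.forms k r) w₂ hw₂
    have e := chart_affineSection (c.forms k r) w hwc
    have hx₂ : HForm.proj ρ k r w₂.pt = HForm.proj ρ k r w₁.pt := congrArg ρ hpt.symm
    rw [hx₂] at j₂ e₂
    refine ⟨w, HForm.proj ρ k r w₁.pt, _, _, _, j₁, j₂, j, ?_⟩
    have e' : ∀ᶠ y in 𝓝 (HForm.proj ρ k r w₁.pt), _ := e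
    filter_upwards [e₁, e₂, e'] with y h₁ h₂ h₃
    set θ₁ := affineSection (c.forms k r) w₁ y
    set θ₂ := affineSection (c.forms k r) w₂ y
    set θ := affineSection (c.forms k r) w y
    have k₁ := h₁.2.2
    have k₂ := h₂.2.2
    have k₃ := h₃.2.2
    set u := c.ψ y - c.ψ (ρ w₁.pt.pt) with hu
    have b₁ : ∀ v, (w₁.coord (c.forms k r) v).1 = w₁.base.coord c v := fun v =>
      (DFunLike.congr_fun (Jet1.base_coord c w₁ hw₁) v).symm
    have b₂ : ∀ v, (w₂.coord (c.forms k r) v).1 = w₁.base.coord c v := fun v => by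
      rw [h]
      exact (DFunLike.congr_fun (Jet1.base_coord c w₂ hw₂) v).symm
    have b : ∀ v, (w.coord (c.forms k r) v).1 = w₁.base.coord c v := fun v => by rw [hwa]; rfl
    have x₁ : c.κ θ₁.pt = (c.ψ y, (c.κ w₁.pt.pt).2 + w₁.base.coord c u) := by
      rw [← b₁]
      have f := congrArg Prod.fst k₁
      have g := congrArg (fun z => z.2.1) k₁
      exact Prod.ext f g
    have x₂ : c.κ θ₂.pt = (c.ψ y, (c.κ w₁.pt.pt).2 + w₁.base.coord c u) := by
      rw [← b₂, hpt]
      have f := congrArg Prod.fst k₂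
      have g := congrArg (fun z => z.2.1) k₂
      exact Prod.ext f g
    have x₃ : c.κ θ.pt = (c.ψ y, (c.κ w₁.pt.pt).2 + w₁.base.coord c u) := by
      rw [← b]
      have f := congrArg Prod.fst k₃
      have g := congrArg (fun z => z.2.1) k₃
      exact Prod.ext f g
    have p₁ : θ₁.pt = θ.pt := c.κ.injOn h₁.1 h₃.1 (x₁.trans x₃.symm)
    have p₂ : θ₂.pt = θ.pt := c.κ.injOn h₂.1 h₃.1 (x₂.trans x₃.symm)
    refine ⟨p₁, p₂, HForm.alt_linComb c h₃.1 p₁ p₂ ?_⟩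
    have c₁ : θ₁.coord c = w₁.pt.coord c + (w₁.coord (c.forms k r) u).2 :=
      congrArg (fun z => z.2.2) k₁
    have c₂ : θ₂.coord c = w₂.pt.coord c + (w₂.coord (c.forms k r) u).2 :=
      congrArg (fun z => z.2.2) k₂
    have c₃ : θ.coord c = w.pt.coord c + (w.coord (c.forms k r) u).2 :=
      congrArg (fun z => z.2.2) k₃
    have c₄ : (w.coord (c.forms k r) u).2 = s • (w₁.coord (c.forms k r) u).2 +
        t • (w₂.coord (c.forms k r) u).2 := by rw [hwa]; rfl
    rw [c₁, c₂, c₃, hwα, c₄, smul_add, smul_add]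
    exact add_add_add_comm _ _ _ _
  · have hwc : w.pt.pt ∈ c.κ.source := hw.pt_pt ▸ hw₁
    have hwc' : w'.pt.pt ∈ c.κ.source := hw'.pt_pt ▸ hw₁
    have h1 : w.pt = w'.pt := HForm.eq_of_coord_eq c hwc (hw.pt_pt.trans hw'.pt_pt.symm)
      ((hw.pt_coord c).trans (hw'.pt_coord c).symm)
    refine Jet1.eq_of_coord_eq (c.forms k r) hwc h1 (ContinuousLinearMap.ext fun v => ?_)
    have h2 := hw.coord c hwc v
    have h3 := hw'.coord c hwc' v
    exact Prod.ext (h2.1.trans h3.1.symm) (h2.2.trans h3.2.symm)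

end LinComb

/-! ### The Tulczyjew morphism and its independence of the chart -/

section Tulczyjew

variable {m : ℕ} {M : Type*} [TopologicalSpace M] [ChartedSpace (Euc m) M]
variable {F E : Type*} [NormedAddCommGroup F] [NormedSpace ℝ F] [TopologicalSpace E]
  [ChartedSpace (Euc m × F) E] [IsManifold 𝓘(ℝ, Euc m × F) ∞ E] {π : E → M}
  [IsFibration (Euc m) F π] [FiniteDimensional ℝ F]

/-- The value at `w` of the Tulczyjew morphism, computed in the fibred chart `c`. -/
def tulczyjewAt (c : FiberedChart (Euc m) F π) (w : MomentumJetSpace m F π)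
    (hw : w.pt.pt ∈ c.κ.source) : JetForms m F π :=
  HForm.ofCoord c.jet w.base hw (tulczyjewModel (w.pt.coord c) (w.coord (c.forms m 2)))

theorem tulczyjewAt_pt (c : FiberedChart (Euc m) F π) (w : MomentumJetSpace m F π)
    (hw : w.pt.pt ∈ c.κ.source) : (tulczyjewAt c w hw).pt = w.base := rfl

theorem tulczyjewAt_coord (c : FiberedChart (Euc m) F π) (w : MomentumJetSpace m F π)
    (hw : w.pt.pt ∈ c.κ.source) : (tulczyjewAt c w hw).coord c.jet =
      tulczyjewModel (w.pt.coord c) (w.coord (c.forms m 2)) :=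
  HForm.coord_ofCoord c.jet w.base hw _

theorem tulczyjewAt_alt (c : FiberedChart (Euc m) F π) (w : MomentumJetSpace m F π)
    (hw : w.pt.pt ∈ c.κ.source) : (tulczyjewAt c w hw).alt =
      (tulczyjewModel (w.pt.coord c) (w.coord (c.forms m 2)) :
        (Euc m × (F × (Euc m →L[ℝ] F))) [⋀^Fin (m + 1)]→L[ℝ] ℝ).compContinuousLinearMap
      (tmap (A := Euc m × (F × (Euc m →L[ℝ] F))) (B := Euc m × (F × (Euc m →L[ℝ] F)))
        c.jet.κ w.base) := rfl

/-- The Tulczyjew morphism. -/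
def tulczyjewMorphism (w : MomentumJetSpace m F π) : JetForms m F π :=
  tulczyjewAt (fiberedChartAt (Euc m) F π w.pt.pt) w (mem_fiberedChartAt w.pt.pt)

theorem tulczyjewMorphism_pt (w : MomentumJetSpace m F π) : (tulczyjewMorphism w).pt = w.base :=
  rfl

/-- Lying over the identity places both values in the domain of one chart, where the expression
determines them. -/
theorem HasTulczyjewExpression.unique {A A' : MomentumJetSpace m F π → JetForms m F π}
    (h : HasTulczyjewExpression A) (h' : HasTulczyjewExpression A')
    (hA : ∀ w, (A w).pt = w.base) (hA' : ∀ w, (A' w).pt = w.base) : A = A' := by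
  funext w
  let c := fiberedChartAt (Euc m) F π w.pt.pt
  have hc : w.pt.pt ∈ c.κ.source := mem_fiberedChartAt _
  obtain ⟨β, hβ, hβv⟩ := h c w hc _ _ _ _ rfl
  obtain ⟨β', hβ', hβv'⟩ := h' c w hc _ _ _ _ rfl
  have hββ' : β = β' := Subtype.ext
    (ContinuousAlternatingMap.ext fun v => (hβv v).trans (hβv' v).symm)
  have hs : (A w).pt.pt ∈ c.κ.source := by rw [hA]; exact hc
  have hs' : (A' w).pt.pt ∈ c.κ.source := by rw [hA']; exact hc
  exact (c.jet.forms (m + 1) 2).κ.injOn hs hs' (by rw [hβ, hβ', hββ'])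

variable [IsManifold 𝓘(ℝ, Euc m) ∞ M]

/-- By uniqueness T may be computed in any chart around the point, and the outcome of the wedge
product involves neither the connection nor η. -/
theorem IsTulczyjewTensor.wedgeTensor_eq
    {cov : (∀ x : M, TangentSpace 𝓘(ℝ, Euc m) x) →
      ∀ x : M, TangentSpace 𝓘(ℝ, Euc m) x →L[ℝ] TangentSpace 𝓘(ℝ, Euc m) x} {U : Set M}
    (h : IsCovariantDerivativeOn (Euc m) cov U) (hU : IsOpen U) {η : VolumeForm m M}
    (c : FiberedChart (Euc m) F π) (w : MomentumJetSpace m F π) (hw : w.pt.pt ∈ c.κ.source)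
    (hxU : Jet1.proj π w.base ∈ U)
    (hΓ : ∀ v v', christoffel cov c.ψ (Jet1.proj π w.base) v v' =
      christoffel cov c.ψ (Jet1.proj π w.base) v' v)
    {T : Euc m →L[ℝ] (Euc m × (F × (Euc m →L[ℝ] F))) [⋀^Fin m]→L[ℝ] ℝ}
    (hT : IsTulczyjewTensor cov η w T) :
    wedgeTensor w.base T = (tulczyjewAt c w hw).alt := by
  rw [hT.unique h hU hxU (h.isTulczyjewTensor hU η c w hw hxU), tulczyjewAt_alt]
  exact wedgeTensor_tulczyjewTensor c w hw hΓ

/-- The flat connection of `c` has symmetric Christoffel symbols in both charts, so the wedge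
product of its unique tensor T equals both candidates. -/
theorem tulczyjewAt_eq (η : VolumeForm m M) (c c' : FiberedChart (Euc m) F π)
    (w : MomentumJetSpace m F π) (hw : w.pt.pt ∈ c.κ.source) (hw' : w.pt.pt ∈ c'.κ.source) :
    tulczyjewAt c w hw = tulczyjewAt c' w hw' := by
  have hx : Jet1.proj π w.base ∈ c.ψ.source := c.mapsTo _ hw
  have hx' : Jet1.proj π w.base ∈ c'.ψ.source := c'.mapsTo _ hw'
  have h := isCovariantDerivativeOn_flatConnection c.mem_ψ
  have h0 : ∀ v v', christoffel (flatConnection c.ψ) c.ψ (Jet1.proj π w.base) v v' =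
      christoffel (flatConnection c.ψ) c.ψ (Jet1.proj π w.base) v' v := fun v v' => by
    simp only [christoffel_flatConnection c.mem_ψ hx, zero_apply]
  have h0' := h.christoffel_symm_change c.ψ.open_source hx c.mem_ψ c'.mem_ψ hx hx' h0
  have hT := h.isTulczyjewTensor c.ψ.open_source η c w hw hx
  have h1 := IsTulczyjewTensor.wedgeTensor_eq h c.ψ.open_source c w hw hx h0 hT
  have h2 := IsTulczyjewTensor.wedgeTensor_eq h c.ψ.open_source c' w hw' hx h0' hT
  have hp : (tulczyjewAt c w hw).pt = (tulczyjewAt c' w hw').pt :=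
    (tulczyjewAt_pt c w hw).trans (tulczyjewAt_pt c' w hw').symm
  have ha : (tulczyjewAt c w hw).alt = (tulczyjewAt c' w hw').alt := h1.symm.trans h2
  exact HForm.ext' hp ha

theorem tulczyjewMorphism_eq (η : VolumeForm m M) (c : FiberedChart (Euc m) F π)
    (w : MomentumJetSpace m F π) (hw : w.pt.pt ∈ c.κ.source) :
    tulczyjewMorphism w = tulczyjewAt c w hw :=
  tulczyjewAt_eq η _ c w _ hw

theorem chart_tulczyjewMorphism (η : VolumeForm m M) (c : FiberedChart (Euc m) F π)
    (w : MomentumJetSpace m F π) (hw : w.pt.pt ∈ c.κ.source) :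
    (c.jet.forms (m + 1) 2).κ (tulczyjewMorphism w) = ((c.κ w.pt.pt).1, ((c.κ w.pt.pt).2,
      (ContinuousLinearMap.fst ℝ F (ModelForms (Euc m) F m 2)).comp (w.coord (c.forms m 2))),
      tulczyjewModel (w.pt.coord c) (w.coord (c.forms m 2))) := by
  rw [← Jet1.base_coord c w hw, tulczyjewMorphism_eq η c w hw, ← tulczyjewAt_coord c w hw]
  rfl

theorem tulczyjewModel_apply {m : ℕ} {F : Type*} [NormedAddCommGroup F] [NormedSpace ℝ F]
    (α : ModelForms (Euc m) F m 2) (b : Euc m →L[ℝ] F × ModelForms (Euc m) F m 2)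
    (v : Fin (m + 1) → Euc m × (F × (Euc m →L[ℝ] F))) :
    (tulczyjewModel α b : (Euc m × (F × (Euc m →L[ℝ] F))) [⋀^Fin (m + 1)]→L[ℝ] ℝ) v =
      ∑ k : Fin (m + 1), (-1) ^ (k : ℕ) *
        (∑ i : Fin m, (momentum (b (stdVec i)).2 i (v k).2.1 +
          momentum α i ((v k).2.2 (stdVec i)))) *
        Matrix.det (Matrix.of fun i j : Fin m => (v (k.succAbove i)).1 j) := by
  refine (wedgeVolume_apply _ v).trans (Finset.sum_congr rfl fun k _ => ?_)
  rw [tulczyjewCoeff_apply]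
  rfl

theorem hasTulczyjewExpression_tulczyjewMorphism (η : VolumeForm m M) :
    HasTulczyjewExpression (tulczyjewMorphism : MomentumJetSpace m F π → JetForms m F π) := by
  intro c w hw x u α b hc
  have h1 : (c.κ w.pt.pt).1 = x := congrArg Prod.fst hc
  have h2 : (c.κ w.pt.pt).2 = u := congrArg (fun q => q.2.1.1) hc
  have h3 : w.pt.coord c = α := congrArg (fun q => q.2.1.2) hc
  have h4 : w.coord (c.forms m 2) = b := congrArg (fun q => q.2.2) hc
  refine ⟨tulczyjewModel α b, ?_, tulczyjewModel_apply α b⟩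
  rw [chart_tulczyjewMorphism η c w hw, h1, h2, h3, h4]

end Tulczyjew

theorem contMDiffAt_of_chart_expression {A B X Y : Type*} [NormedAddCommGroup A] [NormedSpace ℝ A]
    [NormedAddCommGroup B] [NormedSpace ℝ B] [TopologicalSpace X] [ChartedSpace A X]
    [TopologicalSpace Y] [ChartedSpace B Y] {e : OpenPartialHomeomorph X A}
    {e' : OpenPartialHomeomorph Y B} (he : e ∈ IsManifold.maximalAtlas 𝓘(ℝ, A) ∞ X)
    (he' : e' ∈ IsManifold.maximalAtlas 𝓘(ℝ, B) ∞ Y) {f : X → Y} {g : A → B}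
    (hg : ContDiff ℝ ∞ g) (hs : ∀ x ∈ e.source, f x ∈ e'.source)
    (hf : ∀ x ∈ e.source, e' (f x) = g (e x)) {x : X} (hx : x ∈ e.source) :
    ContMDiffAt 𝓘(ℝ, A) 𝓘(ℝ, B) ∞ f x := by
  have ht : g (e x) ∈ e'.target := hf x hx ▸ e'.map_source (hs x hx)
  have h1 := contMDiffAt_of_mem_maximalAtlas he hx
  have h2 := contMDiffAt_symm_of_mem_maximalAtlas he' ht
  refine (h2.comp x (hg.contMDiff.contMDiffAt.comp x h1)).congr_of_eventuallyEq ?_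
  filter_upwards [e.open_source.mem_nhds hx] with y hy
  exact (e'.left_inv (hs y hy)).symm.trans (congrArg e'.symm (hf y hy))

theorem contDiff_jetCoord {V F G H : Type*} [NormedAddCommGroup V] [NormedSpace ℝ V]
    [NormedAddCommGroup F] [NormedSpace ℝ F] [NormedAddCommGroup G] [NormedSpace ℝ G]
    [NormedAddCommGroup H] [NormedSpace ℝ H] {l : G × (V →L[ℝ] F × G) → H}
    (hl : ContDiff ℝ ∞ l) :
    ContDiff ℝ ∞ fun y : V × ((F × G) × (V →L[ℝ] F × G)) =>
      (y.1, (y.2.1.1, (ContinuousLinearMap.fst ℝ F G).comp y.2.2), l (y.2.1.2, y.2.2)) := by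
  have h2 : ContDiff ℝ ∞ fun y : V × ((F × G) × (V →L[ℝ] F × G)) => y.2 := contDiff_snd
  have h5 := hl.comp (h2.fst.snd.prodMk h2.snd)
  exact contDiff_fst.prodMk ((h2.fst.fst.prodMk (contDiff_const.clm_comp h2.snd)).prodMk h5)

/-! ### Smoothness and the epimorphism property -/

section Tulczyjew

variable {m : ℕ} {M : Type*} [TopologicalSpace M] [ChartedSpace (Euc m) M]
variable {F E : Type*} [NormedAddCommGroup F] [NormedSpace ℝ F] [TopologicalSpace E]
  [ChartedSpace (Euc m × F) E] [IsManifold 𝓘(ℝ, Euc m × F) ∞ E] {π : E → M}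
  [IsFibration (Euc m) F π] [FiniteDimensional ℝ F]

variable [IsManifold 𝓘(ℝ, Euc m) ∞ M]

theorem contMDiff_tulczyjewMorphism (η : VolumeForm m M) :
    ContMDiff 𝓘(ℝ, Euc m × ((F × ModelForms (Euc m) F m 2) ×
        (Euc m →L[ℝ] F × ModelForms (Euc m) F m 2)))
      𝓘(ℝ, Euc m × ((F × (Euc m →L[ℝ] F)) × ModelForms (Euc m) (F × (Euc m →L[ℝ] F)) (m + 1) 2))
      ∞ (tulczyjewMorphism : MomentumJetSpace m F π → JetForms m F π) :=
  fun w => contMDiffAt_of_chart_expression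
    ((fiberedChartAt (Euc m) F π w.pt.pt).forms m 2).jet.mem_κ
    ((fiberedChartAt (Euc m) F π w.pt.pt).jet.forms (m + 1) 2).mem_κ
    (contDiff_jetCoord contDiff_tulczyjewModel)
    (fun _ hw' => hw')
    (fun w' hw' => chart_tulczyjewMorphism η (fiberedChartAt (Euc m) F π w.pt.pt) w' hw')
    (x := w) (mem_fiberedChartAt w.pt.pt)

end Tulczyjew

section Tulczyjew

variable {m : ℕ} {M : Type*} [TopologicalSpace M] [ChartedSpace (Euc m) M]
variable {F E : Type*} [NormedAddCommGroup F] [NormedSpace ℝ F] [TopologicalSpace E]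
  [ChartedSpace (Euc m × F) E] [IsManifold 𝓘(ℝ, Euc m × F) ∞ E] {π : E → M}
  [IsFibration (Euc m) F π] [FiniteDimensional ℝ F]

variable [IsManifold 𝓘(ℝ, Euc m) ∞ M]

theorem isVectorBundleEpimorphism_tulczyjewMorphism (hm : 1 ≤ m) (η : VolumeForm m M) :
    IsVectorBundleEpimorphism
      (tulczyjewMorphism : MomentumJetSpace m F π → JetForms m F π) where
  smooth := contMDiff_tulczyjewMorphism η
  over_id := tulczyjewMorphism_pt
  linear s t w₁ w₂ h := by
    refine ⟨existsUnique_isLinComb s t h, fun w hw => ?_⟩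
    let c := fiberedChartAt (Euc m) F π w.pt.pt
    have hc : w.pt.pt ∈ c.κ.source := mem_fiberedChartAt _
    have hb₁ : w₁.base = w.base := hw.base_eq.symm
    have hb₂ : w₂.base = w.base := h.symm.trans hb₁
    have hc₁ : w₁.pt.pt ∈ c.κ.source := hw.pt_pt ▸ hc
    have hp₂ : w₂.pt.pt = w.pt.pt := congrArg Jet1.pt hb₂
    have hc₂ : w₂.pt.pt ∈ c.κ.source := hp₂ ▸ hc
    rw [tulczyjewMorphism_eq η c w hc, tulczyjewMorphism_eq η c w₁ hc₁,
      tulczyjewMorphism_eq η c w₂ hc₂]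
    refine HForm.alt_linComb c.jet hc hb₁ hb₂ ?_
    rw [tulczyjewAt_coord, tulczyjewAt_coord, tulczyjewAt_coord]
    exact tulczyjewModel_linComb (hw.pt_coord c) fun v => (hw.coord c hc v).2
  surjective β := by
    let c := fiberedChartAt (Euc m) F π β.pt.pt
    have hc : β.pt.pt ∈ c.κ.source := mem_fiberedChartAt _
    -- The first component of `b` is prescribed so that the lift lies over the base point of `β`.
    obtain ⟨α, b, hb, hβ⟩ := exists_tulczyjewModel_eq hm (β.pt.coord c) (β.coord c.jet)
    let q : HForm (Euc m) F π m 2 := HForm.ofCoord c β.pt.pt hc α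
    let w : MomentumJetSpace m F π := Jet1.ofCoord (c.forms m 2) q hc b
    have hα : w.pt.coord c = α := HForm.coord_ofCoord c _ hc α
    have hwb : w.coord (c.forms m 2) = b := Jet1.coord_ofCoord (c.forms m 2) q hc b
    have hwc : w.pt.pt ∈ c.κ.source := hc
    have hbase : w.base = β.pt := by
      refine Jet1.eq_of_coord_eq c hc rfl ?_
      rw [Jet1.base_coord c w hc, hwb, hb]
    refine ⟨w, hbase, ?_⟩
    rw [tulczyjewMorphism_eq η c w hwc]
    refine HForm.eq_of_coord_eq c.jet hwc hbase ?_
    rw [tulczyjewAt_coord, hα, hwb, hβ]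

end Tulczyjew

end

/-! ### The main theorem -/

theorem mainTheorem6 {m n : ℕ} (hm : 1 ≤ m) {M E : Type*}
    [TopologicalSpace M] [ChartedSpace (Euc m) M] [IsManifold 𝓘(ℝ, Euc m) ∞ M]
    [TopologicalSpace E] [ChartedSpace (Euc m × Euc n) E]
    [IsManifold 𝓘(ℝ, Euc m × Euc n) ∞ E]
    (π : E → M) [IsFibration (Euc m) (Euc n) π] (η : VolumeForm m M) :
    (∀ (U : Set M)
        (cov : (∀ x : M, TangentSpace 𝓘(ℝ, Euc m) x) →
          ∀ x : M, TangentSpace 𝓘(ℝ, Euc m) x →L[ℝ] TangentSpace 𝓘(ℝ, Euc m) x),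
      IsOpen U → IsSymmetricConnectionOn cov U →
        ∀ (c : FiberedChart (Euc m) (Euc n) π) (y : IteratedJetSpace m (Euc n) π),
          y.pt.pt ∈ c.κ.source → π y.pt.pt ∈ U →
            c.jet.jet.κ (exchange cov y) =
              exchangeCoord (christoffel cov c.ψ (π y.pt.pt)) (c.jet.jet.κ y)) ∧
    ∃! A : MomentumJetSpace m (Euc n) π → JetForms m (Euc n) π,
      IsVectorBundleEpimorphism A ∧ HasTulczyjewExpression A ∧
      ∀ (U : Set M)
        (cov : (∀ x : M, TangentSpace 𝓘(ℝ, Euc m) x) →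
          ∀ x : M, TangentSpace 𝓘(ℝ, Euc m) x →L[ℝ] TangentSpace 𝓘(ℝ, Euc m) x),
        IsOpen U → IsSymmetricConnectionOn cov U →
          ∀ w : MomentumJetSpace m (Euc n) π, Jet1.proj π w.base ∈ U →
            (∃! T, IsTulczyjewTensor cov η w T) ∧
              ∀ T, IsTulczyjewTensor cov η w T → (A w).alt = wedgeTensor w.base T := by
  refine ⟨fun U cov hU hcov c y hy hyU => ?_, tulczyjewMorphism,
    ⟨isVectorBundleEpimorphism_tulczyjewMorphism hm η, hasTulczyjewExpression_tulczyjewMorphism η,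
      fun U cov hU hcov w hxU => ?_⟩, fun A hA => ?_⟩
  · rw [hcov.isCovariantDerivativeOn.exchange_eq hU c y hy hyU]
    exact chart_exchangeIn c _ y hy
  · let c := fiberedChartAt (Euc m) (Euc n) π w.pt.pt
    have hw : w.pt.pt ∈ c.κ.source := mem_fiberedChartAt _
    have h := hcov.isCovariantDerivativeOn
    exact ⟨⟨_, h.isTulczyjewTensor hU η c w hw hxU, fun T hT =>
        hT.unique h hU hxU (h.isTulczyjewTensor hU η c w hw hxU)⟩,
      fun T hT => (IsTulczyjewTensor.wedgeTensor_eq h hU c w hw hxU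
        (hcov.christoffel_symm hU hxU c.mem_ψ (c.mapsTo _ hw)) hT).symm⟩
  -- The coordinate expression and the property of lying over the identity already determine the
  -- map.
  · exact hA.2.1.unique (hasTulczyjewExpression_tulczyjewMorphism η) hA.1.over_id
      tulczyjewMorphism_pt
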